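/- Let $K\in\{-1,0,1\}$ and $a>0$, with $a<\pi/2$ if $K=1$. Put $J_1=(-\pi,\pi)$, $J_2=(-a,a)$, $\Omega_0=J_1\times J_2$, and let $f(x_2)=\cosh x_2,\ 1,\ \cos x_2$ for $K=-1,0,1$ respectively (so that $G=\mathrm{diag}(f^2,1)$ is the metric, in Fermi coordinates, of a strip of half-width $a$ around a geodesic of length $2\pi$ in a surface of constant curvature $K$). Let $d\nu_{(K)}=f\,dx_2$ on $J_2$ and $L^2(\Omega_0,G)=L^2(\Omega_0,f(x_2)\,dx_1dx_2)=L^2(J_1)\otimes L^2(J_2,d\nu_{(K)})$. Consider one of the following two types of boundary conditions at $x_2=\pm a$, with constant coefficients: (I) separated: $\partial_2\psi+(\pm\beta+i\alpha)\psi=0$ at $x_2=\pm a$, where $\alpha,\beta\in\mathbb R$; (II) connected: $\Psi(a)=B\,\Psi(-a)$, where $\Psi=\binom{\psi}{\partial_2\psi}$ and $B=\begin{pmatrix}\sqrt{1+bc}\,e^{i\phi}&b\\ c&\sqrt{1+bc}\,e^{-i\phi}\end{pmatrix}$ with $b>0$, $c\ge-1/b$, $\phi\in[-\pi,\pi)$.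 For $\iota\in\{\mathrm{I},\mathrm{II}\}$ let $H_{\iota(K)}$ be the operator $$H_{\iota(K)}\psi=-f^{-2}\,\partial_1^2\psi-f^{-1}\partial_2(f\,\partial_2\psi)$$ in $L^2(\Omega_0,G)$ whose domain consists of all $\psi\in W^{2,2}(\Omega_0)$ such that $\psi(-\pi,\cdot)=\psi(\pi,\cdot)$, $\partial_1\psi(-\pi,\cdot)=\partial_1\psi(\pi,\cdot)$ a.e. on $J_2$ and the condition ($\iota$) holds at $x_2=\pm a$ for a.e. $x_1\in J_1$ (in the sense of traces). For $m\in\mathbb Z$ let $H^m_{\iota(K)}$ be the operator $$H^m_{\iota(K)}\psi=-f^{-1}(f\,\psi')'+m^2f^{-2}\psi$$ in $L^2(J_2,d\nu_{(K)})$ whose domain consists of all $\psi\in W^{2,2}(J_2)$ that satisfy ($\iota$). Let $\phi_m(x_1)=(2\pi)^{-1/2}e^{imx_1}$ and $$(B^m\Psi)(x_1,x_2)=\big(\phi_m,\Psi(\cdot,x_2)\big)_{L^2(J_1)}\,\phi_m(x_1),\qquad \Psi\in L^2(\Omega_0,G).$$ Write $\varrho(T)$ for the resolvent set of $T$. Then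 $D:=\bigcap_{m\in\mathbb Z}\varrho\big(H^m_{\iota(K)}\big)$ is non-empty and $D\subset\varrho\big(H_{\iota(K)}\big)$. For every $z\in D$, $$\big(H_{\iota(K)}-z\big)^{-1}=\bigoplus_{m\in\mathbb Z}\big(H^m_{\iota(K)}-z\big)^{-1}B^m,$$ where $(H^m_{\iota(K)}-z)^{-1}$ on the right abbreviates the bounded operator $1\otimes(H^m_{\iota(K)}-z)^{-1}$ on $L^2(J_1)\otimes L^2(J_2,d\nu_{(K)})$. That is, the $B^m$ are mutually orthogonal orthogonal projections with $\sum_mB^m\Psi=\Psi$, each $1\otimes(H^m_{\iota(K)}-z)^{-1}$ commutes with $B^m$, and $(H_{\iota(K)}-z)^{-1}\Psi=\sum_m\big(1\otimes(H^m_{\iota(K)}-z)^{-1}\big)B^m\Psi$ for all $\Psi\in L^2(\Omega_0,G)$, both series converging unconditionally in $L^2(\Omega_0,G)$. -/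

import Mathlib

open MeasureTheory

noncomputable section

namespace PTStrip

/-! ## Weak derivatives and traces -/

/-- Test functions: complex-valued, smooth and compactly supported on the whole space. -/
def IsTest {E : Type*} [NormedAddCommGroup E] [NormedSpace ℝ E] (φ : E → ℂ) : Prop :=
  ContDiff ℝ (⊤ : ℕ∞) φ ∧ HasCompactSupport φ

/-- `u` and `v` are square-integrable on the open set `U`, and `v` is the weak (distributional)
derivative of `u` on `U` in the direction `e`. -/
structure HasWeakDeriv {E : Type*} [NormedAddCommGroup E] [NormedSpace ℝ E] [MeasureSpace E]
    (U : Set E) (e : E) (u v : E → ℂ) : Prop where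
  memLp_fun : MemLp u 2 (volume.restrict U)
  memLp_deriv : MemLp v 2 (volume.restrict U)
  integral_eq : ∀ φ : E → ℂ, IsTest φ → tsupport φ ⊆ U →
    ∫ x in U, u x * fderiv ℝ φ x e = - ∫ x in U, v x * φ x

/-- The interval `J₁ = (-π, π)` of the longitudinal variable `x₁`. -/
def J1 : Set ℝ := Set.Ioo (-Real.pi) Real.pi

/-- The interval `J₂ = (-a, a)` of the transverse variable `x₂`. -/
def J2 (a : ℝ) : Set ℝ := Set.Ioo (-a) a

/-- The rectangle `Ω₀ = J₁ × J₂`. -/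
def Omega0 (a : ℝ) : Set (ℝ × ℝ) := J1 ×ˢ J2 a

/-- Boundary values on an interval: for `u ∈ W^{1,2}(J₂)` with weak derivative `v`, the numbers
`gm` and `gp` are the values of `u` at `-a` and at `a`.  They are determined by Green's formula
(integration by parts) tested against all smooth functions on the closed interval. -/
structure HasEndValues (a : ℝ) (u v : ℝ → ℂ) (gm gp : ℂ) : Prop where
  memLp_fun : MemLp u 2 (volume.restrict (J2 a))
  memLp_deriv : MemLp v 2 (volume.restrict (J2 a))
  green : ∀ φ : ℝ → ℂ, IsTest φ →
    ∫ x in J2 a, (u x * fderiv ℝ φ x 1 + v x * φ x) = gp * φ a - gm * φ (-a)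

/-- Traces on the sides `x₁ = ± π` of the rectangle: for `u ∈ W^{1,2}(Ω₀)` with `v = ∂₁ u`, the
functions `gm, gp ∈ L²(J₂)` are the traces of `u` on `{-π} × J₂` and on `{π} × J₂`; they are
determined by Green's formula tested against all smooth functions on the closed rectangle. -/
structure HasTraces1 (a : ℝ) (u v : ℝ × ℝ → ℂ) (gm gp : ℝ → ℂ) : Prop where
  memLp_fun : MemLp u 2 (volume.restrict (Omega0 a))
  memLp_deriv : MemLp v 2 (volume.restrict (Omega0 a))
  memLp_minus : MemLp gm 2 (volume.restrict (J2 a))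
  memLp_plus : MemLp gp 2 (volume.restrict (J2 a))
  green : ∀ φ : ℝ × ℝ → ℂ, IsTest φ →
    ∫ x in Omega0 a, (u x * fderiv ℝ φ x (1, 0) + v x * φ x) =
      ∫ y in J2 a, (gp y * φ (Real.pi, y) - gm y * φ (-Real.pi, y))

/-- Traces on the sides `x₂ = ± a` of the rectangle: for `u ∈ W^{1,2}(Ω₀)` with `v = ∂₂ u`, the
functions `gm, gp ∈ L²(J₁)` are the traces of `u` on `J₁ × {-a}` and on `J₁ × {a}`. -/
structure HasTraces2 (a : ℝ) (u v : ℝ × ℝ → ℂ) (gm gp : ℝ → ℂ) : Prop where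
  memLp_fun : MemLp u 2 (volume.restrict (Omega0 a))
  memLp_deriv : MemLp v 2 (volume.restrict (Omega0 a))
  memLp_minus : MemLp gm 2 (volume.restrict J1)
  memLp_plus : MemLp gp 2 (volume.restrict J1)
  green : ∀ φ : ℝ × ℝ → ℂ, IsTest φ →
    ∫ x in Omega0 a, (u x * fderiv ℝ φ x (0, 1) + v x * φ x) =
      ∫ t in J1, (gp t * φ (t, a) - gm t * φ (t, -a))

/-! ## Geometry -/

/-- The function `f_K` of the metric `G = diag(f², 1)` in Fermi coordinates around a geodesic of a
surface of constant curvature `K ∈ {-1, 0, 1}` (a value of `SignType`). -/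
def warp (K : SignType) (y : ℝ) : ℝ :=
  match K with
  | .neg => Real.cosh y
  | .zero => 1
  | .pos => Real.cos y

/-- The logarithmic derivative `f_K' / f_K`. -/
def drift (K : SignType) (y : ℝ) : ℝ :=
  match K with
  | .neg => Real.tanh y
  | .zero => 0
  | .pos => - Real.tan y

/-- The measure `dν_K = f_K dx₂` on `J₂`. -/
def nu (K : SignType) (a : ℝ) : Measure ℝ :=
  (volume.restrict (J2 a)).withDensity fun y => ENNReal.ofReal (warp K y)

/-- The Riemannian measure `|G|^{1/2} dx = f_K(x₂) dx₁ dx₂` on `Ω₀`, written as `dx₁ ⊗ dν_K`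
(see `muG_eq`). -/
def muG (K : SignType) (a : ℝ) : Measure (ℝ × ℝ) := (volume.restrict J1).prod (nu K a)

/-- `L²(J₁)`. -/
abbrev L2J1 : Type := Lp ℂ 2 (volume.restrict J1)

/-- `L²(J₂, dν_K)`. -/
abbrev L2J2 (K : SignType) (a : ℝ) : Type := Lp ℂ 2 (nu K a)

/-- `L²(Ω₀, G)`. -/
abbrev L2Omega (K : SignType) (a : ℝ) : Type := Lp ℂ 2 (muG K a)

/-! ## Boundary conditions -/

/-- Constant coupling constants of the two types of boundary conditions: separated and
connected. -/
inductive Coupling : Type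
  | separated (α β : ℝ) : Coupling
  | connected (b c φ : ℝ) (hb : 0 < b) (hc : -1 / b ≤ c) (hφ : φ ∈ Set.Ico (-Real.pi) Real.pi) :
      Coupling

/-- The matrix `B` of the connected boundary conditions. -/
def connMatrix (b c φ : ℝ) : Matrix (Fin 2) (Fin 2) ℂ :=
  !![(Real.sqrt (1 + b * c) : ℂ) * Complex.exp (Complex.I * φ), (b : ℂ);
    (c : ℂ), (Real.sqrt (1 + b * c) : ℂ) * Complex.exp (-(Complex.I * φ))]

/-- The boundary conditions for the values `gm = ψ(-a)`, `gp = ψ(a)`, `hm = ψ'(-a)`, `hp = ψ'(a)`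
(the derivative being with respect to `x₂`). -/
def Coupling.Holds : Coupling → (gm gp hm hp : ℂ) → Prop
  | .separated α β, gm, gp, hm, hp =>
      hp + (β + Complex.I * α) * gp = 0 ∧ hm + (-β + Complex.I * α) * gm = 0
  | .connected b c φ _ _ _, gm, gp, hm, hp =>
      ![gp, hp] = Matrix.mulVec (connMatrix b c φ) ![gm, hm]

/-! ## The two-dimensional Hamiltonian -/

/-- `u ∈ W^{2,2}(Ω₀)` with the indicated weak derivatives. -/
structure IsW22 (a : ℝ) (u u1 u2 u11 u12 u22 : ℝ × ℝ → ℂ) : Prop where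
  d1 : HasWeakDeriv (Omega0 a) (1, 0) u u1
  d2 : HasWeakDeriv (Omega0 a) (0, 1) u u2
  d11 : HasWeakDeriv (Omega0 a) (1, 0) u1 u11
  d12 : HasWeakDeriv (Omega0 a) (0, 1) u1 u12
  d21 : HasWeakDeriv (Omega0 a) (1, 0) u2 u12
  d22 : HasWeakDeriv (Omega0 a) (0, 1) u2 u22

/-- Periodicity of `u` and of `∂₁ u` in the variable `x₁`, in the sense of traces. -/
def PeriodicBC (a : ℝ) (u u1 u11 : ℝ × ℝ → ℂ) : Prop :=
  (∃ gm gp, HasTraces1 a u u1 gm gp ∧ gm =ᵐ[volume.restrict (J2 a)] gp) ∧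
  (∃ hm hp, HasTraces1 a u1 u11 hm hp ∧ hm =ᵐ[volume.restrict (J2 a)] hp)

/-- The boundary conditions on `x₂ = ± a`, in the sense of traces. -/
def CouplingBC (κ : Coupling) (a : ℝ) (u u2 u22 : ℝ × ℝ → ℂ) : Prop :=
  ∃ gm gp hm hp, HasTraces2 a u u2 gm gp ∧ HasTraces2 a u2 u22 hm hp ∧
    ∀ᵐ t ∂(volume.restrict J1), κ.Holds (gm t) (gp t) (hm t) (hp t)

/-- The Laplace–Beltrami expression
`-Δ_G u = - f⁻² ∂₁² u - ∂₂² u - (f'/f) ∂₂ u`. -/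
def action2 (K : SignType) (u2 u11 u22 : ℝ × ℝ → ℂ) (x : ℝ × ℝ) : ℂ :=
  -(((warp K x.2 ^ 2)⁻¹ : ℝ) : ℂ) * u11 x - u22 x - (drift K x.2 : ℂ) * u2 x

/-- `u` is a `W^{2,2}(Ω₀)` function satisfying both boundary conditions, and `F = -Δ_G u`. -/
def StripRel (K : SignType) (a : ℝ) (κ : Coupling) (ψ F : ℝ × ℝ → ℂ) : Prop :=
  ∃ u u1 u2 u11 u12 u22 : ℝ × ℝ → ℂ, ψ =ᵐ[muG K a] u ∧
    IsW22 a u u1 u2 u11 u12 u22 ∧ PeriodicBC a u u1 u11 ∧ CouplingBC κ a u u2 u22 ∧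
    F =ᵐ[muG K a] action2 K u2 u11 u22

/-! ## The transverse one-dimensional operators -/

/-- The expression `-u'' - (f'/f) u' + m² f⁻² u`. -/
def action1 (K : SignType) (m : ℤ) (u u1 u2 : ℝ → ℂ) (y : ℝ) : ℂ :=
  - u2 y - (drift K y : ℂ) * u1 y + (((m : ℝ) ^ 2 * (warp K y ^ 2)⁻¹ : ℝ) : ℂ) * u y

/-- `ψ` is a `W^{2,2}(J₂)` function satisfying the boundary conditions, and
`F = -ψ'' - (f'/f) ψ' + m² f⁻² ψ`. -/
def TransRel (K : SignType) (a : ℝ) (κ : Coupling) (m : ℤ) (ψ F : ℝ → ℂ) : Prop :=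
  ∃ u u1 u2 : ℝ → ℂ, ψ =ᵐ[nu K a] u ∧
    HasWeakDeriv (J2 a) 1 u u1 ∧ HasWeakDeriv (J2 a) 1 u1 u2 ∧
    (∃ gm gp hm hp, HasEndValues a u u1 gm gp ∧ HasEndValues a u1 u2 hm hp ∧
      κ.Holds gm gp hm hp) ∧
    F =ᵐ[nu K a] action1 K m u u1 u2

/-! ## Facts needed to turn these relations into linear operators -/

lemma IsTest.memLp {E : Type*} [NormedAddCommGroup E] [NormedSpace ℝ E] [MeasurableSpace E]
    [BorelSpace E] {φ : E → ℂ} (h : IsTest φ)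
    (μ : Measure E) [IsFiniteMeasureOnCompacts μ] : MemLp φ 2 μ :=
  h.1.continuous.memLp_of_hasCompactSupport h.2

lemma IsTest.memLp_fderiv {E : Type*} [NormedAddCommGroup E] [NormedSpace ℝ E]
    [MeasurableSpace E] [BorelSpace E] {φ : E → ℂ} (h : IsTest φ) (e : E)
    (μ : Measure E) [IsFiniteMeasureOnCompacts μ] : MemLp (fun x => fderiv ℝ φ x e) 2 μ :=
  Continuous.memLp_of_hasCompactSupport
    ((h.1.continuous_fderiv (by simp)).clm_apply continuous_const) (h.2.fderiv_apply ℝ e)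

lemma integrable_mul_of_memLp {α : Type*} [MeasurableSpace α] {μ : Measure α} {u v : α → ℂ}
    (hu : MemLp u 2 μ) (hv : MemLp v 2 μ) : Integrable (fun x => u x * v x) μ :=
  hu.integrable_mul hv

lemma integrable_mul_add {α : Type*} [MeasurableSpace α] {μ : Measure α} {u v u' v' : α → ℂ}
    (hu : MemLp u 2 μ) (hv : MemLp v 2 μ) (hu' : MemLp u' 2 μ) (hv' : MemLp v' 2 μ) :
    Integrable (fun x => u x * v x + u' x * v' x) μ :=
  (integrable_mul_of_memLp hu hv).add (integrable_mul_of_memLp hu' hv')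

lemma integrable_mul_sub {α : Type*} [MeasurableSpace α] {μ : Measure α} {u v u' v' : α → ℂ}
    (hu : MemLp u 2 μ) (hv : MemLp v 2 μ) (hu' : MemLp u' 2 μ) (hv' : MemLp v' 2 μ) :
    Integrable (fun x => u x * v x - u' x * v' x) μ :=
  (integrable_mul_of_memLp hu hv).sub (integrable_mul_of_memLp hu' hv')

lemma integral_lin {α : Type*} [MeasurableSpace α] {μ : Measure α} (c : ℂ) {f g : α → ℂ}
    (hf : Integrable f μ) (hg : Integrable g μ) :
    ∫ x, (c * f x + g x) ∂μ = c * ∫ x, f x ∂μ + ∫ x, g x ∂μ := by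
  rw [integral_add (hf.const_mul c) hg, integral_const_mul]

lemma memLp_lin {α : Type*} [MeasurableSpace α] {μ : Measure α} (c : ℂ) {f g : α → ℂ}
    (hf : MemLp f 2 μ) (hg : MemLp g 2 μ) : MemLp (fun x => c * f x + g x) 2 μ :=
  (hf.const_mul c).add hg

lemma HasWeakDeriv.lin {E : Type*} [NormedAddCommGroup E] [NormedSpace ℝ E] [MeasureSpace E]
    [BorelSpace E] [IsFiniteMeasureOnCompacts (volume : Measure E)] (c : ℂ)
    {U : Set E} {e : E} {u v u' v' : E → ℂ} (h : HasWeakDeriv U e u v)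
    (h' : HasWeakDeriv U e u' v') :
    HasWeakDeriv U e (fun x => c * u x + u' x) (fun x => c * v x + v' x) where
  memLp_fun := memLp_lin c h.memLp_fun h'.memLp_fun
  memLp_deriv := memLp_lin c h.memLp_deriv h'.memLp_deriv
  integral_eq φ hφ hU := by
    have i1 := h.integral_eq φ hφ hU
    have i2 := h'.integral_eq φ hφ hU
    simp only [add_mul, mul_assoc]
    rw [integral_lin c (integrable_mul_of_memLp h.memLp_fun (hφ.memLp_fderiv e _))
        (integrable_mul_of_memLp h'.memLp_fun (hφ.memLp_fderiv e _)),
      integral_lin c (integrable_mul_of_memLp h.memLp_deriv (hφ.memLp _))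
        (integrable_mul_of_memLp h'.memLp_deriv (hφ.memLp _)), i1, i2]
    ring

lemma HasWeakDeriv.zero {E : Type*} [NormedAddCommGroup E] [NormedSpace ℝ E] [MeasureSpace E]
    (U : Set E) (e : E) : HasWeakDeriv U e (fun _ => 0) (fun _ => 0) :=
  ⟨MemLp.zero, MemLp.zero, fun φ _ _ => by simp⟩

/-- The weak derivative of a function that vanishes almost everywhere vanishes almost
everywhere. -/
lemma HasWeakDeriv.ae_zero {E : Type*} [NormedAddCommGroup E] [NormedSpace ℝ E]
    [FiniteDimensional ℝ E] [MeasureSpace E]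
    [BorelSpace E] [IsLocallyFiniteMeasure (volume : Measure E)]
    {U : Set E} (hU : IsOpen U) {e : E} {u v : E → ℂ}
    (h : HasWeakDeriv U e u v) (h0 : u =ᵐ[volume.restrict U] fun _ => 0) :
    v =ᵐ[volume.restrict U] fun _ => 0 := by
  have hloc : LocallyIntegrableOn v U volume :=
    locallyIntegrableOn_of_locallyIntegrable_restrict
      (h.memLp_deriv.locallyIntegrable (by norm_num))
  have key := hU.ae_eq_zero_of_integral_contDiff_smul_eq_zero hloc ?_
  · exact (ae_restrict_iff' hU.measurableSet).2 key
  intro g hg hgc hgU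
  have hsub : Function.support (fun x => (g x : ℂ)) = Function.support g := by
    ext x; simp
  have hts : tsupport (fun x => (g x : ℂ)) = tsupport g := by
    rw [tsupport, hsub, ← tsupport]
  have ht : IsTest (fun x => (g x : ℂ)) := by
    refine ⟨Complex.ofRealCLM.contDiff.comp hg, ?_⟩
    rw [HasCompactSupport, hts]; exact hgc
  have h1 := h.integral_eq _ ht (by rw [hts]; exact hgU)
  have h2 : ∫ x in U, u x * fderiv ℝ (fun x => (g x : ℂ)) x e = 0 := by
    rw [← integral_zero E ℂ]
    refine integral_congr_ae ?_
    filter_upwards [h0] with x hx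
    simp [hx]
  rw [h2] at h1
  have h3 : ∫ x in U, v x * (g x : ℂ) = ∫ x, v x * (g x : ℂ) := by
    refine setIntegral_eq_integral_of_forall_compl_eq_zero fun x hx => ?_
    have : g x = 0 := image_eq_zero_of_notMem_tsupport fun hx' => hx (hgU hx')
    simp [this]
  rw [h3] at h1
  have h4 : ∀ x, g x • v x = v x * (g x : ℂ) := fun x => by
    rw [Complex.real_smul, mul_comm]
  simp only [h4]
  exact (neg_eq_zero.1 h1.symm)

lemma HasEndValues.lin (c : ℂ) {a : ℝ} {u v u' v' : ℝ → ℂ} {gm gp gm' gp' : ℂ}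
    (h : HasEndValues a u v gm gp) (h' : HasEndValues a u' v' gm' gp') :
    HasEndValues a (fun x => c * u x + u' x) (fun x => c * v x + v' x)
      (c * gm + gm') (c * gp + gp') where
  memLp_fun := memLp_lin c h.memLp_fun h'.memLp_fun
  memLp_deriv := memLp_lin c h.memLp_deriv h'.memLp_deriv
  green φ hφ := by
    have e1 : ∀ x, (c * u x + u' x) * fderiv ℝ φ x 1 + (c * v x + v' x) * φ x =
        c * (u x * fderiv ℝ φ x 1 + v x * φ x) + (u' x * fderiv ℝ φ x 1 + v' x * φ x) :=
      fun x => by ring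
    simp only [e1]
    rw [integral_lin c
      (integrable_mul_add h.memLp_fun (hφ.memLp_fderiv _ _) h.memLp_deriv (hφ.memLp _))
      (integrable_mul_add h'.memLp_fun (hφ.memLp_fderiv _ _) h'.memLp_deriv (hφ.memLp _)), h.green φ hφ, h'.green φ hφ]
    ring

instance isFiniteMeasure_J1 : IsFiniteMeasure (volume.restrict J1) :=
  inferInstanceAs (IsFiniteMeasure (volume.restrict (Set.Ioo _ _)))

instance isFiniteMeasure_J2 (a : ℝ) : IsFiniteMeasure (volume.restrict (J2 a)) :=
  inferInstanceAs (IsFiniteMeasure (volume.restrict (Set.Ioo _ _)))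

lemma IsTest.memLp_slice1 {φ : ℝ × ℝ → ℂ} (hφ : IsTest φ) (t : ℝ) (a : ℝ) :
    MemLp (fun y => φ (t, y)) 2 (volume.restrict (J2 a)) := by
  have hc : Continuous fun y => φ (t, y) := hφ.1.continuous.comp (by fun_prop)
  obtain ⟨C, hC⟩ := hφ.1.continuous.bounded_above_of_compact_support hφ.2
  exact MemLp.of_bound hc.aestronglyMeasurable C (Filter.Eventually.of_forall fun y => hC _)

lemma IsTest.memLp_slice2 {φ : ℝ × ℝ → ℂ} (hφ : IsTest φ) (y : ℝ) :
    MemLp (fun t => φ (t, y)) 2 (volume.restrict J1) := by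
  have hc : Continuous fun t => φ (t, y) := hφ.1.continuous.comp (by fun_prop)
  obtain ⟨C, hC⟩ := hφ.1.continuous.bounded_above_of_compact_support hφ.2
  exact MemLp.of_bound hc.aestronglyMeasurable C (Filter.Eventually.of_forall fun y => hC _)

lemma HasTraces1.lin (c : ℂ) {a : ℝ} {u v u' v' : ℝ × ℝ → ℂ} {gm gp gm' gp' : ℝ → ℂ}
    (h : HasTraces1 a u v gm gp) (h' : HasTraces1 a u' v' gm' gp') :
    HasTraces1 a (fun x => c * u x + u' x) (fun x => c * v x + v' x)
      (fun y => c * gm y + gm' y) (fun y => c * gp y + gp' y) where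
  memLp_fun := memLp_lin c h.memLp_fun h'.memLp_fun
  memLp_deriv := memLp_lin c h.memLp_deriv h'.memLp_deriv
  memLp_minus := memLp_lin c h.memLp_minus h'.memLp_minus
  memLp_plus := memLp_lin c h.memLp_plus h'.memLp_plus
  green φ hφ := by
    have e1 : ∀ x, (c * u x + u' x) * fderiv ℝ φ x (1, 0) + (c * v x + v' x) * φ x =
        c * (u x * fderiv ℝ φ x (1, 0) + v x * φ x) +
          (u' x * fderiv ℝ φ x (1, 0) + v' x * φ x) := fun x => by ring
    have e2 : ∀ y, (c * gp y + gp' y) * φ (Real.pi, y) - (c * gm y + gm' y) * φ (-Real.pi, y) =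
        c * (gp y * φ (Real.pi, y) - gm y * φ (-Real.pi, y)) +
          (gp' y * φ (Real.pi, y) - gm' y * φ (-Real.pi, y)) := fun y => by ring
    simp only [e1, e2]
    rw [integral_lin c
      (integrable_mul_add h.memLp_fun (hφ.memLp_fderiv _ _) h.memLp_deriv (hφ.memLp _))
      (integrable_mul_add h'.memLp_fun (hφ.memLp_fderiv _ _) h'.memLp_deriv (hφ.memLp _)), h.green φ hφ, h'.green φ hφ,
      integral_lin c
      (integrable_mul_sub h.memLp_plus (hφ.memLp_slice1 _ _) h.memLp_minus (hφ.memLp_slice1 _ _))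
      (integrable_mul_sub h'.memLp_plus (hφ.memLp_slice1 _ _) h'.memLp_minus (hφ.memLp_slice1 _ _))]

lemma HasTraces2.lin (c : ℂ) {a : ℝ} {u v u' v' : ℝ × ℝ → ℂ} {gm gp gm' gp' : ℝ → ℂ}
    (h : HasTraces2 a u v gm gp) (h' : HasTraces2 a u' v' gm' gp') :
    HasTraces2 a (fun x => c * u x + u' x) (fun x => c * v x + v' x)
      (fun t => c * gm t + gm' t) (fun t => c * gp t + gp' t) where
  memLp_fun := memLp_lin c h.memLp_fun h'.memLp_fun
  memLp_deriv := memLp_lin c h.memLp_deriv h'.memLp_deriv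
  memLp_minus := memLp_lin c h.memLp_minus h'.memLp_minus
  memLp_plus := memLp_lin c h.memLp_plus h'.memLp_plus
  green φ hφ := by
    have e1 : ∀ x, (c * u x + u' x) * fderiv ℝ φ x (0, 1) + (c * v x + v' x) * φ x =
        c * (u x * fderiv ℝ φ x (0, 1) + v x * φ x) +
          (u' x * fderiv ℝ φ x (0, 1) + v' x * φ x) := fun x => by ring
    have e2 : ∀ t, (c * gp t + gp' t) * φ (t, a) - (c * gm t + gm' t) * φ (t, -a) =
        c * (gp t * φ (t, a) - gm t * φ (t, -a)) +
          (gp' t * φ (t, a) - gm' t * φ (t, -a)) := fun t => by ring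
    simp only [e1, e2]
    rw [integral_lin c
      (integrable_mul_add h.memLp_fun (hφ.memLp_fderiv _ _) h.memLp_deriv (hφ.memLp _))
      (integrable_mul_add h'.memLp_fun (hφ.memLp_fderiv _ _) h'.memLp_deriv (hφ.memLp _)), h.green φ hφ, h'.green φ hφ,
      integral_lin c
      (integrable_mul_sub h.memLp_plus (hφ.memLp_slice2 _) h.memLp_minus (hφ.memLp_slice2 _))
      (integrable_mul_sub h'.memLp_plus (hφ.memLp_slice2 _) h'.memLp_minus (hφ.memLp_slice2 _))]

lemma HasEndValues.zero (a : ℝ) : HasEndValues a (fun _ => 0) (fun _ => 0) 0 0 :=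
  ⟨MemLp.zero, MemLp.zero, fun φ _ => by simp⟩

lemma HasTraces1.zero (a : ℝ) :
    HasTraces1 a (fun _ => 0) (fun _ => 0) (fun _ => 0) (fun _ => 0) :=
  ⟨MemLp.zero, MemLp.zero, MemLp.zero, MemLp.zero, fun φ _ => by simp⟩

lemma HasTraces2.zero (a : ℝ) :
    HasTraces2 a (fun _ => 0) (fun _ => 0) (fun _ => 0) (fun _ => 0) :=
  ⟨MemLp.zero, MemLp.zero, MemLp.zero, MemLp.zero, fun φ _ => by simp⟩

lemma Coupling.Holds.lin {κ : Coupling} (c : ℂ) {gm gp hm hp gm' gp' hm' hp' : ℂ}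
    (h : κ.Holds gm gp hm hp) (h' : κ.Holds gm' gp' hm' hp') :
    κ.Holds (c * gm + gm') (c * gp + gp') (c * hm + hm') (c * hp + hp') := by
  cases κ with
  | separated α β =>
    obtain ⟨h1, h2⟩ := h
    obtain ⟨h1', h2'⟩ := h'
    constructor
    · linear_combination c * h1 + h1'
    · linear_combination c * h2 + h2'
  | connected b d φ _ _ _ =>
    have e : ∀ p q p' q' : ℂ, ![c * p + p', c * q + q'] = c • ![p, q] + ![p', q'] := by
      intro p q p' q'
      ext i
      fin_cases i <;> simp
    simp only [Coupling.Holds] at h h' ⊢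
    rw [e, e, h, h', Matrix.mulVec_add, Matrix.mulVec_smul]

lemma Coupling.Holds.zero (κ : Coupling) : κ.Holds 0 0 0 0 := by
  cases κ with
  | separated α β => simp [Coupling.Holds]
  | connected b d φ _ _ _ =>
    simp only [Coupling.Holds]
    ext i
    fin_cases i <;> simp [Matrix.mulVec, dotProduct]

lemma TransRel.lin {K : SignType} {a : ℝ} {κ : Coupling} {m : ℤ} (c : ℂ) {ψ F ψ' F' : ℝ → ℂ}
    (h : TransRel K a κ m ψ F) (h' : TransRel K a κ m ψ' F') :
    TransRel K a κ m (fun y => c * ψ y + ψ' y) (fun y => c * F y + F' y) := by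
  obtain ⟨u, u1, u2, hu, d1, d2, ⟨gm, gp, hm, hp, t1, t2, hB⟩, hF⟩ := h
  obtain ⟨v, v1, v2, hv, d1', d2', ⟨gm', gp', hm', hp', t1', t2', hB'⟩, hF'⟩ := h'
  refine ⟨_, _, _, ?_, d1.lin c d1', d2.lin c d2',
    ⟨_, _, _, _, t1.lin c t1', t2.lin c t2', hB.lin c hB'⟩, ?_⟩
  · filter_upwards [hu, hv] with y h1 h2
    rw [h1, h2]
  · filter_upwards [hF, hF'] with y h1 h2
    rw [h1, h2]
    simp only [action1]
    ring

lemma StripRel.lin {K : SignType} {a : ℝ} {κ : Coupling} (c : ℂ) {ψ F ψ' F' : ℝ × ℝ → ℂ}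
    (h : StripRel K a κ ψ F) (h' : StripRel K a κ ψ' F') :
    StripRel K a κ (fun x => c * ψ x + ψ' x) (fun x => c * F x + F' x) := by
  obtain ⟨u, u1, u2, u11, u12, u22, hu, W, ⟨⟨gm, gp, p1, q1⟩, ⟨hm, hp, p2, q2⟩⟩,
    ⟨km, kp, lm, lp, t1, t2, hB⟩, hF⟩ := h
  obtain ⟨v, v1, v2, v11, v12, v22, hv, W', ⟨⟨gm', gp', p1', q1'⟩, ⟨hm', hp', p2', q2'⟩⟩,
    ⟨km', kp', lm', lp', t1', t2', hB'⟩, hF'⟩ := h'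
  refine ⟨_, _, _, _, _, _, ?_, ⟨W.d1.lin c W'.d1, W.d2.lin c W'.d2, W.d11.lin c W'.d11,
    W.d12.lin c W'.d12, W.d21.lin c W'.d21, W.d22.lin c W'.d22⟩,
    ⟨⟨_, _, p1.lin c p1', ?_⟩, ⟨_, _, p2.lin c p2', ?_⟩⟩,
    ⟨_, _, _, _, t1.lin c t1', t2.lin c t2', ?_⟩, ?_⟩
  · filter_upwards [hu, hv] with y h1 h2
    rw [h1, h2]
  · filter_upwards [q1, q1'] with y h1 h2
    rw [h1, h2]
  · filter_upwards [q2, q2'] with y h1 h2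
    rw [h1, h2]
  · filter_upwards [hB, hB'] with y h1 h2
    exact h1.lin c h2
  · filter_upwards [hF, hF'] with y h1 h2
    rw [h1, h2]
    simp only [action2]
    ring

lemma TransRel.congr {K : SignType} {a : ℝ} {κ : Coupling} {m : ℤ} {ψ F ψ' F' : ℝ → ℂ}
    (h : TransRel K a κ m ψ F) (h1 : ψ' =ᵐ[nu K a] ψ) (h2 : F' =ᵐ[nu K a] F) :
    TransRel K a κ m ψ' F' := by
  obtain ⟨u, u1, u2, hu, d1, d2, hB, hF⟩ := h
  exact ⟨u, u1, u2, h1.trans hu, d1, d2, hB, h2.trans hF⟩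

lemma StripRel.congr {K : SignType} {a : ℝ} {κ : Coupling} {ψ F ψ' F' : ℝ × ℝ → ℂ}
    (h : StripRel K a κ ψ F) (h1 : ψ' =ᵐ[muG K a] ψ) (h2 : F' =ᵐ[muG K a] F) :
    StripRel K a κ ψ' F' := by
  obtain ⟨u, u1, u2, u11, u12, u22, hu, W, hP, hB, hF⟩ := h
  exact ⟨u, u1, u2, u11, u12, u22, h1.trans hu, W, hP, hB, h2.trans hF⟩

lemma TransRel.zero (K : SignType) (a : ℝ) (κ : Coupling) (m : ℤ) :
    TransRel K a κ m (fun _ => 0) (fun _ => 0) :=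
  ⟨_, _, _, Filter.EventuallyEq.rfl, HasWeakDeriv.zero _ _, HasWeakDeriv.zero _ _,
    ⟨0, 0, 0, 0, HasEndValues.zero a, HasEndValues.zero a, Coupling.Holds.zero κ⟩,
    Filter.Eventually.of_forall fun y => by simp [action1]⟩

lemma StripRel.zero (K : SignType) (a : ℝ) (κ : Coupling) :
    StripRel K a κ (fun _ => 0) (fun _ => 0) :=
  ⟨_, _, _, _, fun _ => 0, _, Filter.EventuallyEq.rfl,
    ⟨HasWeakDeriv.zero _ _, HasWeakDeriv.zero _ _, HasWeakDeriv.zero _ _, HasWeakDeriv.zero _ _,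
      HasWeakDeriv.zero _ _, HasWeakDeriv.zero _ _⟩,
    ⟨⟨_, _, HasTraces1.zero a, Filter.EventuallyEq.rfl⟩,
      ⟨_, _, HasTraces1.zero a, Filter.EventuallyEq.rfl⟩⟩,
    ⟨_, _, _, _, HasTraces2.zero a, HasTraces2.zero a,
      Filter.Eventually.of_forall fun _ => Coupling.Holds.zero κ⟩,
    Filter.Eventually.of_forall fun y => by simp [action2]⟩

/-- The linear relation underlying the transverse operator `H^m`. -/
def transGraph (K : SignType) (a : ℝ) (κ : Coupling) (m : ℤ) :
    Submodule ℂ (L2J2 K a × L2J2 K a) where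
  carrier := {p | TransRel K a κ m p.1 p.2}
  zero_mem' := (TransRel.zero K a κ m).congr (Lp.coeFn_zero ..) (Lp.coeFn_zero ..)
  add_mem' {p q} hp hq := by
    refine (TransRel.lin 1 hp hq).congr ?_ ?_
    · filter_upwards [Lp.coeFn_add p.1 q.1] with x hx
      simpa using hx
    · filter_upwards [Lp.coeFn_add p.2 q.2] with x hx
      simpa using hx
  smul_mem' c p hp := by
    refine (TransRel.lin c hp (TransRel.zero K a κ m)).congr ?_ ?_
    · filter_upwards [Lp.coeFn_smul c p.1] with x hx
      simpa using hx
    · filter_upwards [Lp.coeFn_smul c p.2] with x hx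
      simpa using hx

/-- The linear relation underlying the Hamiltonian `H`. -/
def stripGraph (K : SignType) (a : ℝ) (κ : Coupling) :
    Submodule ℂ (L2Omega K a × L2Omega K a) where
  carrier := {p | StripRel K a κ p.1 p.2}
  zero_mem' := (StripRel.zero K a κ).congr (Lp.coeFn_zero ..) (Lp.coeFn_zero ..)
  add_mem' {p q} hp hq := by
    refine (StripRel.lin 1 hp hq).congr ?_ ?_
    · filter_upwards [Lp.coeFn_add p.1 q.1] with x hx
      simpa using hx
    · filter_upwards [Lp.coeFn_add p.2 q.2] with x hx
      simpa using hx
  smul_mem' c p hp := by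
    refine (StripRel.lin c hp (StripRel.zero K a κ)).congr ?_ ?_
    · filter_upwards [Lp.coeFn_smul c p.1] with x hx
      simpa using hx
    · filter_upwards [Lp.coeFn_smul c p.2] with x hx
      simpa using hx

/-- The transverse operator `H^m_{ι(K)}` in `L²(J₂, dν_K)`: its domain consists of the
`W^{2,2}(J₂)` functions that satisfy the boundary conditions, and
`H^m ψ = -ψ'' - (f'/f) ψ' + m² f⁻² ψ` (see `mem_transGraph_iff`). -/
def transOp (K : SignType) (a : ℝ) (κ : Coupling) (m : ℤ) : L2J2 K a →ₗ.[ℂ] L2J2 K a :=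
  (transGraph K a κ m).toLinearPMap

/-- The Hamiltonian `H_{ι(K)}` in `L²(Ω₀, G)`: its domain consists of the `W^{2,2}(Ω₀)` functions
that are periodic in `x₁` and satisfy the boundary conditions at `x₂ = ± a`, and `H ψ = -Δ_G ψ`
(see `mem_stripGraph_iff`).  As `f_K` is bounded and bounded away from zero on `J₂` (for `a < π/2`
if `K = 1`), `-Δ_G ψ` belongs to `L²(Ω₀, G)` for every such `ψ`. -/
def stripOp (K : SignType) (a : ℝ) (κ : Coupling) : L2Omega K a →ₗ.[ℂ] L2Omega K a :=
  (stripGraph K a κ).toLinearPMap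

/-! ## Consistency of the definitions: the metric and the single-valuedness of the operators -/

lemma continuous_warp (K : SignType) : Continuous (warp K) := by
  cases K
  · exact continuous_const
  · exact Real.continuous_cosh
  · exact Real.continuous_cos

lemma warp_pos {K : SignType} {a : ℝ} (hK : K = 1 → a < Real.pi / 2) {y : ℝ} (hy : y ∈ J2 a) :
    0 < warp K y := by
  cases K
  · exact one_pos
  · exact Real.cosh_pos y
  · have := hK rfl
    exact Real.cos_pos_of_mem_Ioo ⟨by linarith [hy.1], by linarith [hy.2]⟩

/-- `f_K` is the solution of the Jacobi equation `f'' + K f = 0`, `f(0) = 1`, `f'(0) = 0`, and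
`drift K` is its logarithmic derivative (where `f_K` does not vanish). -/
lemma warp_jacobi (K : SignType) :
    (∀ y, deriv (deriv (warp K)) y + ((K : ℝ)) * warp K y = 0) ∧ warp K 0 = 1 ∧
      deriv (warp K) 0 = 0 ∧ ∀ y, warp K y ≠ 0 → drift K y = deriv (warp K) y / warp K y := by
  cases K
  · have : warp 0 = fun _ => (1 : ℝ) := rfl
    simp [this, drift]
  · have : warp (-1) = Real.cosh := rfl
    simp [this, drift, Real.tanh_eq_sinh_div_cosh]
  · have : warp 1 = Real.cos := rfl
    simp [this, drift, Real.tan_eq_sin_div_cos, neg_div]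

lemma muG_eq (K : SignType) (a : ℝ) :
    muG K a = (volume.restrict (Omega0 a)).withDensity fun x => ENNReal.ofReal (warp K x.2) := by
  have hm : Measurable fun y => ENNReal.ofReal (warp K y) :=
    ENNReal.measurable_ofReal.comp (continuous_warp K).measurable
  rw [muG, nu, prod_withDensity_right hm, Measure.prod_restrict]
  rfl

lemma restrict_ac_nu {K : SignType} {a : ℝ} (hK : K = 1 → a < Real.pi / 2) :
    volume.restrict (J2 a) ≪ nu K a := by
  refine withDensity_absolutelyContinuous'
    (ENNReal.measurable_ofReal.comp (continuous_warp K).measurable).aemeasurable ?_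
  refine (ae_restrict_iff' measurableSet_Ioo).2 (Filter.Eventually.of_forall fun y hy => ?_)
  simpa using warp_pos hK hy

lemma restrict_ac_muG {K : SignType} {a : ℝ} (hK : K = 1 → a < Real.pi / 2) :
    volume.restrict (Omega0 a) ≪ muG K a := by
  rw [muG_eq]
  refine withDensity_absolutelyContinuous' (ENNReal.measurable_ofReal.comp
    ((continuous_warp K).comp continuous_snd).measurable).aemeasurable ?_
  refine (ae_restrict_iff' (measurableSet_Ioo.prod measurableSet_Ioo)).2
    (Filter.Eventually.of_forall fun y hy => ?_)
  simpa using warp_pos hK hy.2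

lemma isOpen_Omega0 (a : ℝ) : IsOpen (Omega0 a) := isOpen_Ioo.prod isOpen_Ioo

lemma transGraph_single {K : SignType} {a : ℝ} (hK : K = 1 → a < Real.pi / 2) (κ : Coupling)
    (m : ℤ) (p : L2J2 K a × L2J2 K a) (hp : p ∈ transGraph K a κ m) (h0 : p.1 = 0) :
    p.2 = 0 := by
  obtain ⟨u, u1, u2, hu, d1, d2, -, hF⟩ := hp
  have ac : nu K a ≪ volume.restrict (J2 a) := withDensity_absolutelyContinuous _ _
  have z : u =ᵐ[volume.restrict (J2 a)] fun _ => 0 := by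
    refine (restrict_ac_nu hK).ae_eq (hu.symm.trans ?_)
    rw [h0]
    exact Lp.coeFn_zero ..
  have z1 := d1.ae_zero isOpen_Ioo z
  have z2 := d2.ae_zero isOpen_Ioo z1
  rw [Lp.eq_zero_iff_ae_eq_zero]
  filter_upwards [hF, ac.ae_eq z, ac.ae_eq z1, ac.ae_eq z2] with y h1 h2 h3 h4
  rw [h1]
  simp [action1, h2, h3, h4]

lemma stripGraph_single {K : SignType} {a : ℝ} (hK : K = 1 → a < Real.pi / 2) (κ : Coupling)
    (p : L2Omega K a × L2Omega K a) (hp : p ∈ stripGraph K a κ) (h0 : p.1 = 0) :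
    p.2 = 0 := by
  obtain ⟨u, u1, u2, u11, u12, u22, hu, W, -, -, hF⟩ := hp
  have ac : muG K a ≪ volume.restrict (Omega0 a) := by
    rw [muG_eq]; exact withDensity_absolutelyContinuous _ _
  have z : u =ᵐ[volume.restrict (Omega0 a)] fun _ => 0 := by
    refine (restrict_ac_muG hK).ae_eq (hu.symm.trans ?_)
    rw [h0]
    exact Lp.coeFn_zero ..
  have z1 := W.d1.ae_zero (isOpen_Omega0 a) z
  have z2 := W.d2.ae_zero (isOpen_Omega0 a) z
  have z11 := W.d11.ae_zero (isOpen_Omega0 a) z1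
  have z22 := W.d22.ae_zero (isOpen_Omega0 a) z2
  rw [Lp.eq_zero_iff_ae_eq_zero]
  filter_upwards [hF, ac.ae_eq z2, ac.ae_eq z11, ac.ae_eq z22] with y h1 h2 h3 h4
  rw [h1]
  simp [action2, h2, h3, h4]

/-- The graph of `H^m`. -/
lemma mem_transGraph_iff {K : SignType} {a : ℝ} (hK : K = 1 → a < Real.pi / 2) (κ : Coupling)
    (m : ℤ) (ψ F : L2J2 K a) :
    (ψ, F) ∈ (transOp K a κ m).graph ↔ TransRel K a κ m ψ F := by
  rw [transOp, Submodule.toLinearPMap_graph_eq _ (transGraph_single hK κ m)]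
  rfl

/-- The graph of `H`. -/
lemma mem_stripGraph_iff {K : SignType} {a : ℝ} (hK : K = 1 → a < Real.pi / 2) (κ : Coupling)
    (ψ F : L2Omega K a) :
    (ψ, F) ∈ (stripOp K a κ).graph ↔ StripRel K a κ ψ F := by
  rw [stripOp, Submodule.toLinearPMap_graph_eq _ (stripGraph_single hK κ)]
  rfl

/-! ## Resolvents of unbounded operators -/

section Resolvent

/-- `R` is a bounded, everywhere defined, two-sided inverse of `T - z`. -/
def IsResolventAt {E : Type*} [NormedAddCommGroup E] [NormedSpace ℂ E] (T : E →ₗ.[ℂ] E) (z : ℂ)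
    (R : E →L[ℂ] E) : Prop :=
  (∀ v : E, ∃ u : T.domain, (u : E) = R v ∧ T u - z • (u : E) = v) ∧
    ∀ u : T.domain, R (T u - z • (u : E)) = u

/-- The resolvent set `ϱ(T)`. -/
def rho {E : Type*} [NormedAddCommGroup E] [NormedSpace ℂ E] (T : E →ₗ.[ℂ] E) : Set ℂ :=
  {z | ∃ R : E →L[ℂ] E, IsResolventAt T z R}

open Classical in
/-- The resolvent `(T - z)⁻¹` for `z ∈ ϱ(T)` (and zero otherwise). -/
def resolv {E : Type*} [NormedAddCommGroup E] [NormedSpace ℂ E] (T : E →ₗ.[ℂ] E) (z : ℂ) :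
    E →L[ℂ] E :=
  if h : ∃ R : E →L[ℂ] E, IsResolventAt T z R then h.choose else 0

lemma IsResolventAt.unique {E : Type*} [NormedAddCommGroup E] [NormedSpace ℂ E]
    {T : E →ₗ.[ℂ] E} {z : ℂ} {R R' : E →L[ℂ] E} (h : IsResolventAt T z R)
    (h' : IsResolventAt T z R') : R = R' := by
  ext v
  obtain ⟨u, hu, hv⟩ := h'.1 v
  rw [← hu, ← h.2 u, hv]

lemma resolv_spec {E : Type*} [NormedAddCommGroup E] [NormedSpace ℂ E]
    {T : E →ₗ.[ℂ] E} {z : ℂ} (h : z ∈ rho T) : IsResolventAt T z (resolv T z) := by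
  have h' : ∃ R : E →L[ℂ] E, IsResolventAt T z R := h
  rw [resolv, dif_pos h']
  exact h'.choose_spec

end Resolvent

/-! ## Tensor products and Fourier modes -/

lemma memLp_tensor {K : SignType} {a : ℝ} (g : L2J1) (h : L2J2 K a) :
    MemLp (fun x : ℝ × ℝ => g x.1 * h x.2) 2 (muG K a) := by
  have hg := Lp.memLp g
  have hh := Lp.memLp h
  have hm : AEStronglyMeasurable (fun x : ℝ × ℝ => g x.1 * h x.2) (muG K a) :=
    hg.1.comp_fst.mul hh.1.comp_snd
  rw [memLp_two_iff_integrable_sq_norm hm, muG]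
  have := ((memLp_two_iff_integrable_sq_norm hg.1).1 hg).mul_prod
    ((memLp_two_iff_integrable_sq_norm hh.1).1 hh)
  simpa only [norm_mul, mul_pow] using this

/-- The pure tensor `g ⊗ h ∈ L²(Ω₀, G)` of `g ∈ L²(J₁)` and `h ∈ L²(J₂, dν_K)`, i.e. the function
`(x₁, x₂) ↦ g(x₁) h(x₂)`. -/
def tensor {K : SignType} {a : ℝ} (g : L2J1) (h : L2J2 K a) : L2Omega K a :=
  (memLp_tensor g h).toLp _

/-- The bounded operator `T` on `L²(Ω₀, G) = L²(J₁) ⊗ L²(J₂, dν_K)` is `1 ⊗ A`.  (Pure tensors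
span a dense subspace, so this determines `T`.) -/
def IsOneTensor {K : SignType} {a : ℝ} (A : L2J2 K a →L[ℂ] L2J2 K a)
    (T : L2Omega K a →L[ℂ] L2Omega K a) : Prop :=
  ∀ (g : L2J1) (h : L2J2 K a), T (tensor g h) = tensor g (A h)

/-- `φ_m(x₁) = (2π)^{-1/2} e^{i m x₁}`. -/
def phi (m : ℤ) (t : ℝ) : ℂ :=
  ((Real.sqrt (2 * Real.pi))⁻¹ : ℝ) * Complex.exp (Complex.I * m * t)

lemma continuous_phi (m : ℤ) : Continuous (phi m) := by
  unfold phi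
  fun_prop

lemma norm_phi (m : ℤ) (t : ℝ) : ‖phi m t‖ = (Real.sqrt (2 * Real.pi))⁻¹ := by
  have : Complex.I * m * t = ((m * t : ℝ) : ℂ) * Complex.I := by push_cast; ring
  rw [phi, norm_mul, this, Complex.norm_exp_ofReal_mul_I, mul_one, Complex.norm_real,
    Real.norm_of_nonneg (by positivity)]

lemma memLp_phi (m : ℤ) : MemLp (phi m) 2 (volume.restrict J1) :=
  MemLp.of_bound (continuous_phi m).aestronglyMeasurable _
    (Filter.Eventually.of_forall fun t => (norm_phi m t).le)

/-- `φ_m` as an element of `L²(J₁)`. -/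
def phiL2 (m : ℤ) : L2J1 := (memLp_phi m).toLp _

/-- The Fourier coefficient `ψ_m(x₂) = (φ_m, Ψ(·, x₂))_{L²(J₁)}`. -/
def coeffFun (m : ℤ) (Ψ : ℝ × ℝ → ℂ) (y : ℝ) : ℂ :=
  ∫ t in J1, (starRingEnd ℂ) (phi m t) * Ψ (t, y)

instance isFiniteMeasure_nu (K : SignType) (a : ℝ) : IsFiniteMeasure (nu K a) := by
  refine isFiniteMeasure_withDensity_ofReal (Integrable.hasFiniteIntegral ?_)
  exact ((continuous_warp K).integrableOn_Icc (a := -a) (b := a)).mono_set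
    Set.Ioo_subset_Icc_self

instance isFiniteMeasure_muG (K : SignType) (a : ℝ) : IsFiniteMeasure (muG K a) :=
  inferInstanceAs (IsFiniteMeasure ((volume.restrict J1).prod (nu K a)))

lemma volume_real_J1 : (volume.restrict J1).real Set.univ = 2 * Real.pi := by
  simp only [measureReal_restrict_apply MeasurableSet.univ, Set.univ_inter, J1,
    Real.volume_real_Ioo]
  rw [max_eq_left (by linarith [Real.pi_pos])]
  ring

lemma integrable_coeff {K : SignType} {a : ℝ} (m : ℤ) (Ψ : L2Omega K a) :
    Integrable (fun x : ℝ × ℝ => (starRingEnd ℂ) (phi m x.1) * Ψ x)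
      ((volume.restrict J1).prod (nu K a)) := by
  have h1 : Integrable (fun x : ℝ × ℝ => Ψ x) ((volume.restrict J1).prod (nu K a)) :=
    (Lp.memLp Ψ).integrable (by norm_num)
  refine h1.bdd_mul (c := (Real.sqrt (2 * Real.pi))⁻¹) ?_ ?_
  · exact (Complex.continuous_conj.comp
      ((continuous_phi m).comp continuous_fst)).aestronglyMeasurable
  · exact Filter.Eventually.of_forall fun x => by
      rw [RCLike.norm_conj, norm_phi]

lemma norm_sq_integral_le {f : ℝ → ℂ} (m : ℤ) (hf : Integrable f (volume.restrict J1))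
    (hf2 : Integrable (fun t => ‖f t‖ ^ 2) (volume.restrict J1)) :
    ‖∫ t in J1, (starRingEnd ℂ) (phi m t) * f t‖ ^ 2 ≤ ∫ t in J1, ‖f t‖ ^ 2 := by
  set c : ℝ := (Real.sqrt (2 * Real.pi))⁻¹ with hc
  have hc2 : c ^ 2 * (2 * Real.pi) = 1 := by
    have := Real.pi_pos
    rw [hc, inv_pow, Real.sq_sqrt (by positivity)]
    field_simp
  have hc0 : 0 ≤ c := by positivity
  set s : ℝ := c * ∫ t in J1, ‖f t‖ with hs
  have h1 : ‖∫ t in J1, (starRingEnd ℂ) (phi m t) * f t‖ ≤ s := by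
    refine (norm_integral_le_integral_norm _).trans_eq ?_
    rw [hs, ← integral_const_mul]
    refine integral_congr_ae (Filter.Eventually.of_forall fun t => ?_)
    simp only [norm_mul, RCLike.norm_conj, norm_phi, hc]
  have h2 : 0 ≤ ∫ t in J1, (‖f t‖ - s * c) ^ 2 := integral_nonneg fun t => sq_nonneg _
  have e : ∀ t, (‖f t‖ - s * c) ^ 2 = ‖f t‖ ^ 2 - (2 * s * c) * ‖f t‖ + (s * c) ^ 2 :=
    fun t => by ring
  simp only [e] at h2
  have hi : Integrable (fun t => ‖f t‖ ^ 2 - (2 * s * c) * ‖f t‖) (volume.restrict J1) :=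
    hf2.sub (hf.norm.const_mul _)
  rw [integral_add hi (integrable_const _), integral_sub hf2 (hf.norm.const_mul _), integral_const_mul, integral_const,
    volume_real_J1, smul_eq_mul] at h2
  have h3 : 2 * s * c * ∫ t in J1, ‖f t‖ = 2 * s ^ 2 := by rw [hs]; ring
  have h4 : 2 * Real.pi * (s * c) ^ 2 = s ^ 2 := by
    calc 2 * Real.pi * (s * c) ^ 2 = (c ^ 2 * (2 * Real.pi)) * s ^ 2 := by ring
      _ = s ^ 2 := by rw [hc2, one_mul]
  rw [h3, h4] at h2
  have h5 := pow_le_pow_left₀ (norm_nonneg _) h1 2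
  linarith

lemma coeffFun_bound {K : SignType} {a : ℝ} (m : ℤ) (Ψ : L2Omega K a) :
    ∀ᵐ y ∂(nu K a), ‖coeffFun m Ψ y‖ ^ 2 ≤ ∫ t in J1, ‖Ψ (t, y)‖ ^ 2 := by
  have h1 : Integrable (fun x : ℝ × ℝ => Ψ x) ((volume.restrict J1).prod (nu K a)) :=
    (Lp.memLp Ψ).integrable (by norm_num)
  have h2 : Integrable (fun x : ℝ × ℝ => ‖Ψ x‖ ^ 2) ((volume.restrict J1).prod (nu K a)) :=
    (memLp_two_iff_integrable_sq_norm (Lp.memLp Ψ).1).1 (Lp.memLp Ψ)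
  filter_upwards [h1.prod_left_ae, h2.prod_left_ae] with y hy1 hy2
  exact norm_sq_integral_le m hy1 hy2

lemma memLp_coeffFun {K : SignType} {a : ℝ} (m : ℤ) (Ψ : L2Omega K a) :
    MemLp (coeffFun m Ψ) 2 (nu K a) := by
  have hm : AEStronglyMeasurable (coeffFun m Ψ) (nu K a) :=
    (integrable_coeff m Ψ).integral_prod_right.1
  rw [memLp_two_iff_integrable_sq_norm hm]
  have h2 : Integrable (fun x : ℝ × ℝ => ‖Ψ x‖ ^ 2) ((volume.restrict J1).prod (nu K a)) :=
    (memLp_two_iff_integrable_sq_norm (Lp.memLp Ψ).1).1 (Lp.memLp Ψ)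
  refine h2.integral_prod_right.mono' (hm.norm.pow 2) ?_
  filter_upwards [coeffFun_bound m Ψ] with y hy
  rwa [Real.norm_of_nonneg (by positivity)]

/-- The Fourier coefficient `ψ_m` as an element of `L²(J₂, dν_K)`. -/
def coeff {K : SignType} {a : ℝ} (m : ℤ) (Ψ : L2Omega K a) : L2J2 K a :=
  (memLp_coeffFun m Ψ).toLp _

lemma coeff_lin {K : SignType} {a : ℝ} (m : ℤ) (c : ℂ) (Ψ Φ : L2Omega K a) :
    coeff m (c • Ψ + Φ) = c • coeff m Ψ + coeff m Φ := by
  have hsum : ∀ᵐ x ∂((volume.restrict J1).prod (nu K a)),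
      (c • Ψ + Φ : L2Omega K a) x = c * Ψ x + Φ x := by
    filter_upwards [Lp.coeFn_add (c • Ψ) Φ, Lp.coeFn_smul c Ψ] with x h1 h2
    rw [h1, Pi.add_apply, h2, Pi.smul_apply, smul_eq_mul]
  have hsum' := (Measure.measurePreserving_swap (μ := nu K a)
    (ν := volume.restrict J1)).quasiMeasurePreserving.ae hsum
  apply Lp.ext
  filter_upwards [(memLp_coeffFun m (c • Ψ + Φ)).coeFn_toLp, (memLp_coeffFun m Ψ).coeFn_toLp,
    (memLp_coeffFun m Φ).coeFn_toLp, Lp.coeFn_add (c • coeff m Ψ) (coeff m Φ),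
    Lp.coeFn_smul c (coeff m Ψ), Measure.ae_ae_of_ae_prod hsum',
    (integrable_coeff m Ψ).prod_left_ae, (integrable_coeff m Φ).prod_left_ae]
    with y e1 e2 e3 e4 e5 e6 i1 i2
  rw [e4, Pi.add_apply, e5, Pi.smul_apply, smul_eq_mul]
  simp only [coeff]
  rw [e1, e2, e3]
  simp only [coeffFun]
  rw [← integral_lin c i1 i2]
  refine integral_congr_ae ?_
  filter_upwards [e6] with t ht
  simp only [Prod.swap_prod_mk] at ht
  rw [ht]
  ring

lemma norm_sq_L2 {α : Type*} [MeasurableSpace α] {μ : Measure α} (f : Lp ℂ 2 μ) :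
    ‖f‖ ^ 2 = ∫ x, ‖f x‖ ^ 2 ∂μ := by
  have h := L2.inner_def (𝕜 := ℂ) f f
  have h' : (inner ℂ f f : ℂ) = ((‖f‖ ^ 2 : ℝ) : ℂ) := by
    rw [inner_self_eq_norm_sq_to_K]; norm_cast
  rw [h'] at h
  have e : ∀ x, (inner ℂ (f x) (f x) : ℂ) = ((‖f x‖ ^ 2 : ℝ) : ℂ) := fun x => by
    rw [inner_self_eq_norm_sq_to_K]; norm_cast
  simp only [e] at h
  rw [integral_complex_ofReal] at h
  exact_mod_cast h

lemma norm_coeff_le {K : SignType} {a : ℝ} (m : ℤ) (Ψ : L2Omega K a) : ‖coeff m Ψ‖ ≤ ‖Ψ‖ := by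
  have h2 : Integrable (fun x : ℝ × ℝ => ‖Ψ x‖ ^ 2) ((volume.restrict J1).prod (nu K a)) :=
    (memLp_two_iff_integrable_sq_norm (Lp.memLp Ψ).1).1 (Lp.memLp Ψ)
  refine le_of_sq_le_sq ?_ (norm_nonneg _)
  have e : ‖Ψ‖ ^ 2 = ∫ y, (∫ t in J1, ‖Ψ (t, y)‖ ^ 2) ∂(nu K a) := by
    rw [norm_sq_L2, ← integral_prod_symm (fun x => ‖Ψ x‖ ^ 2) h2]
    rfl
  rw [e, norm_sq_L2]
  refine integral_mono_ae ((memLp_two_iff_integrable_sq_norm (Lp.memLp _).1).1 (Lp.memLp _))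
    h2.integral_prod_right ?_
  filter_upwards [coeffFun_bound m Ψ, (memLp_coeffFun m Ψ).coeFn_toLp] with y h1 h3
  rw [coeff, h3]
  exact h1

lemma tensor_lin {K : SignType} {a : ℝ} (g : L2J1) (c : ℂ) (h h' : L2J2 K a) :
    tensor g (c • h + h') = c • tensor g h + tensor g h' := by
  have hsum : ∀ᵐ x ∂(muG K a), (c • h + h' : L2J2 K a) x.2 = c * h x.2 + h' x.2 := by
    have : ∀ᵐ y ∂(nu K a), (c • h + h' : L2J2 K a) y = c * h y + h' y := by
      filter_upwards [Lp.coeFn_add (c • h) h', Lp.coeFn_smul c h] with x h1 h2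
      rw [h1, Pi.add_apply, h2, Pi.smul_apply, smul_eq_mul]
    exact (Measure.quasiMeasurePreserving_snd (μ := volume.restrict J1)).ae this
  apply Lp.ext
  filter_upwards [(memLp_tensor g (c • h + h')).coeFn_toLp, (memLp_tensor g h).coeFn_toLp,
    (memLp_tensor g h').coeFn_toLp, Lp.coeFn_add (c • tensor g h) (tensor g h'),
    Lp.coeFn_smul c (tensor g h), hsum] with x e1 e2 e3 e4 e5 e6
  rw [e4, Pi.add_apply, e5, Pi.smul_apply, smul_eq_mul]
  simp only [tensor]
  rw [e1, e2, e3, e6]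
  ring

lemma norm_tensor {K : SignType} {a : ℝ} (g : L2J1) (h : L2J2 K a) :
    ‖tensor g h‖ = ‖g‖ * ‖h‖ := by
  have e : ‖tensor g h‖ ^ 2 = (‖g‖ * ‖h‖) ^ 2 := by
    rw [mul_pow, norm_sq_L2, norm_sq_L2, norm_sq_L2, ← integral_prod_mul]
    refine integral_congr_ae ?_
    filter_upwards [(memLp_tensor g h).coeFn_toLp] with x hx
    rw [tensor, hx, norm_mul, mul_pow]
  exact (sq_eq_sq₀ (norm_nonneg _) (by positivity)).1 e

/-- The operator `(B^m Ψ)(x₁, x₂) = (φ_m, Ψ(·, x₂))_{L²(J₁)} φ_m(x₁)` on `L²(Ω₀, G)`. -/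
def modeProj (K : SignType) (a : ℝ) (m : ℤ) : L2Omega K a →L[ℂ] L2Omega K a :=
  LinearMap.mkContinuous
    { toFun := fun Ψ => tensor (phiL2 m) (coeff m Ψ)
      map_add' := fun Ψ Φ => by
        have h1 := coeff_lin m 1 Ψ Φ
        have h2 := tensor_lin (phiL2 m) 1 (coeff m Ψ) (coeff m Φ)
        simp only [one_smul] at h1 h2
        rw [h1, h2]
      map_smul' := fun c Ψ => by
        have z1 : coeff m (0 : L2Omega K a) = 0 := by
          have := coeff_lin m 1 (0 : L2Omega K a) 0
          simpa using this
        have z2 : tensor (phiL2 m) (0 : L2J2 K a) = 0 := by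
          have := tensor_lin (phiL2 m) 1 (0 : L2J2 K a) 0
          simpa using this
        have h1 := coeff_lin m c Ψ 0
        have h2 := tensor_lin (phiL2 m) c (coeff m Ψ) 0
        simp only [z1, z2, add_zero] at h1 h2
        rw [h1, h2, RingHom.id_apply] }
    ‖phiL2 m‖ fun Ψ => by
      refine (norm_tensor _ _).trans_le ?_
      exact mul_le_mul_of_nonneg_left (norm_coeff_le m Ψ) (norm_nonneg _)

/-- The defining formula of `B^m`, pointwise almost everywhere. -/
lemma modeProj_ae (K : SignType) (a : ℝ) (m : ℤ) (Ψ : L2Omega K a) :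
    modeProj K a m Ψ =ᵐ[muG K a]
      fun x => (∫ t in J1, (starRingEnd ℂ) (phi m t) * Ψ (t, x.2)) * phi m x.1 := by
  have h1 := (Measure.quasiMeasurePreserving_fst (μ := volume.restrict J1)
    (ν := nu K a)).ae (memLp_phi m).coeFn_toLp
  have h2 := (Measure.quasiMeasurePreserving_snd (μ := volume.restrict J1)
    (ν := nu K a)).ae (memLp_coeffFun m Ψ).coeFn_toLp
  filter_upwards [(memLp_tensor (phiL2 m) (coeff m Ψ)).coeFn_toLp, h1, h2] with x e1 e2 e3
  change tensor (phiL2 m) (coeff m Ψ) x = _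
  rw [tensor, e1, phiL2, coeff, e2, e3, mul_comm]
  rfl

/-! ## Direct sums of bounded operators -/

/-- `R = ⨁_m A_m P_m` on a Hilbert space `E`: the `P_m` are mutually orthogonal orthogonal
projections that sum up (strongly) to the identity, each `A_m` leaves the range of `P_m` and its
complement invariant, and `R Ψ = ∑_m A_m P_m Ψ` for all `Ψ`, the series being (unconditionally)
convergent in `E`. -/
structure IsDirectSum {ι E : Type*} [NormedAddCommGroup E] [InnerProductSpace ℂ E]
    [CompleteSpace E] (P A : ι → E →L[ℂ] E) (R : E →L[ℂ] E) : Prop where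
  proj : ∀ m, IsStarProjection (P m)
  orthogonal : ∀ m n, m ≠ n → P m * P n = 0
  complete : ∀ Ψ : E, HasSum (fun m => P m Ψ) Ψ
  invariant : ∀ m, A m * P m = P m * A m
  hasSum : ∀ Ψ : E, HasSum (fun m => A m (P m Ψ)) (R Ψ)

/-- The set `D = ⋂_m ϱ(H^m)`. -/
def commonRho (K : SignType) (a : ℝ) (κ : Coupling) : Set ℂ :=
  ⋂ m : ℤ, rho (transOp K a κ m)

end PTStrip

end

/-!
# The resolvent of the Laplacian on a strip of constant curvature

The coefficients of `H` depend on `x₂` only and the boundary conditions have constant coefficients,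
so the Fourier series in `x₁` diagonalizes `H`: it turns `H` into the sequence of transverse
operators `H^m`. The content of the theorem is that this formal decomposition respects the domains,
in both directions, and that the set `⋂ ϱ(H^m)` is not empty; the operators need not be
self-adjoint.

* *Uniform estimates.* Both types of boundary conditions express `ψ'(± a)` linearly through
  `ψ(± a)` (`Coupling.exists_robin`; here `b > 0` enters). As the boundary values are dominated by a
  small multiple of `‖ψ'‖` plus a multiple of `‖ψ‖`, the real part of the quadratic form of `H^m`
  is at least `‖ψ'‖² / 2 + (k m² - C) ‖ψ‖²` with `k > 0` and `C` independent of `m`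
  (`exists_energy_bound`). Hence for `z ∈ ⋂ ϱ(H^m)` the norms of `(H^m - z)⁻¹` are
  `O((1 + m²)⁻¹)`: the estimate gives this for large `|m|`, and the finitely many other `m` are
  absorbed in the constant (`exists_resolv_bound`). The derivatives and the boundary values of
  `(H^m - z)⁻¹ G` satisfy corresponding bounds (`exists_resolv_deriv_bound`).

* *A common point of the resolvent sets.* For `z` real and very negative the estimate shows that
  `H^m - z` is bounded below for every `m`. It is surjective because a boundary value problem for a
  linear ordinary differential equation with unique solutions is solvable
  (`exists_boundary_value`), the initial value problem being a Volterra equation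
  (`exists_volterra`); this gives `commonRho_nonempty`.

* *From `H` to `H^m`.* Testing Green's formula on the rectangle with products `\bar φ_m ⊗ g` shows
  that the Fourier coefficients of a function in the domain of `H` are in the domains of the `H^m`,
  and `H` acts on them as `H^m` (`StripRel.transRel_modeCoeff`).

* *From `H^m` to `H`.* Conversely let `u = ∑ φ_m ⊗ (H^m - z)⁻¹ Ψ_m`. By the uniform estimates the
  series of the derivatives up to second order and of the traces converge in `L²`, and Green's
  formulas, which define weak derivatives and traces, are stable under such limits
  (`hasTraces2_of_hasSum`, `exists_hasTraces1_of_hasSum`). Thus `u` is in the domain of `H` and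
  `(H - z) u = Ψ` (`stripRel_of_hasSum`).

Together these show that the diagonal operator with entries `(H^m - z)⁻¹` is the resolvent of `H`
at `z` (`isResolventAt_of_hasSum`).
-/

open MeasureTheory

noncomputable section

namespace PTStrip

/-! ### Absolutely continuous functions on the closed interval -/

/-- Integration by parts for two primitives that vanish at the left end point, in the form of
Fubini's theorem on the square cut along its diagonal. -/
lemma integral_mul_primitive_add {l r : ℝ} (hlr : l ≤ r) {p q : ℝ → ℂ}
    (hp : IntegrableOn p (Set.Ioc l r)) (hq : IntegrableOn q (Set.Ioc l r)) :
    (∫ y in Set.Ioc l r, p y * ∫ s in l..y, q s) + (∫ y in Set.Ioc l r, q y * ∫ s in l..y, p s) =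
      (∫ y in l..r, p y) * ∫ y in l..r, q y := by
  set μ := volume.restrict (Set.Ioc l r) with hμ
  have hpq : Integrable (fun z : ℝ × ℝ => p z.1 * q z.2) (μ.prod μ) := hp.mul_prod hq
  have m1 : MeasurableSet {z : ℝ × ℝ | z.2 ≤ z.1} := measurableSet_le measurable_snd measurable_fst
  have i1 := hpq.indicator m1
  have i2 := hpq.indicator m1.compl
  have hq' : ∀ y ∈ Set.Ioc l r, ∫ s in l..y, q s = ∫ s, (Set.Iic y).indicator q s ∂μ := by
    intro y hy
    rw [integral_indicator measurableSet_Iic, hμ, Measure.restrict_restrict measurableSet_Iic,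
      intervalIntegral.integral_of_le hy.1.le]
    congr 2
    ext s
    simp only [Set.mem_Ioc, Set.mem_inter_iff, Set.mem_Iic]
    exact ⟨fun h => ⟨h.2, h.1, h.2.trans hy.2⟩, fun h => ⟨h.2.1, h.1⟩⟩
  have hp' : ∀ y ∈ Set.Ioc l r, ∫ s in l..y, p s = ∫ s, (Set.Iio y).indicator p s ∂μ := by
    intro y hy
    rw [integral_indicator measurableSet_Iio, hμ, Measure.restrict_restrict measurableSet_Iio,
      intervalIntegral.integral_of_le hy.1.le, integral_Ioc_eq_integral_Ioo]
    congr 2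
    ext s
    simp only [Set.mem_Ioc, Set.mem_inter_iff, Set.mem_Iio, Set.mem_Ioo]
    exact ⟨fun h => ⟨h.2, h.1, h.2.le.trans hy.2⟩, fun h => ⟨h.2.1, h.1⟩⟩
  have e1 : ∫ y in Set.Ioc l r, p y * ∫ s in l..y, q s =
      ∫ z, {z : ℝ × ℝ | z.2 ≤ z.1}.indicator (fun z => p z.1 * q z.2) z ∂(μ.prod μ) := by
    rw [integral_prod _ i1]
    refine setIntegral_congr_fun measurableSet_Ioc fun y hy => ?_
    simp only [hq' y hy, ← integral_const_mul]
    refine integral_congr_ae (Filter.Eventually.of_forall fun s => ?_)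
    by_cases h : s ≤ y <;> simp [Set.indicator, h]
  have e2 : ∫ y in Set.Ioc l r, q y * ∫ s in l..y, p s =
      ∫ z, {z : ℝ × ℝ | z.2 ≤ z.1}ᶜ.indicator (fun z => p z.1 * q z.2) z ∂(μ.prod μ) := by
    rw [integral_prod_symm _ i2]
    refine setIntegral_congr_fun measurableSet_Ioc fun y hy => ?_
    simp only [hp' y hy, ← integral_const_mul]
    refine integral_congr_ae (Filter.Eventually.of_forall fun s => ?_)
    by_cases h : s < y
    · simp [Set.indicator, h, mul_comm]
    · simp [Set.indicator, h]
  rw [e1, e2, ← integral_add i1 i2, intervalIntegral.integral_of_le hlr,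
    intervalIntegral.integral_of_le hlr, ← integral_prod_mul]
  refine integral_congr_ae (Filter.Eventually.of_forall fun z => ?_)
  exact congrFun (Set.indicator_self_add_compl _ _) z

/-- On the closed interval `[-a, a]`, the function `u` is absolutely continuous with integrable
derivative `v`. -/
structure IsPrimitive (a : ℝ) (u v : ℝ → ℂ) : Prop where
  integrable : IntegrableOn v (Set.Icc (-a) a)
  eq_integral : ∀ y ∈ Set.Icc (-a) a, u y = u (-a) + ∫ s in (-a)..y, v s

namespace IsPrimitive

variable {a : ℝ} {u v p q : ℝ → ℂ}

lemma of_integral (c : ℂ) (hv : IntegrableOn v (Set.Icc (-a) a)) :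
    IsPrimitive a (fun y => c + ∫ s in (-a)..y, v s) v :=
  ⟨hv, fun y _ => by simp⟩

lemma of_hasDerivAt (hd : ∀ y ∈ Set.Icc (-a) a, HasDerivAt u (v y) y)
    (hv : ContinuousOn v (Set.Icc (-a) a)) : IsPrimitive a u v := by
  have hi : IntegrableOn v (Set.Icc (-a) a) := hv.integrableOn_compact isCompact_Icc
  refine ⟨hi, fun y hy => ?_⟩
  rw [intervalIntegral.integral_eq_sub_of_hasDerivAt]
  · ring
  · intro x hx
    rw [Set.uIcc_of_le hy.1] at hx
    exact hd x ⟨hx.1, hx.2.trans hy.2⟩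
  · exact (intervalIntegrable_iff_integrableOn_Icc_of_le hy.1).2
      (hi.mono_set (Set.Icc_subset_Icc_right hy.2))

lemma intervalIntegrable (h : IsPrimitive a u v) {y : ℝ}
    (hy : y ∈ Set.Icc (-a) a) : IntervalIntegrable v volume (-a) y :=
  (intervalIntegrable_iff_integrableOn_Icc_of_le hy.1).2
    (h.integrable.mono_set (Set.Icc_subset_Icc_right hy.2))

lemma continuousOn (h : IsPrimitive a u v) : ContinuousOn u (Set.Icc (-a) a) := by
  refine ((continuousOn_const (c := u (-a))).add
    (intervalIntegral.continuousOn_primitive h.integrable)).congr fun y hy => ?_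
  rw [h.eq_integral y hy, intervalIntegral.integral_of_le hy.1]
  rfl

lemma integral_J2 (ha : 0 ≤ a) (h : IsPrimitive a u v) : ∫ y in J2 a, v y = u a - u (-a) := by
  rw [h.eq_integral a ⟨by linarith, le_rfl⟩, intervalIntegral.integral_of_le (by linarith),
    integral_Ioc_eq_integral_Ioo, J2]
  ring

/-- The product rule, proved through `integral_mul_primitive_add` since the derivatives exist only
almost everywhere. -/
lemma mul (h : IsPrimitive a u v) (h' : IsPrimitive a p q) :
    IsPrimitive a (fun y => u y * p y) (fun y => v y * p y + u y * q y) := by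
  have i1 : IntegrableOn (fun y => v y * p y) (Set.Icc (-a) a) :=
    h.integrable.mul_continuousOn h'.continuousOn isCompact_Icc
  have i2 : IntegrableOn (fun y => u y * q y) (Set.Icc (-a) a) :=
    h'.integrable.continuousOn_mul h.continuousOn isCompact_Icc
  refine ⟨i1.add i2, fun y hy => ?_⟩
  have hsub : Set.Ioc (-a) y ⊆ Set.Icc (-a) a := fun s hs => ⟨hs.1.le, hs.2.trans hy.2⟩
  have j1 := i1.mono_set hsub
  have j2 := i2.mono_set hsub
  have k1 := h.integrable.mono_set hsub
  have k2 := h'.integrable.mono_set hsub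
  have key := integral_mul_primitive_add hy.1 k1 k2
  have f1 : ∀ s ∈ Set.Ioc (-a) y, v s * ∫ x in (-a)..s, q x = v s * p s - v s * p (-a) := by
    intro s hs
    rw [h'.eq_integral s (hsub hs)]; ring
  have f2 : ∀ s ∈ Set.Ioc (-a) y, q s * ∫ x in (-a)..s, v x = u s * q s - u (-a) * q s := by
    intro s hs
    rw [h.eq_integral s (hsub hs)]; ring
  rw [setIntegral_congr_fun measurableSet_Ioc f1, setIntegral_congr_fun measurableSet_Ioc f2,
    integral_sub j1 (k1.mul_const _), integral_sub j2 (k2.const_mul _), integral_mul_const,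
    integral_const_mul, ← intervalIntegral.integral_of_le hy.1,
    ← intervalIntegral.integral_of_le hy.1, ← intervalIntegral.integral_of_le hy.1,
    ← intervalIntegral.integral_of_le hy.1] at key
  rw [intervalIntegral.integral_add
    ((intervalIntegrable_iff_integrableOn_Ioc_of_le hy.1).2 j1)
    ((intervalIntegrable_iff_integrableOn_Ioc_of_le hy.1).2 j2),
    h.eq_integral y hy, h'.eq_integral y hy]
  linear_combination -key

lemma conj (h : IsPrimitive a u v) :
    IsPrimitive a (fun y => (starRingEnd ℂ) (u y)) (fun y => (starRingEnd ℂ) (v y)) := by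
  refine ⟨?_, fun y hy => ?_⟩
  · have := h.integrable
    exact (Complex.conjLIE.toContinuousLinearEquiv : ℂ →L[ℝ] ℂ).integrable_comp this
  · have e := intervalIntegral.intervalIntegral_eq_integral_uIoc
      (fun s => (starRingEnd ℂ) (v s)) (-a) y volume
    rw [e, integral_conj, h.eq_integral y hy, map_add,
      intervalIntegral.intervalIntegral_eq_integral_uIoc, if_pos hy.1]
    simp

end IsPrimitive

lemma IsTest.hasDerivAt {φ : ℝ → ℂ} (hφ : IsTest φ) (y : ℝ) :
    HasDerivAt φ (fderiv ℝ φ y 1) y :=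
  (hφ.1.differentiable (by simp) y).hasDerivAt

lemma IsTest.isPrimitive {φ : ℝ → ℂ} (hφ : IsTest φ) (a : ℝ) :
    IsPrimitive a φ (fun y => fderiv ℝ φ y 1) :=
  IsPrimitive.of_hasDerivAt (fun y _ => hφ.hasDerivAt y)
    ((hφ.1.continuous_fderiv (by simp)).clm_apply continuous_const).continuousOn

lemma ae_restrict_J2_of_forall {a : ℝ} {P : ℝ → Prop} (h : ∀ y ∈ Set.Icc (-a) a, P y) :
    ∀ᵐ y ∂(volume.restrict (J2 a)), P y :=
  (ae_restrict_iff' measurableSet_Ioo).2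
    (Filter.Eventually.of_forall fun y hy => h y ⟨hy.1.le, hy.2.le⟩)

lemma memLp_J2_of_continuousOn {a : ℝ} {u : ℝ → ℂ} (hu : ContinuousOn u (Set.Icc (-a) a)) :
    MemLp u 2 (volume.restrict (J2 a)) := by
  obtain ⟨C, hC⟩ := isCompact_Icc.exists_bound_of_continuousOn hu
  exact MemLp.of_bound ((hu.mono Set.Ioo_subset_Icc_self).aestronglyMeasurable measurableSet_Ioo) C
    (ae_restrict_J2_of_forall hC)

lemma IsPrimitive.hasEndValues {a : ℝ} (ha : 0 ≤ a) {u v : ℝ → ℂ} (h : IsPrimitive a u v)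
    (hv : MemLp v 2 (volume.restrict (J2 a))) : HasEndValues a u v (u (-a)) (u a) where
  memLp_fun := memLp_J2_of_continuousOn h.continuousOn
  memLp_deriv := hv
  green φ hφ := by
    rw [← (h.mul (hφ.isPrimitive a)).integral_J2 ha]
    simp only [add_comm]

lemma integrableOn_Icc_of_memLp {a : ℝ} {v : ℝ → ℂ} (hv : MemLp v 2 (volume.restrict (J2 a))) :
    IntegrableOn v (Set.Icc (-a) a) :=
  (integrableOn_Icc_iff_integrableOn_Ioo (by simp) (by simp)).2 (hv.integrable (by norm_num))

/-- A smooth cutoff: a test function with real values that equals `1` on a given interval. -/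
lemma exists_cutoff (r : ℝ) :
    ∃ χ : ℝ → ℂ, IsTest χ ∧ ∀ y ∈ Set.Icc (-r) r, χ y = 1 ∧ fderiv ℝ χ y = 0 := by
  let b : ContDiffBump (0 : ℝ) := ⟨|r| + 1, |r| + 2, by positivity, by linarith⟩
  refine ⟨fun y => (b y : ℂ), ⟨Complex.ofRealCLM.contDiff.comp b.contDiff, ?_⟩, fun y hy => ?_⟩
  · exact b.hasCompactSupport.comp_left (g := ((↑) : ℝ → ℂ)) Complex.ofReal_zero
  have hy' : y ∈ Metric.ball (0 : ℝ) (|r| + 1) := by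
    rw [mem_ball_zero_iff, Real.norm_eq_abs]
    have := abs_le.2 hy
    linarith [le_abs_self r]
  have : (fun y => (b y : ℂ)) =ᶠ[nhds y] fun _ => 1 := by
    filter_upwards [Metric.isOpen_ball.mem_nhds hy'] with x hx
    rw [b.one_of_mem_closedBall (Metric.ball_subset_closedBall hx), Complex.ofReal_one]
  exact ⟨this.eq_of_nhds, by rw [this.fderiv_eq]; simp⟩

lemma IsTest.mul_contDiff {E : Type*} [NormedAddCommGroup E] [NormedSpace ℝ E] {φ ψ : E → ℂ}
    (h : IsTest φ) (h' : ContDiff ℝ (⊤ : ℕ∞) ψ) : IsTest (fun x => φ x * ψ x) :=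
  ⟨h.1.mul h', h.2.mul_right⟩

/-- A function on the interval that annihilates all test functions on the line vanishes. -/
lemma ae_eq_zero_of_integral_test {a : ℝ} {w : ℝ → ℂ} (hw : MemLp w 2 (volume.restrict (J2 a)))
    (h : ∀ φ : ℝ → ℂ, IsTest φ → tsupport φ ⊆ J2 a → ∫ y in J2 a, w y * φ y = 0) :
    w =ᵐ[volume.restrict (J2 a)] fun _ => 0 := by
  have hloc : LocallyIntegrableOn w (J2 a) volume :=
    locallyIntegrableOn_of_locallyIntegrable_restrict (hw.locallyIntegrable (by norm_num))
  refine (ae_restrict_iff' measurableSet_Ioo).2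
    (isOpen_Ioo.ae_eq_zero_of_integral_contDiff_smul_eq_zero hloc fun g hg hgc hgU => ?_)
  have hts : tsupport (fun x => (g x : ℂ)) = tsupport g := by
    have : Function.support (fun x => (g x : ℂ)) = Function.support g := by
      ext x; simp
    rw [tsupport, this, ← tsupport]
  have h1 := h (fun x => (g x : ℂ)) ⟨Complex.ofRealCLM.contDiff.comp hg, by
    rw [HasCompactSupport, hts]; exact hgc⟩ (by rw [hts]; exact hgU)
  rw [← h1, ← setIntegral_eq_integral_of_forall_compl_eq_zero (s := J2 a) (fun x hx => ?_)]
  · refine integral_congr_ae (Filter.Eventually.of_forall fun x => ?_)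
    simp [Complex.real_smul, mul_comm]
  · have : g x = 0 := image_eq_zero_of_notMem_tsupport fun hx' => hx (hgU hx')
    simp [this]

/-- Du Bois-Reymond: a function that is square integrable on the interval together with its weak
derivative coincides with the primitive of the latter, and the boundary values in Green's formula
are those of this primitive. -/
lemma HasEndValues.exists_primitive {a : ℝ} (ha : 0 < a) {u v : ℝ → ℂ} {gm gp : ℂ}
    (h : HasEndValues a u v gm gp) :
    ∃ w, IsPrimitive a w v ∧ w =ᵐ[volume.restrict (J2 a)] u ∧ w (-a) = gm ∧ w a = gp := by
  have hvi := integrableOn_Icc_of_memLp h.memLp_deriv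
  set w : ℝ → ℂ := fun y => gm + ∫ s in (-a)..y, v s with hw
  have hP : IsPrimitive a w v := IsPrimitive.of_integral gm hvi
  have hE := hP.hasEndValues ha.le h.memLp_deriv
  have hwm : w (-a) = gm := by simp [hw]
  have hdiff : ∀ φ : ℝ → ℂ, IsTest φ →
      ∫ y in J2 a, (u y - w y) * fderiv ℝ φ y 1 = (gp - w a) * φ a := by
    intro φ hφ
    have e : ∀ y, (u y - w y) * fderiv ℝ φ y 1 =
        (u y * fderiv ℝ φ y 1 + v y * φ y) - (w y * fderiv ℝ φ y 1 + v y * φ y) := fun y => by ring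
    simp only [e]
    rw [integral_sub
      (integrable_mul_add h.memLp_fun (hφ.memLp_fderiv _ _) h.memLp_deriv (hφ.memLp _))
      (integrable_mul_add hE.memLp_fun (hφ.memLp_fderiv _ _) h.memLp_deriv (hφ.memLp _)),
      h.green φ hφ, hE.green φ hφ, hwm]
    ring
  obtain ⟨χ, hχ, hχ1⟩ := exists_cutoff a
  -- test with a function that is constant on the interval
  have hpa : w a = gp := by
    have h1 := hdiff χ hχ
    rw [(hχ1 a ⟨by linarith, le_rfl⟩).1, mul_one] at h1
    have h2 : ∫ y in J2 a, (u y - w y) * fderiv ℝ χ y 1 = 0 := by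
      rw [← integral_zero ℝ ℂ]
      refine integral_congr_ae (ae_restrict_J2_of_forall fun y hy => ?_)
      simp [(hχ1 y hy).2]
    exact (sub_eq_zero.1 (h1.symm.trans h2)).symm
  refine ⟨w, hP, ?_, hwm, hpa⟩
  have hz : (fun y => u y - w y) =ᵐ[volume.restrict (J2 a)] fun _ => 0 := by
    refine ae_eq_zero_of_integral_test (h.memLp_fun.sub hE.memLp_fun) fun g hg _ => ?_
    -- every test function is, on the interval, the derivative of a test function
    have hd : ∀ y, HasDerivAt (fun y => ∫ s in (-a)..y, g s) (g y) y := fun y =>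
      intervalIntegral.integral_hasDerivAt_right (hg.1.continuous.intervalIntegrable _ _)
        hg.1.continuous.stronglyMeasurable.stronglyMeasurableAtFilter hg.1.continuous.continuousAt
    have hG : ContDiff ℝ (⊤ : ℕ∞) fun y => ∫ s in (-a)..y, g s := by
      refine contDiff_infty_iff_deriv.2 ⟨fun y => (hd y).differentiableAt, ?_⟩
      rw [show deriv (fun y => ∫ s in (-a)..y, g s) = g from funext fun y => (hd y).deriv]
      exact hg.1
    have ht := hχ.mul_contDiff hG
    have h1 := hdiff _ ht
    rw [hpa, sub_self, zero_mul] at h1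
    rw [← h1]
    refine integral_congr_ae (ae_restrict_J2_of_forall fun y hy => ?_)
    have h2 := ((hχ.hasDerivAt y).mul (hd y)).unique (ht.hasDerivAt y)
    simp only [← h2, (hχ1 y hy).1, (hχ1 y hy).2]
    simp
  filter_upwards [hz] with y hy
  exact (sub_eq_zero.1 hy).symm

/-! ### Comparison of the weighted and the unweighted measures -/

lemma warp_pos_Icc {K : SignType} {a : ℝ} (hK : K = 1 → a < Real.pi / 2) {y : ℝ}
    (hy : y ∈ Set.Icc (-a) a) : 0 < warp K y := by
  cases K
  · exact one_pos
  · exact Real.cosh_pos y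
  · have := hK rfl
    exact Real.cos_pos_of_mem_Ioo ⟨by linarith [hy.1], by linarith [hy.2]⟩

lemma hasDerivAt_warp {K : SignType} {a : ℝ} (hK : K = 1 → a < Real.pi / 2) {y : ℝ}
    (hy : y ∈ Set.Icc (-a) a) : HasDerivAt (warp K) (drift K y * warp K y) y := by
  have hne := (warp_pos_Icc hK hy).ne'
  rw [(warp_jacobi K).2.2.2 y hne, div_mul_cancel₀ _ hne]
  refine DifferentiableAt.hasDerivAt ?_
  cases K
  · exact differentiableAt_const _
  · exact Real.differentiable_cosh y
  · exact Real.differentiable_cos y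

lemma continuousOn_drift {K : SignType} {a : ℝ} (hK : K = 1 → a < Real.pi / 2) :
    ContinuousOn (drift K) (Set.Icc (-a) a) := by
  cases K
  · exact continuousOn_const
  · have : drift .neg = fun y => Real.sinh y / Real.cosh y := funext Real.tanh_eq_sinh_div_cosh
    rw [this]
    exact (Real.continuous_sinh.div Real.continuous_cosh fun y => (Real.cosh_pos y).ne').continuousOn
  · refine (Real.continuousOn_tan.mono fun y hy => ?_).neg
    exact (warp_pos_Icc hK hy).ne'

lemma warp_neg (K : SignType) (y : ℝ) : warp K (-y) = warp K y := by
  cases K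
  · rfl
  · exact Real.cosh_neg y
  · exact Real.cos_neg y

/-- The coefficients of the operators are bounded, and the weight is bounded away from zero. -/
lemma exists_coeff_bounds (K : SignType) {a : ℝ} (hK : K = 1 → a < Real.pi / 2) :
    ∃ c C : ℝ, 0 < c ∧ 0 < C ∧
      ∀ y ∈ Set.Icc (-a) a, c ≤ warp K y ∧ warp K y ≤ C ∧ |drift K y| ≤ C := by
  obtain ⟨C1, h1⟩ := isCompact_Icc.exists_bound_of_continuousOn
    (continuous_warp K).continuousOn (s := Set.Icc (-a) a)
  obtain ⟨C2, h2⟩ := isCompact_Icc.exists_bound_of_continuousOn (continuousOn_drift hK)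
  obtain ⟨C3, h3⟩ := isCompact_Icc.exists_bound_of_continuousOn
    ((continuous_warp K).continuousOn.inv₀ (s := Set.Icc (-a) a)
      fun y hy => (warp_pos_Icc hK hy).ne')
  refine ⟨(|C3| + 1)⁻¹, |C1| + |C2| + 1, by positivity, by positivity, fun y hy => ⟨?_, ?_, ?_⟩⟩
  · have hp := warp_pos_Icc hK hy
    have := h3 y hy
    rw [Pi.inv_apply, Real.norm_of_nonneg (inv_nonneg.2 hp.le)] at this
    exact inv_le_of_inv_le₀ hp (by linarith [le_abs_self C3])
  · have := (le_abs_self _).trans (h1 y hy)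
    linarith [le_abs_self C1, abs_nonneg C2]
  · have := h2 y hy
    rw [Real.norm_eq_abs] at this
    linarith [le_abs_self C2, abs_nonneg C1]

lemma nu_ac (K : SignType) (a : ℝ) : nu K a ≪ volume.restrict (J2 a) :=
  withDensity_absolutelyContinuous _ _

lemma withDensity_le_smul {α : Type*} [MeasurableSpace α] {μ : Measure α} {g : α → ENNReal}
    {C : ENNReal} (h : ∀ᵐ x ∂μ, g x ≤ C) : μ.withDensity g ≤ C • μ := by
  rw [← withDensity_const]
  exact withDensity_mono h

lemma le_smul_withDensity {α : Type*} [MeasurableSpace α] {μ : Measure α} {g : α → ENNReal}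
    {c : ENNReal} (hc : c ≠ 0) (hc' : c ≠ ⊤) (h : ∀ᵐ x ∂μ, c ≤ g x) :
    μ ≤ c⁻¹ • μ.withDensity g := by
  have h1 : c • μ ≤ μ.withDensity g := by
    rw [← withDensity_const]
    exact withDensity_mono h
  calc μ = (c⁻¹ * c) • μ := by rw [ENNReal.inv_mul_cancel hc hc', one_smul]
    _ = c⁻¹ • (c • μ) := by rw [smul_smul]
    _ ≤ _ := by gcongr

/-- A density bounded from above and away from zero does not change square integrability. -/
lemma memLp_withDensity_iff {α : Type*} [MeasurableSpace α] {μ : Measure α} {g : α → ℝ} {c C : ℝ}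
    (hc : 0 < c) (h : ∀ᵐ x ∂μ, c ≤ g x ∧ g x ≤ C) {u : α → ℂ} :
    MemLp u 2 (μ.withDensity fun x => ENNReal.ofReal (g x)) ↔ MemLp u 2 μ := by
  constructor
  · intro hu
    refine hu.of_measure_le_smul (c := (ENNReal.ofReal c)⁻¹) (by simpa using hc)
      (le_smul_withDensity (by simpa using hc) ENNReal.ofReal_ne_top ?_)
    filter_upwards [h] with x hx
    exact ENNReal.ofReal_le_ofReal hx.1
  · intro hu
    refine hu.of_measure_le_smul (c := ENNReal.ofReal C) ENNReal.ofReal_ne_top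
      (withDensity_le_smul ?_)
    filter_upwards [h] with x hx
    exact ENNReal.ofReal_le_ofReal hx.2

lemma memLp_nu_iff {K : SignType} {a : ℝ} (hK : K = 1 → a < Real.pi / 2) {u : ℝ → ℂ} :
    MemLp u 2 (nu K a) ↔ MemLp u 2 (volume.restrict (J2 a)) := by
  obtain ⟨c, C, hc, -, h⟩ := exists_coeff_bounds K hK
  exact memLp_withDensity_iff hc (ae_restrict_J2_of_forall fun y hy => ⟨(h y hy).1, (h y hy).2.1⟩)

lemma ae_restrict_Omega0_of_forall {a : ℝ} {P : ℝ × ℝ → Prop}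
    (h : ∀ x, x.2 ∈ Set.Icc (-a) a → P x) : ∀ᵐ x ∂(volume.restrict (Omega0 a)), P x :=
  (ae_restrict_iff' (isOpen_Omega0 a).measurableSet).2
    (Filter.Eventually.of_forall fun x hx => h x ⟨hx.2.1.le, hx.2.2.le⟩)

lemma memLp_muG_iff {K : SignType} {a : ℝ} (hK : K = 1 → a < Real.pi / 2) {u : ℝ × ℝ → ℂ} :
    MemLp u 2 (muG K a) ↔ MemLp u 2 (volume.restrict (Omega0 a)) := by
  obtain ⟨c, C, hc, -, h⟩ := exists_coeff_bounds K hK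
  rw [muG_eq]
  exact memLp_withDensity_iff hc
    (ae_restrict_Omega0_of_forall fun y hy => ⟨(h _ hy).1, (h _ hy).2.1⟩)

lemma integral_nu {K : SignType} {a : ℝ} (hK : K = 1 → a < Real.pi / 2) {E : Type*}
    [NormedAddCommGroup E] [NormedSpace ℝ E] (g : ℝ → E) :
    ∫ y, g y ∂(nu K a) = ∫ y in J2 a, warp K y • g y := by
  have hm : Measurable fun y => ENNReal.ofReal (warp K y) :=
    ENNReal.measurable_ofReal.comp (continuous_warp K).measurable
  rw [nu, integral_withDensity_eq_integral_toReal_smul hm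
    (Filter.Eventually.of_forall fun y => ENNReal.ofReal_lt_top)]
  refine integral_congr_ae (ae_restrict_J2_of_forall fun y hy => ?_)
  simp only [ENNReal.toReal_ofReal (warp_pos_Icc hK hy).le]

/-! ### The boundary conditions as Robin conditions -/

/-- As `b > 0`, the connected conditions, like the separated ones, express the values of the
derivative at the end points through those of the function. -/
lemma Coupling.exists_robin (κ : Coupling) : ∃ p q r s : ℂ, ∀ gm gp hm hp : ℂ,
    κ.Holds gm gp hm hp ↔ hp = p * gp + q * gm ∧ hm = r * gp + s * gm := by
  cases κ with
  | separated α β =>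
    refine ⟨-(β + Complex.I * α), 0, 0, -(-β + Complex.I * α), fun gm gp hm hp => ?_⟩
    simp only [Coupling.Holds]
    constructor
    · rintro ⟨h1, h2⟩
      exact ⟨by linear_combination h1, by linear_combination h2⟩
    · rintro ⟨h1, h2⟩
      exact ⟨by linear_combination h1, by linear_combination h2⟩
  | connected b c φ hb hc hφ =>
    set e := Complex.exp (Complex.I * φ) with he
    set e' := Complex.exp (-(Complex.I * φ)) with he'
    have hee : e * e' = 1 := by rw [he, he', ← Complex.exp_add, add_neg_cancel, Complex.exp_zero]
    set σ : ℂ := (Real.sqrt (1 + b * c) : ℂ) with hσ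
    have hσ2 : σ ^ 2 = 1 + b * c := by
      have h0 : 0 ≤ 1 + b * c := by
        have := mul_le_mul_of_nonneg_left hc hb.le
        rw [mul_div_cancel₀ _ hb.ne'] at this
        linarith
      rw [hσ, ← Complex.ofReal_pow, Real.sq_sqrt h0]
      push_cast; ring
    have hb' : (b : ℂ) ≠ 0 := by exact_mod_cast hb.ne'
    refine ⟨σ * e' / b, -1 / b, 1 / b, -(σ * e) / b, fun gm gp hm hp => ?_⟩
    have e1 : Matrix.mulVec (connMatrix b c φ) ![gm, hm] =
        ![σ * e * gm + b * hm, c * gm + σ * e' * hm] := by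
      ext i
      fin_cases i <;> simp [connMatrix, Matrix.mulVec, dotProduct, Fin.sum_univ_two, hσ, he, he']
    simp only [Coupling.Holds, e1]
    have e2 : ![gp, hp] = ![σ * e * gm + b * hm, c * gm + σ * e' * hm] ↔
        gp = σ * e * gm + b * hm ∧ hp = c * gm + σ * e' * hm := by
      constructor
      · intro h
        exact ⟨congrFun h 0, congrFun h 1⟩
      · rintro ⟨h1, h2⟩
        rw [h1, h2]
    rw [e2]
    constructor
    · rintro ⟨h1, h2⟩
      constructor
      · field_simp
        linear_combination b * h2 - σ * e' * h1 - gm * hσ2 - gm * σ ^ 2 * hee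
      · field_simp
        linear_combination -h1
    · rintro ⟨h1, h2⟩
      have h3 : gp = σ * e * gm + b * hm := by
        rw [h2]; field_simp; ring
      refine ⟨h3, ?_⟩
      rw [h1, h3]
      field_simp
      linear_combination gm * hσ2 + gm * σ ^ 2 * hee

/-! ### Energy estimate for the transverse operators -/

lemma integrable_norm_sq {α : Type*} [MeasurableSpace α] {μ : Measure α} {u : α → ℂ}
    (hu : MemLp u 2 μ) : Integrable (fun x => ‖u x‖ ^ 2) μ :=
  (memLp_two_iff_integrable_sq_norm hu.1).1 hu

lemma ofReal_norm_sq (z : ℂ) : ((‖z‖ ^ 2 : ℝ) : ℂ) = z * (starRingEnd ℂ) z := by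
  rw [Complex.mul_conj, Complex.normSq_eq_norm_sq]

/-- The values at the end points are controlled, with an arbitrarily small constant in front of
the derivative: integrate the derivative of `(y / a) |w(y)|²`. -/
lemma IsPrimitive.norm_sq_endpoints_le {a : ℝ} (ha : 0 < a) {w v : ℝ → ℂ}
    (h : IsPrimitive a w v) (hv : MemLp v 2 (volume.restrict (J2 a))) {ε : ℝ} (hε : 0 < ε) :
    ‖w a‖ ^ 2 + ‖w (-a)‖ ^ 2 ≤ ∫ y in J2 a, ((a⁻¹ + ε⁻¹) * ‖w y‖ ^ 2 + ε * ‖v y‖ ^ 2) := by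
  have hθ : IsPrimitive a (fun y => ((y / a : ℝ) : ℂ)) (fun _ => ((a⁻¹ : ℝ) : ℂ)) :=
    IsPrimitive.of_hasDerivAt (fun y _ => by
      have := ((hasDerivAt_id y).div_const a).ofReal_comp
      simpa [one_div] using this) continuousOn_const
  have key := (hθ.mul (h.mul h.conj)).integral_J2 ha.le
  have e : ((‖w a‖ ^ 2 + ‖w (-a)‖ ^ 2 : ℝ) : ℂ) =
      ((a / a : ℝ) : ℂ) * (w a * (starRingEnd ℂ) (w a)) -
        ((-a / a : ℝ) : ℂ) * (w (-a) * (starRingEnd ℂ) (w (-a))) := by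
    rw [neg_div, div_self ha.ne', Complex.ofReal_add, ofReal_norm_sq, ofReal_norm_sq]
    push_cast; ring
  rw [← e] at key
  have hw := memLp_J2_of_continuousOn h.continuousOn
  have hn : ‖w a‖ ^ 2 + ‖w (-a)‖ ^ 2 = ‖((‖w a‖ ^ 2 + ‖w (-a)‖ ^ 2 : ℝ) : ℂ)‖ := by
    rw [Complex.norm_real, Real.norm_of_nonneg (by positivity)]
  rw [hn, ← key]
  refine norm_integral_le_of_norm_le
    (((integrable_norm_sq hw).const_mul _).add ((integrable_norm_sq hv).const_mul _))
    (ae_restrict_J2_of_forall fun y hy => ?_)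
  have h1 : |y / a| ≤ 1 := by
    rw [abs_div, abs_of_pos ha, div_le_one ha]
    exact abs_le.2 hy
  have h2 : 2 * (‖v y‖ * ‖w y‖) ≤ ε⁻¹ * ‖w y‖ ^ 2 + ε * ‖v y‖ ^ 2 := by
    have h3 : 0 ≤ ε⁻¹ * (‖w y‖ - ε * ‖v y‖) ^ 2 := by positivity
    have h4 : ε⁻¹ * (‖w y‖ - ε * ‖v y‖) ^ 2 =
        ε⁻¹ * ‖w y‖ ^ 2 + ε * ‖v y‖ ^ 2 - 2 * (‖v y‖ * ‖w y‖) := by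
      field_simp; ring
    linarith
  calc _ ≤ a⁻¹ * (‖w y‖ * ‖w y‖) + |y / a| * (‖v y‖ * ‖w y‖ + ‖w y‖ * ‖v y‖) := by
        refine (norm_add_le _ _).trans (add_le_add ?_ ?_)
        · rw [norm_mul, norm_mul, RCLike.norm_conj, Complex.norm_real,
            Real.norm_of_nonneg (inv_nonneg.2 ha.le)]
        · rw [norm_mul, Complex.norm_real, Real.norm_eq_abs]
          refine mul_le_mul_of_nonneg_left ((norm_add_le _ _).trans ?_) (abs_nonneg _)
          rw [norm_mul, norm_mul, RCLike.norm_conj, RCLike.norm_conj]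
    _ ≤ a⁻¹ * (‖w y‖ * ‖w y‖) + 1 * (‖v y‖ * ‖w y‖ + ‖w y‖ * ‖v y‖) := by gcongr
    _ ≤ _ := by nlinarith

/-- A function with two weak derivatives has a continuously differentiable representative whose
derivative is absolutely continuous. -/
lemma HasEndValues.exists_primitive_two {a : ℝ} (ha : 0 < a) {u u1 u2 : ℝ → ℂ} {gm gp hm hp : ℂ}
    (h : HasEndValues a u u1 gm gp) (h' : HasEndValues a u1 u2 hm hp) :
    ∃ w w1, IsPrimitive a w w1 ∧ IsPrimitive a w1 u2 ∧ w =ᵐ[volume.restrict (J2 a)] u ∧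
      w1 =ᵐ[volume.restrict (J2 a)] u1 ∧ w (-a) = gm ∧ w a = gp ∧ w1 (-a) = hm ∧ w1 a = hp := by
  obtain ⟨w, hw, hwu, hm1, hp1⟩ := h.exists_primitive ha
  obtain ⟨w1, hw1, hwu1, hm2, hp2⟩ := h'.exists_primitive ha
  refine ⟨w, w1, ⟨hw1.continuousOn.integrableOn_compact isCompact_Icc, fun y hy => ?_⟩, hw1, hwu,
    hwu1, hm1, hp1, hm2, hp2⟩
  rw [hw.eq_integral y hy]
  congr 1
  rw [intervalIntegral.integral_of_le hy.1, intervalIntegral.integral_of_le hy.1,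
    integral_Ioc_eq_integral_Ioo, integral_Ioc_eq_integral_Ioo]
  exact (integral_congr_ae (ae_restrict_of_ae_restrict_of_subset
    (Set.Ioo_subset_Ioo_right hy.2) hwu1)).symm

lemma le_integral_nu {K : SignType} {a : ℝ} (hK : K = 1 → a < Real.pi / 2) {c : ℝ}
    (hc : ∀ y ∈ Set.Icc (-a) a, c ≤ warp K y) {u : ℝ → ℂ}
    (hu : MemLp u 2 (volume.restrict (J2 a))) :
    c * ∫ y in J2 a, ‖u y‖ ^ 2 ≤ ∫ y, ‖u y‖ ^ 2 ∂(nu K a) := by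
  obtain ⟨_, C, _, _, hC⟩ := exists_coeff_bounds K hK
  rw [integral_nu hK, ← integral_const_mul]
  refine integral_mono_ae ((integrable_norm_sq hu).const_mul c) ?_
    (ae_restrict_J2_of_forall fun y hy => ?_)
  · simp only [smul_eq_mul]
    refine (integrable_norm_sq hu).bdd_mul (c := C) (continuous_warp K).aestronglyMeasurable
      (ae_restrict_J2_of_forall fun y hy => ?_)
    rw [Real.norm_of_nonneg (warp_pos_Icc hK hy).le]
    exact (hC y hy).2.1
  · exact mul_le_mul_of_nonneg_right (hc y hy) (by positivity)

/-- The trace inequality: the boundary values are form-bounded with respect to `‖u'‖²` with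
arbitrarily small relative bound `ε`. -/
lemma exists_endpoint_bound {K : SignType} {a : ℝ} (ha : 0 < a) (hK : K = 1 → a < Real.pi / 2)
    {ε : ℝ} (hε : 0 < ε) : ∃ C : ℝ, 0 ≤ C ∧ ∀ (u u1 : ℝ → ℂ) (gm gp : ℂ),
      HasEndValues a u u1 gm gp →
        ‖gp‖ ^ 2 + ‖gm‖ ^ 2 ≤
          ε * ∫ y, ‖u1 y‖ ^ 2 ∂(nu K a) + C * ∫ y, ‖u y‖ ^ 2 ∂(nu K a) := by
  obtain ⟨c, _, hc, _, hb⟩ := exists_coeff_bounds K hK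
  refine ⟨(a⁻¹ + (ε * c)⁻¹) / c, by positivity, fun u u1 gm gp h => ?_⟩
  obtain ⟨w, hw, hwu, rfl, rfl⟩ := h.exists_primitive ha
  refine (hw.norm_sq_endpoints_le ha h.memLp_deriv (mul_pos hε hc)).trans ?_
  have h0 := le_integral_nu hK (fun y hy => (hb y hy).1) h.memLp_fun
  have h1 := le_integral_nu hK (fun y hy => (hb y hy).1) h.memLp_deriv
  have e : ∫ y in J2 a, ((a⁻¹ + (ε * c)⁻¹) * ‖w y‖ ^ 2 + ε * c * ‖u1 y‖ ^ 2) =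
      (a⁻¹ + (ε * c)⁻¹) * (∫ y in J2 a, ‖u y‖ ^ 2) + ε * c * ∫ y in J2 a, ‖u1 y‖ ^ 2 := by
    rw [← integral_const_mul, ← integral_const_mul, ← integral_add
      ((integrable_norm_sq h.memLp_fun).const_mul _)
      ((integrable_norm_sq h.memLp_deriv).const_mul _)]
    refine integral_congr_ae ?_
    filter_upwards [hwu] with y hy
    rw [hy]
  rw [e]
  have h2 : (a⁻¹ + (ε * c)⁻¹) * (∫ y in J2 a, ‖u y‖ ^ 2) =
      (a⁻¹ + (ε * c)⁻¹) / c * (c * ∫ y in J2 a, ‖u y‖ ^ 2) := by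
    field_simp
  rw [h2, add_comm, mul_assoc]
  gcongr

/-- Green's identity for the quadratic form of the transverse operator. -/
lemma IsPrimitive.integral_action1_mul_conj {K : SignType} {a : ℝ} (ha : 0 < a)
    (hK : K = 1 → a < Real.pi / 2) (m : ℤ) {u u1 u2 : ℝ → ℂ} (h : IsPrimitive a u u1)
    (h' : IsPrimitive a u1 u2) :
    ∫ y, action1 K m u u1 u2 y * (starRingEnd ℂ) (u y) ∂(nu K a) =
      ((∫ y, (‖u1 y‖ ^ 2 + (m : ℝ) ^ 2 * (warp K y ^ 2)⁻¹ * ‖u y‖ ^ 2) ∂(nu K a) : ℝ) : ℂ) -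
        warp K a * (u1 a * (starRingEnd ℂ) (u a) - u1 (-a) * (starRingEnd ℂ) (u (-a))) := by
  have hf : IsPrimitive a (fun y => (warp K y : ℂ)) (fun y => ((drift K y * warp K y : ℝ) : ℂ)) :=
    IsPrimitive.of_hasDerivAt (fun y hy => (hasDerivAt_warp hK hy).ofReal_comp)
      (Complex.continuous_ofReal.comp_continuousOn
        ((continuousOn_drift hK).mul (continuous_warp K).continuousOn))
  have hd := (hf.mul h').mul h.conj
  have key := hd.integral_J2 ha.le
  rw [warp_neg] at key
  have i1 : Integrable (fun y => (drift K y * warp K y : ℝ) * u1 y * (starRingEnd ℂ) (u y) +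
      warp K y * u2 y * (starRingEnd ℂ) (u y) + warp K y * u1 y * (starRingEnd ℂ) (u1 y))
      (volume.restrict (J2 a)) := by
    refine (hd.integrable.mono_set Set.Ioo_subset_Icc_self).congr
      (Filter.Eventually.of_forall fun y => ?_)
    simp only
    ring
  have hc : ContinuousOn (fun y => (warp K y *
      (‖u1 y‖ ^ 2 + (m : ℝ) ^ 2 * (warp K y ^ 2)⁻¹ * ‖u y‖ ^ 2) : ℝ)) (Set.Icc (-a) a) := by
    have hw := (continuous_warp K).continuousOn (s := Set.Icc (-a) a)
    exact hw.mul ((h'.continuousOn.norm.pow 2).add ((continuousOn_const.mul ((hw.pow 2).inv₀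
      fun y hy => (pow_pos (warp_pos_Icc hK hy) 2).ne')).mul (h.continuousOn.norm.pow 2)))
  have i2 : Integrable (fun y => ((warp K y *
      (‖u1 y‖ ^ 2 + (m : ℝ) ^ 2 * (warp K y ^ 2)⁻¹ * ‖u y‖ ^ 2) : ℝ) : ℂ))
      (volume.restrict (J2 a)) :=
    ((hc.integrableOn_compact isCompact_Icc).mono_set Set.Ioo_subset_Icc_self).ofReal
  have e : ∫ y in J2 a, ((drift K y * warp K y : ℝ) * u1 y * (starRingEnd ℂ) (u y) +
      warp K y * u2 y * (starRingEnd ℂ) (u y) + warp K y * u1 y * (starRingEnd ℂ) (u1 y)) =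
      warp K a * (u1 a * (starRingEnd ℂ) (u a) - u1 (-a) * (starRingEnd ℂ) (u (-a))) := by
    rw [show (warp K a * (u1 a * (starRingEnd ℂ) (u a) - u1 (-a) * (starRingEnd ℂ) (u (-a))) : ℂ) =
      warp K a * u1 a * (starRingEnd ℂ) (u a) - warp K a * u1 (-a) * (starRingEnd ℂ) (u (-a)) by
        ring, ← key]
    refine integral_congr_ae (Filter.Eventually.of_forall fun y => ?_)
    simp only
    ring
  rw [← e, integral_nu hK, integral_nu hK]
  simp only [smul_eq_mul]
  rw [← integral_complex_ofReal, ← integral_sub i2 i1]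
  refine integral_congr_ae (ae_restrict_J2_of_forall fun y hy => ?_)
  have hne : (warp K y : ℂ) ≠ 0 := by exact_mod_cast (warp_pos_Icc hK hy).ne'
  simp only [action1, Complex.real_smul]
  push_cast
  have e1 := ofReal_norm_sq (u y)
  have e2 := ofReal_norm_sq (u1 y)
  push_cast at e1 e2
  rw [e1, e2]
  ring

/-- The transverse quadratic forms are bounded below, uniformly in `m`, and control the derivative;
the centrifugal term contributes a multiple of `m²`. -/
lemma exists_energy_bound {K : SignType} {a : ℝ} (ha : 0 < a) (hK : K = 1 → a < Real.pi / 2)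
    (κ : Coupling) : ∃ k C : ℝ, 0 < k ∧ 0 ≤ C ∧ ∀ (m : ℤ) (u u1 u2 : ℝ → ℂ) (gm gp hm hp : ℂ),
      HasEndValues a u u1 gm gp → HasEndValues a u1 u2 hm hp → κ.Holds gm gp hm hp →
      2⁻¹ * ∫ y, ‖u1 y‖ ^ 2 ∂(nu K a) + (k * (m : ℝ) ^ 2 - C) * ∫ y, ‖u y‖ ^ 2 ∂(nu K a) ≤
        (∫ y, action1 K m u u1 u2 y * (starRingEnd ℂ) (u y) ∂(nu K a)).re := by
  obtain ⟨c, D, hc, hD, hb⟩ := exists_coeff_bounds K hK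
  obtain ⟨p, q, r, s, hR⟩ := κ.exists_robin
  set M := ‖p‖ + ‖q‖ + ‖r‖ + ‖s‖ with hM
  have hM0 : 0 ≤ M := by positivity
  -- the boundary term is at most `2 D M (|u(a)|² + |u(-a)|²)`, so this `ε` absorbs it in half of
  -- `‖u'‖²`
  obtain ⟨E, hE, hEb⟩ := exists_endpoint_bound ha hK (ε := (4 * (D * M + 1))⁻¹) (by positivity)
  refine ⟨(D ^ 2)⁻¹, 2 * (D * M + 1) * E, by positivity, by positivity,
    fun m u u1 u2 gm gp hm hp h h' hB => ?_⟩
  obtain ⟨hB1, hB2⟩ := (hR _ _ _ _).1 hB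
  have hend := hEb u u1 gm gp h
  obtain ⟨w, w1, hw, hw1, hwu, hwu1, e1, e2, e3, e4⟩ := h.exists_primitive_two ha h'
  have id := hw.integral_action1_mul_conj ha hK m hw1
  have ac := nu_ac K a
  have t1 : ∫ y, action1 K m w w1 u2 y * (starRingEnd ℂ) (w y) ∂(nu K a) =
      ∫ y, action1 K m u u1 u2 y * (starRingEnd ℂ) (u y) ∂(nu K a) := by
    refine integral_congr_ae ?_
    filter_upwards [ac.ae_eq hwu, ac.ae_eq hwu1] with y h1 h2
    simp only [action1, h1, h2]
  have i0 : Integrable (fun y => ‖w y‖ ^ 2) (nu K a) :=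
    integrable_norm_sq ((memLp_nu_iff hK).2 (memLp_J2_of_continuousOn hw.continuousOn))
  have i1 : Integrable (fun y => ‖w1 y‖ ^ 2) (nu K a) :=
    integrable_norm_sq ((memLp_nu_iff hK).2 (memLp_J2_of_continuousOn hw1.continuousOn))
  have ib : ∀ᵐ y ∂(nu K a), (D ^ 2)⁻¹ ≤ (warp K y ^ 2)⁻¹ ∧ (warp K y ^ 2)⁻¹ ≤ (c ^ 2)⁻¹ :=
    ac.ae_le (ae_restrict_J2_of_forall fun y hy => by
      have hp := warp_pos_Icc hK hy
      exact ⟨inv_anti₀ (by positivity) (pow_le_pow_left₀ hp.le (hb y hy).2.1 2),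
        inv_anti₀ (by positivity) (pow_le_pow_left₀ hc.le (hb y hy).1 2)⟩)
  have i2 : Integrable (fun y => (m : ℝ) ^ 2 * (warp K y ^ 2)⁻¹ * ‖w y‖ ^ 2) (nu K a) := by
    refine i0.bdd_mul (c := (m : ℝ) ^ 2 * (c ^ 2)⁻¹)
      (((continuous_warp K).measurable.pow_const 2).inv.const_mul _).aestronglyMeasurable ?_
    filter_upwards [ib] with y hy
    rw [norm_mul, Real.norm_of_nonneg (by positivity), Real.norm_of_nonneg (by positivity)]
    exact mul_le_mul_of_nonneg_left hy.2 (by positivity)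
  have lower : ∫ y, ‖u1 y‖ ^ 2 ∂(nu K a) + (D ^ 2)⁻¹ * (m : ℝ) ^ 2 * ∫ y, ‖u y‖ ^ 2 ∂(nu K a) ≤
      ∫ y, (‖w1 y‖ ^ 2 + (m : ℝ) ^ 2 * (warp K y ^ 2)⁻¹ * ‖w y‖ ^ 2) ∂(nu K a) := by
    rw [integral_add i1 i2]
    refine add_le_add (le_of_eq (integral_congr_ae ?_)) ?_
    · filter_upwards [ac.ae_eq hwu1] with y h1
      rw [h1]
    · rw [← integral_const_mul]
      have : ∫ y, (D ^ 2)⁻¹ * (m : ℝ) ^ 2 * ‖u y‖ ^ 2 ∂(nu K a) =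
          ∫ y, (D ^ 2)⁻¹ * (m : ℝ) ^ 2 * ‖w y‖ ^ 2 ∂(nu K a) := by
        refine integral_congr_ae ?_
        filter_upwards [ac.ae_eq hwu] with y h1
        rw [h1]
      rw [this]
      refine integral_mono_ae (i0.const_mul _) i2 ?_
      filter_upwards [ib] with y hy
      refine mul_le_mul_of_nonneg_right ?_ (by positivity)
      rw [mul_comm]
      exact mul_le_mul_of_nonneg_left hy.1 (by positivity)
  have bdry : (warp K a * (hp * (starRingEnd ℂ) gp - hm * (starRingEnd ℂ) gm) : ℂ).re ≤
      2 * (D * M + 1) * (‖gp‖ ^ 2 + ‖gm‖ ^ 2) := by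
    have haI : a ∈ Set.Icc (-a) a := ⟨by linarith, le_rfl⟩
    have hP : ‖hp‖ ≤ M * (‖gp‖ + ‖gm‖) := by
      rw [hB1]
      refine (norm_add_le _ _).trans ?_
      rw [norm_mul, norm_mul, mul_add]
      gcongr
      · rw [hM]; linarith [norm_nonneg q, norm_nonneg r, norm_nonneg s]
      · rw [hM]; linarith [norm_nonneg p, norm_nonneg r, norm_nonneg s]
    have hQ : ‖hm‖ ≤ M * (‖gp‖ + ‖gm‖) := by
      rw [hB2]
      refine (norm_add_le _ _).trans ?_
      rw [norm_mul, norm_mul, mul_add]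
      gcongr
      · rw [hM]; linarith [norm_nonneg q, norm_nonneg p, norm_nonneg s]
      · rw [hM]; linarith [norm_nonneg p, norm_nonneg r, norm_nonneg q]
    calc _ ≤ ‖(warp K a * (hp * (starRingEnd ℂ) gp - hm * (starRingEnd ℂ) gm) : ℂ)‖ :=
          Complex.re_le_norm _
      _ ≤ warp K a * (‖hp‖ * ‖gp‖ + ‖hm‖ * ‖gm‖) := by
          rw [norm_mul, Complex.norm_real, Real.norm_of_nonneg (warp_pos_Icc hK haI).le]
          refine mul_le_mul_of_nonneg_left ((norm_sub_le _ _).trans_eq ?_) (warp_pos_Icc hK haI).le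
          rw [norm_mul, norm_mul, RCLike.norm_conj, RCLike.norm_conj]
      _ ≤ D * (M * (‖gp‖ + ‖gm‖) * ‖gp‖ + M * (‖gp‖ + ‖gm‖) * ‖gm‖) := by
          gcongr
          exact (hb a haI).2.1
      _ = D * M * (‖gp‖ + ‖gm‖) ^ 2 := by ring
      _ ≤ D * M * (2 * (‖gp‖ ^ 2 + ‖gm‖ ^ 2)) := by
          gcongr
          nlinarith [sq_nonneg (‖gp‖ - ‖gm‖)]
      _ ≤ _ := by nlinarith [sq_nonneg ‖gp‖, sq_nonneg ‖gm‖]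
  rw [← t1, id, Complex.sub_re, Complex.ofReal_re, e1, e2, e3, e4]
  have h3 : 2 * (D * M + 1) * (‖gp‖ ^ 2 + ‖gm‖ ^ 2) ≤
      2⁻¹ * ∫ y, ‖u1 y‖ ^ 2 ∂(nu K a) + 2 * (D * M + 1) * E * ∫ y, ‖u y‖ ^ 2 ∂(nu K a) := by
    have := mul_le_mul_of_nonneg_left hend (show 0 ≤ 2 * (D * M + 1) by positivity)
    refine this.trans_eq ?_
    field_simp
    ring
  linarith

/-! ### The initial value problem and the transverse boundary value problem -/

/-- Linear Volterra equations are solvable: in the weighted norm `sup |e^{-μ (y - l)} w(y)|` with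
`μ` large, the integral operator is a contraction. -/
lemma exists_volterra {E : Type*} [NormedAddCommGroup E] [NormedSpace ℂ E] [CompleteSpace E]
    {l r : ℝ} (hlr : l ≤ r) {A : ℝ → E →L[ℂ] E} (hA : ContinuousOn A (Set.Icc l r)) {g : ℝ → E}
    (hg : ContinuousOn g (Set.Icc l r)) :
    ∃ w : ℝ → E, ContinuousOn w (Set.Icc l r) ∧
      ∀ y ∈ Set.Icc l r, w y = g y + ∫ s in l..y, A s (w s) := by
  obtain ⟨M, hM⟩ := isCompact_Icc.exists_bound_of_continuousOn hA
  have hM0 : 0 ≤ M := (norm_nonneg _).trans (hM l ⟨le_rfl, hlr⟩)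
  set μ : ℝ := 2 * M + 1 with hμ
  have hμ0 : 0 < μ := by positivity
  set A' : ℝ → E →L[ℂ] E := fun s => A (Set.projIcc l r hlr s) with hA'
  have hA'c : Continuous A' :=
    hA.comp_continuous (continuous_subtype_val.comp continuous_projIcc) fun s => Subtype.prop _
  have hA'M : ∀ s, ‖A' s‖ ≤ M := fun s => hM _ (Subtype.prop _)
  have hgc : Continuous fun y : Set.Icc l r => g y :=
    hg.comp_continuous continuous_subtype_val fun y => y.2
  have hic : ∀ v : C(Set.Icc l r, E), Continuous fun s : ℝ =>
      Real.exp (μ * (s - l)) • A' s (v (Set.projIcc l r hlr s)) := fun v =>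
    (by fun_prop : Continuous fun s : ℝ => Real.exp (μ * (s - l))).smul
      (hA'c.clm_apply (v.continuous.comp continuous_projIcc))
  let Φ : C(Set.Icc l r, E) → C(Set.Icc l r, E) := fun v =>
    ⟨fun y => Real.exp (-(μ * (y - l))) • (g y + ∫ s in l..y, Real.exp (μ * (s - l)) •
      A' s (v (Set.projIcc l r hlr s))),
      (by fun_prop : Continuous fun y : Set.Icc l r => Real.exp (-(μ * ((y : ℝ) - l)))).smul
        (hgc.add ((intervalIntegral.continuous_primitive
          (fun _ _ => (hic v).intervalIntegrable _ _) l).comp continuous_subtype_val))⟩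
  have hexp : ∀ y : ℝ, ∫ s in l..y, Real.exp (μ * (s - l)) = (Real.exp (μ * (y - l)) - 1) / μ := by
    intro y
    have hd : ∀ s ∈ Set.uIcc l y, HasDerivAt (fun s => Real.exp (μ * (s - l)) / μ)
        (Real.exp (μ * (s - l))) s := by
      intro s _
      have := (((hasDerivAt_id s).sub_const l).const_mul μ).exp.div_const μ
      simpa [mul_div_assoc, hμ0.ne'] using this
    rw [intervalIntegral.integral_eq_sub_of_hasDerivAt hd
      ((by fun_prop : Continuous fun s : ℝ => Real.exp (μ * (s - l))).intervalIntegrable _ _)]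
    simp
    ring
  have hΦ : ContractingWith (1 / 2) Φ := by
    refine ⟨by norm_num [← NNReal.coe_lt_coe], LipschitzWith.of_dist_le_mul fun v w => ?_⟩
    rw [ContinuousMap.dist_le (by positivity)]
    intro y
    have e : (Φ v) y - (Φ w) y = Real.exp (-(μ * (y - l))) • ∫ s in l..y,
        (Real.exp (μ * (s - l)) • A' s (v (Set.projIcc l r hlr s)) -
          Real.exp (μ * (s - l)) • A' s (w (Set.projIcc l r hlr s))) := by
      rw [intervalIntegral.integral_sub ((hic v).intervalIntegrable _ _)
        ((hic w).intervalIntegrable _ _)]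
      change Real.exp (-(μ * (y - l))) • ((_ : E) + (_ : E)) -
        Real.exp (-(μ * (y - l))) • ((_ : E) + (_ : E)) = _
      rw [← smul_sub, add_sub_add_left_eq_sub]
    have hb : ‖∫ s in l..y, (Real.exp (μ * (s - l)) • A' s (v (Set.projIcc l r hlr s)) -
          Real.exp (μ * (s - l)) • A' s (w (Set.projIcc l r hlr s)))‖ ≤
        ∫ s in l..y, Real.exp (μ * (s - l)) * (M * dist v w) := by
      refine intervalIntegral.norm_integral_le_of_norm_le y.2.1
        (Filter.Eventually.of_forall fun s _ => ?_)
        (Continuous.intervalIntegrable (by fun_prop) _ _)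
      rw [← smul_sub, ← map_sub, norm_smul, Real.norm_of_nonneg (Real.exp_pos _).le]
      refine mul_le_mul_of_nonneg_left (((A' s).le_opNorm _).trans ?_) (Real.exp_pos _).le
      refine mul_le_mul (hA'M s) ?_ (norm_nonneg _) hM0
      rw [← dist_eq_norm]
      exact ContinuousMap.dist_apply_le_dist _
    rw [intervalIntegral.integral_mul_const, hexp] at hb
    rw [dist_eq_norm, e, norm_smul, Real.norm_of_nonneg (Real.exp_pos _).le]
    calc _ ≤ Real.exp (-(μ * (y - l))) * ((Real.exp (μ * (y - l)) - 1) / μ * (M * dist v w)) :=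
          mul_le_mul_of_nonneg_left hb (Real.exp_pos _).le
      _ = (1 - Real.exp (-(μ * (y - l)))) * (M / μ * dist v w) := by
          have : Real.exp (-(μ * (y - l))) * Real.exp (μ * (y - l)) = 1 := by
            rw [← Real.exp_add, neg_add_cancel, Real.exp_zero]
          linear_combination (M / μ * dist v w) * this
      _ ≤ 1 * (2⁻¹ * dist v w) := by
          refine mul_le_mul (by linarith [Real.exp_pos (-(μ * (y - l)))]) ?_ (by positivity)
            zero_le_one
          refine mul_le_mul_of_nonneg_right ?_ dist_nonneg
          rw [div_le_iff₀ hμ0, hμ]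
          linarith
      _ = _ := by simp
  obtain ⟨v, hv⟩ : ∃ v, Φ v = v := ⟨_, hΦ.fixedPoint_isFixedPt⟩
  have hv' : ∀ y : Set.Icc l r, v y = Real.exp (-(μ * (y - l))) • (g y + ∫ s in l..y,
      Real.exp (μ * (s - l)) • A' s (v (Set.projIcc l r hlr s))) := fun y =>
    (congrArg (fun f : C(Set.Icc l r, E) => f y) hv).symm
  refine ⟨fun y => Real.exp (μ * (y - l)) • v (Set.projIcc l r hlr y), ?_, fun y hy => ?_⟩
  · exact ((by fun_prop : Continuous fun s : ℝ => Real.exp (μ * (s - l))).smul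
      (v.continuous.comp continuous_projIcc)).continuousOn
  · simp only
    rw [Set.projIcc_of_mem hlr hy, hv' ⟨y, hy⟩, smul_smul, ← Real.exp_add, add_neg_cancel,
      Real.exp_zero, one_smul]
    congr 1
    refine intervalIntegral.integral_congr fun s hs => ?_
    rw [Set.uIcc_of_le hy.1] at hs
    have hs' : s ∈ Set.Icc l r := ⟨hs.1, hs.2.trans hy.2⟩
    simp only [hA', Set.projIcc_of_mem hlr hs']
    exact ((A s).map_smul_of_tower _ _).symm

namespace IsPrimitive

variable {a : ℝ} {u v p q : ℝ → ℂ}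

lemma lin (c : ℂ) (h : IsPrimitive a u v) (h' : IsPrimitive a p q) :
    IsPrimitive a (fun y => c * u y + p y) (fun y => c * v y + q y) := by
  refine ⟨(h.integrable.const_mul c).add h'.integrable, fun y hy => ?_⟩
  rw [intervalIntegral.integral_add ((h.intervalIntegrable hy).const_mul c)
    (h'.intervalIntegrable hy), intervalIntegral.integral_const_mul, h.eq_integral y hy,
    h'.eq_integral y hy]
  ring

end IsPrimitive

lemma continuousOn_potential {K : SignType} {a : ℝ} (hK : K = 1 → a < Real.pi / 2) (m : ℤ) (z : ℂ) :
    ContinuousOn (fun y => (((m : ℝ) ^ 2 * (warp K y ^ 2)⁻¹ : ℝ) : ℂ) - z) (Set.Icc (-a) a) := by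
  refine (Complex.continuous_ofReal.comp_continuousOn (continuousOn_const.mul
    (((continuous_warp K).continuousOn.pow 2).inv₀ fun y hy => ?_))).sub continuousOn_const
  exact (pow_pos (warp_pos_Icc hK hy) 2).ne'

lemma intervalIntegrable_of_continuousOn_Icc {E : Type*} [NormedAddCommGroup E] {l r : ℝ}
    {f : ℝ → E} (hf : ContinuousOn f (Set.Icc l r)) (y : ℝ) (hy : y ∈ Set.Icc l r) :
    IntervalIntegrable f volume l y :=
  (hf.mono (by rw [Set.uIcc_of_le hy.1]; exact Set.Icc_subset_Icc_right hy.2)).intervalIntegrable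

/-- The initial value problem for `(H^m - z) u = G`, at the left end point. -/
lemma exists_initial_value {K : SignType} {a : ℝ} (ha : 0 < a) (hK : K = 1 → a < Real.pi / 2)
    (m : ℤ) (z : ℂ) {G : ℝ → ℂ} (hG : IntegrableOn G (Set.Icc (-a) a)) (g h : ℂ) :
    ∃ u u1 u2 : ℝ → ℂ, IsPrimitive a u u1 ∧ IsPrimitive a u1 u2 ∧ u (-a) = g ∧ u1 (-a) = h ∧
      ∀ y, action1 K m u u1 u2 y - z * u y = G y := by
  set Q : ℝ → ℂ := fun y => (((m : ℝ) ^ 2 * (warp K y ^ 2)⁻¹ : ℝ) : ℂ) - z with hQ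
  have hQc : ContinuousOn Q (Set.Icc (-a) a) := continuousOn_potential hK m z
  set d : ℝ → ℂ := fun y => (drift K y : ℂ) with hd
  have hdc : ContinuousOn d (Set.Icc (-a) a) :=
    Complex.continuous_ofReal.comp_continuousOn (continuousOn_drift hK)
  -- the equation as a first order system for `(u, u')` with matrix `B₀ + Q B₁ - d B₂`
  let B0 : ℂ × ℂ →L[ℂ] ℂ × ℂ :=
    (ContinuousLinearMap.inl ℂ ℂ ℂ).comp (ContinuousLinearMap.snd ℂ ℂ ℂ)
  let B1 : ℂ × ℂ →L[ℂ] ℂ × ℂ :=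
    (ContinuousLinearMap.inr ℂ ℂ ℂ).comp (ContinuousLinearMap.fst ℂ ℂ ℂ)
  let B2 : ℂ × ℂ →L[ℂ] ℂ × ℂ :=
    (ContinuousLinearMap.inr ℂ ℂ ℂ).comp (ContinuousLinearMap.snd ℂ ℂ ℂ)
  have hA : ContinuousOn (fun y => B0 + Q y • B1 - d y • B2) (Set.Icc (-a) a) :=
    (continuousOn_const.add (hQc.smul continuousOn_const)).sub (hdc.smul continuousOn_const)
  have hP : IsPrimitive a (fun y => h + ∫ s in (-a)..y, -G s) (fun y => -G y) :=
    IsPrimitive.of_integral h hG.neg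
  obtain ⟨w, hwc, hw⟩ := exists_volterra (by linarith : -a ≤ a) hA
    (g := fun y => (g, h + ∫ s in (-a)..y, -G s)) (continuousOn_const.prodMk hP.continuousOn)
  have c1 : ContinuousOn (fun y => (w y).1) (Set.Icc (-a) a) := continuous_fst.comp_continuousOn hwc
  have c2 : ContinuousOn (fun y => (w y).2) (Set.Icc (-a) a) := continuous_snd.comp_continuousOn hwc
  have hAw : ∀ s, (B0 + Q s • B1 - d s • B2) (w s) =
      ((w s).2, Q s * (w s).1 - d s * (w s).2) := fun s => by
    ext <;> simp [B0, B1, B2]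
  have hmem : -a ∈ Set.Icc (-a) a := ⟨le_rfl, by linarith⟩
  have hii : ∀ {f : ℝ → ℂ}, ContinuousOn f (Set.Icc (-a) a) → ∀ y ∈ Set.Icc (-a) a,
      IntervalIntegrable f volume (-a) y := intervalIntegrable_of_continuousOn_Icc
  have c3 : ContinuousOn (fun s => Q s * (w s).1 - d s * (w s).2) (Set.Icc (-a) a) :=
    (hQc.mul c1).sub (hdc.mul c2)
  have hint : ∀ y ∈ Set.Icc (-a) a, w y = (g + ∫ s in (-a)..y, (w s).2,
      h + (∫ s in (-a)..y, -G s) + ∫ s in (-a)..y, (Q s * (w s).1 - d s * (w s).2)) := by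
    intro y hy
    rw [hw y hy]
    simp only [hAw]
    have e1 := (ContinuousLinearMap.fst ℂ ℂ ℂ).intervalIntegral_comp_comm
      (intervalIntegrable_of_continuousOn_Icc (c2.prodMk c3) y hy)
    have e2 := (ContinuousLinearMap.snd ℂ ℂ ℂ).intervalIntegral_comp_comm
      (intervalIntegrable_of_continuousOn_Icc (c2.prodMk c3) y hy)
    simp only [ContinuousLinearMap.coe_fst', ContinuousLinearMap.coe_snd'] at e1 e2
    ext
    · simp [e1]
    · simp [e2]
  have h0 : w (-a) = (g, h) := by rw [hint _ hmem]; simp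
  refine ⟨fun y => (w y).1, fun y => (w y).2, fun y => -G y + (Q y * (w y).1 - d y * (w y).2),
    ⟨c2.integrableOn_compact isCompact_Icc, fun y hy => ?_⟩,
    ⟨hG.neg.add (c3.integrableOn_compact isCompact_Icc), fun y hy => ?_⟩,
    by simp only [h0], by simp only [h0], fun y => ?_⟩
  · rw [h0, hint y hy]
  · rw [h0, hint y hy]
    simp only
    rw [intervalIntegral.integral_add (hP.intervalIntegrable hy) (hii c3 y hy), add_assoc]
  · simp only [action1, hQ, hd]
    ring

/-- Solvability of the transverse boundary value problem follows from uniqueness: on the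
two-dimensional space of solutions of the homogeneous equation the boundary conditions define an
injective, hence surjective linear map to `ℂ²`. -/
lemma exists_boundary_value {K : SignType} {a : ℝ} (ha : 0 < a) (hK : K = 1 → a < Real.pi / 2)
    (κ : Coupling) (m : ℤ) (z : ℂ)
    (huniq : ∀ u u1 u2 : ℝ → ℂ, IsPrimitive a u u1 → IsPrimitive a u1 u2 →
      κ.Holds (u (-a)) (u a) (u1 (-a)) (u1 a) → (∀ y, action1 K m u u1 u2 y - z * u y = 0) →
      u (-a) = 0 ∧ u1 (-a) = 0) {G : ℝ → ℂ} (hG : IntegrableOn G (Set.Icc (-a) a)) :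
    ∃ u u1 u2 : ℝ → ℂ, IsPrimitive a u u1 ∧ IsPrimitive a u1 u2 ∧
      κ.Holds (u (-a)) (u a) (u1 (-a)) (u1 a) ∧ ∀ y, action1 K m u u1 u2 y - z * u y = G y := by
  obtain ⟨p, q, r, s, hR⟩ := κ.exists_robin
  obtain ⟨v, v1, v2, hv, hv1, bv, bv1, ev⟩ := exists_initial_value ha hK m z hG 0 0
  obtain ⟨x, x1, x2, hx, hx1, bx, bx1, ex⟩ :=
    exists_initial_value ha hK m z (G := fun _ => 0) integrableOn_zero 1 0
  obtain ⟨w, w1, w2, hw, hw1, bw, bw1, ew⟩ :=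
    exists_initial_value ha hK m z (G := fun _ => 0) integrableOn_zero 0 1
  -- the defect of the boundary conditions
  let δ : (ℝ → ℂ) → (ℝ → ℂ) → ℂ × ℂ := fun u u1 =>
    (u1 a - (p * u a + q * u (-a)), u1 (-a) - (r * u a + s * u (-a)))
  have hδ : ∀ u u1 : ℝ → ℂ, κ.Holds (u (-a)) (u a) (u1 (-a)) (u1 a) ↔ δ u u1 = 0 := by
    intro u u1
    rw [hR, Prod.ext_iff]
    simp only [δ, Prod.fst_zero, Prod.snd_zero, sub_eq_zero]
  have comb : ∀ (c d : ℂ) (f f1 f2 : ℝ → ℂ) (F : ℝ → ℂ),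
      (∀ y, action1 K m f f1 f2 y - z * f y = F y) → ∀ y,
      action1 K m (fun y => c * x y + (d * w y + f y)) (fun y => c * x1 y + (d * w1 y + f1 y))
        (fun y => c * x2 y + (d * w2 y + f2 y)) y - z * (c * x y + (d * w y + f y)) = F y := by
    intro c d f f1 f2 F hf y
    have h1 := ex y
    have h2 := ew y
    have h3 := hf y
    simp only [action1] at h1 h2 h3 ⊢
    linear_combination c * h1 + d * h2 + h3
  let L : ℂ × ℂ →ₗ[ℂ] ℂ × ℂ :=
    (LinearMap.toSpanSingleton ℂ (ℂ × ℂ) (δ x x1)).coprod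
      (LinearMap.toSpanSingleton ℂ (ℂ × ℂ) (δ w w1))
  have hL : ∀ c d, L (c, d) = c • δ x x1 + d • δ w w1 := fun c d => by simp [L]
  have hδc : ∀ (c d : ℂ) (f f1 : ℝ → ℂ),
      δ (fun y => c * x y + (d * w y + f y)) (fun y => c * x1 y + (d * w1 y + f1 y)) =
        L (c, d) + δ f f1 := by
    intro c d f f1
    rw [hL]
    ext <;> simp [δ] <;> ring
  have z0 : IsPrimitive a (fun _ => 0) (fun _ => 0) := ⟨integrableOn_zero, fun y _ => by simp⟩
  have hinj : Function.Injective L := by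
    rw [← LinearMap.ker_eq_bot, LinearMap.ker_eq_bot']
    rintro ⟨c, d⟩ hcd
    have := huniq _ _ _ (hx.lin c (hw.lin d z0)) (hx1.lin c (hw1.lin d z0))
      ((hδ (fun y => c * x y + (d * w y + 0)) (fun y => c * x1 y + (d * w1 y + 0))).2
        ((hδc c d (fun _ => 0) (fun _ => 0)).trans (by rw [hcd]; simp [δ])))
      (comb c d _ _ _ (fun _ => 0) (fun y => by simp [action1]))
    rw [bx, bx1, bw, bw1] at this
    ext
    · simpa using this.1
    · simpa using this.2
  obtain ⟨⟨c, d⟩, hcd⟩ := LinearMap.injective_iff_surjective.1 hinj (-δ v v1)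
  refine ⟨_, _, _, hx.lin c (hw.lin d hv), hx1.lin c (hw1.lin d hv1),
    (hδ (fun y => c * x y + (d * w y + v y)) (fun y => c * x1 y + (d * w1 y + v1 y))).2 ?_,
    comb c d _ _ _ G ev⟩
  rw [hδc, hcd, neg_add_cancel]

/-! ### Resolvents in terms of graphs -/

section Graph

variable {E : Type*} [NormedAddCommGroup E] [NormedSpace ℂ E] {T : E →ₗ.[ℂ] E} {z : ℂ}

lemma isResolventAt_iff_graph {R : E →L[ℂ] E} :
    IsResolventAt T z R ↔ (∀ v, (R v, v + z • R v) ∈ T.graph) ∧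
      ∀ u F, (u, F) ∈ T.graph → R (F - z • u) = u := by
  constructor
  · rintro ⟨h1, h2⟩
    refine ⟨fun v => ?_, fun u F huF => ?_⟩
    · obtain ⟨u, hu, hv⟩ := h1 v
      rw [LinearPMap.mem_graph_iff]
      exact ⟨u, hu, by rw [← hu]; exact sub_eq_iff_eq_add.1 hv⟩
    · obtain ⟨x, rfl, rfl⟩ := (LinearPMap.mem_graph_iff T).1 huF
      exact h2 x
  · rintro ⟨h1, h2⟩
    refine ⟨fun v => ?_, fun u => h2 _ _ (T.mem_graph u)⟩
    obtain ⟨u, hu, hv⟩ := (LinearPMap.mem_graph_iff T).1 (h1 v)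
    simp only at hu hv
    exact ⟨u, hu, by rw [hv, hu]; simp⟩

/-- A surjective operator `T - z` that is bounded below has a bounded inverse. -/
lemma mem_rho_of_bound {C : ℝ} (hex : ∀ v, ∃ u, (u, v + z • u) ∈ T.graph)
    (hb : ∀ u F, (u, F) ∈ T.graph → ‖u‖ ≤ C * ‖F - z • u‖) : z ∈ rho T := by
  choose f hf using hex
  have huniq : ∀ u v, (u, v + z • u) ∈ T.graph → u = f v := by
    intro u v h
    have h1 := T.graph.sub_mem h (hf v)
    have h2 := hb _ _ h1
    rw [show v + z • u - (v + z • f v) - z • (u - f v) = 0 by rw [smul_sub]; abel, norm_zero,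
      mul_zero] at h2
    exact sub_eq_zero.1 (norm_le_zero_iff.1 h2)
  let L : E →ₗ[ℂ] E :=
    { toFun := f
      map_add' := fun v w => by
        refine (huniq _ _ ?_).symm
        convert T.graph.add_mem (hf v) (hf w) using 1
        ext <;> simp [smul_add]
        abel
      map_smul' := fun c v => by
        refine (huniq _ _ ?_).symm
        convert T.graph.smul_mem c (hf v) using 1
        ext <;> simp [smul_smul, mul_comm] }
  refine ⟨L.mkContinuous C fun v => ?_, isResolventAt_iff_graph.2 ⟨fun v => hf v, fun u F h => ?_⟩⟩
  · have := hb _ _ (hf v)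
    rwa [add_sub_cancel_right] at this
  · exact (huniq u (F - z • u) (by simpa using h)).symm

end Graph

/-! ### The transverse resolvents -/

lemma HasEndValues.congr {a : ℝ} {u v u' v' : ℝ → ℂ} {gm gp : ℂ} (h : HasEndValues a u v gm gp)
    (hu : u' =ᵐ[volume.restrict (J2 a)] u) (hv : v' =ᵐ[volume.restrict (J2 a)] v) :
    HasEndValues a u' v' gm gp where
  memLp_fun := (memLp_congr_ae hu).2 h.memLp_fun
  memLp_deriv := (memLp_congr_ae hv).2 h.memLp_deriv
  green φ hφ := by
    rw [← h.green φ hφ]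
    refine integral_congr_ae ?_
    filter_upwards [hu, hv] with y h1 h2
    rw [h1, h2]

/-- `H^m ψ = F`, where `U₁`, `U₂` are the first two derivatives of `ψ` and `gm, gp, hm, hp` the
boundary values of `ψ` and `U₁`, all functions being elements of `L²(J₂, dν_K)`. -/
structure IsTransSolution (K : SignType) (a : ℝ) (κ : Coupling) (m : ℤ) (ψ U1 U2 F : L2J2 K a)
    (gm gp hm hp : ℂ) : Prop where
  ends : HasEndValues a ψ U1 gm gp
  ends_deriv : HasEndValues a U1 U2 hm hp
  holds : κ.Holds gm gp hm hp
  eq_action : F =ᵐ[nu K a] action1 K m ψ U1 U2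

section TransverseResolvent

variable {K : SignType} {a : ℝ} {κ : Coupling} {m : ℤ}

lemma TransRel.exists_solution (hK : K = 1 → a < Real.pi / 2) {ψ F : L2J2 K a}
    (h : TransRel K a κ m ψ F) :
    ∃ (U1 U2 : L2J2 K a) (gm gp hm hp : ℂ), IsTransSolution K a κ m ψ U1 U2 F gm gp hm hp := by
  obtain ⟨u, u1, u2, hu, -, -, ⟨gm, gp, hm, hp, t1, t2, hB⟩, hF⟩ := h
  have m1 := (memLp_nu_iff hK).2 t2.memLp_fun
  have m2 := (memLp_nu_iff hK).2 t2.memLp_deriv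
  have ac := restrict_ac_nu hK
  refine ⟨m1.toLp _, m2.toLp _, gm, gp, hm, hp, t1.congr (ac.ae_eq hu) (ac.ae_eq m1.coeFn_toLp),
    t2.congr (ac.ae_eq m1.coeFn_toLp) (ac.ae_eq m2.coeFn_toLp), hB, ?_⟩
  filter_upwards [hF, hu, m1.coeFn_toLp, m2.coeFn_toLp] with y e1 e2 e3 e4
  simp only [e1, action1, e2, e3, e4]

/-- Green's formula for all smooth functions on the closed interval contains the definition of the
weak derivative. -/
lemma HasEndValues.hasWeakDeriv {u v : ℝ → ℂ} {gm gp : ℂ} (h : HasEndValues a u v gm gp) :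
    HasWeakDeriv (J2 a) 1 u v where
  memLp_fun := h.memLp_fun
  memLp_deriv := h.memLp_deriv
  integral_eq φ hφ hU := by
    have h1 := h.green φ hφ
    have z1 : φ a = 0 := image_eq_zero_of_notMem_tsupport fun hx => lt_irrefl _ (hU hx).2
    have z2 : φ (-a) = 0 := image_eq_zero_of_notMem_tsupport fun hx => lt_irrefl _ (hU hx).1
    rw [z1, z2, mul_zero, mul_zero, sub_zero, integral_add
      (integrable_mul_of_memLp h.memLp_fun (hφ.memLp_fderiv _ _))
      (integrable_mul_of_memLp h.memLp_deriv (hφ.memLp _))] at h1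
    exact eq_neg_of_add_eq_zero_left h1

lemma inner_eq_integral (ψ F : L2J2 K a) :
    inner ℂ ψ F = ∫ y, F y * (starRingEnd ℂ) (ψ y) ∂(nu K a) := by
  rw [L2.inner_def]
  simp only [RCLike.inner_apply]

/-- The energy estimate for `(H^m - z) ψ = G`. -/
lemma exists_solution_bound (ha : 0 < a) (hK : K = 1 → a < Real.pi / 2) (κ : Coupling) :
    ∃ k C : ℝ, 0 < k ∧ 0 ≤ C ∧ ∀ (m : ℤ) (z : ℂ) (ψ U1 U2 F : L2J2 K a) (gm gp hm hp : ℂ),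
      IsTransSolution K a κ m ψ U1 U2 F gm gp hm hp →
      2⁻¹ * ‖U1‖ ^ 2 + (k * (m : ℝ) ^ 2 - C - z.re) * ‖ψ‖ ^ 2 ≤ ‖ψ‖ * ‖F - z • ψ‖ := by
  obtain ⟨k, C, hk, hC, h⟩ := exists_energy_bound ha hK κ
  refine ⟨k, C, hk, hC, fun m z ψ U1 U2 F gm gp hm hp hs => ?_⟩
  have h1 := h m _ _ _ _ _ _ _ hs.ends hs.ends_deriv hs.holds
  have h2 : ∫ y, action1 K m ψ U1 U2 y * (starRingEnd ℂ) (ψ y) ∂(nu K a) = inner ℂ ψ F := by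
    rw [inner_eq_integral]
    refine integral_congr_ae ?_
    filter_upwards [hs.eq_action] with y hy
    rw [hy]
  rw [h2, ← norm_sq_L2, ← norm_sq_L2] at h1
  have h3 : inner ℂ ψ F = inner ℂ ψ (F - z • ψ) + z * ((‖ψ‖ ^ 2 : ℝ) : ℂ) := by
    rw [inner_sub_right, inner_smul_right, inner_self_eq_norm_sq_to_K]
    push_cast
    simp
  have h4 : (inner ℂ ψ F : ℂ).re = (inner ℂ ψ (F - z • ψ) : ℂ).re + z.re * ‖ψ‖ ^ 2 := by
    rw [h3, Complex.add_re, Complex.re_mul_ofReal]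
  have h5 : (inner ℂ ψ (F - z • ψ) : ℂ).re ≤ ‖ψ‖ * ‖F - z • ψ‖ :=
    (Complex.re_le_norm _).trans (norm_inner_le_norm _ _)
  rw [h4] at h1
  linarith

lemma memLp_secondDeriv (hK : K = 1 → a < Real.pi / 2) {z : ℂ} {u u1 u2 G : ℝ → ℂ}
    (hu : ContinuousOn u (Set.Icc (-a) a)) (hu1 : ContinuousOn u1 (Set.Icc (-a) a))
    (hG : MemLp G 2 (volume.restrict (J2 a))) (h : ∀ y, action1 K m u u1 u2 y - z * u y = G y) :
    MemLp u2 2 (volume.restrict (J2 a)) := by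
  have h1 := memLp_J2_of_continuousOn (((continuousOn_potential hK m z).mul hu).sub
    ((Complex.continuous_ofReal.comp_continuousOn (continuousOn_drift hK)).mul hu1))
  convert h1.sub hG using 1
  funext y
  have := h y
  simp only [action1] at this
  simp only [Pi.sub_apply, Pi.mul_apply, Function.comp_apply]
  linear_combination -this

/-- Points far to the left on the real axis belong to all resolvent sets. -/
lemma commonRho_nonempty (ha : 0 < a) (hK : K = 1 → a < Real.pi / 2) (κ : Coupling) :
    (commonRho K a κ).Nonempty := by
  obtain ⟨k, C, hk, hC, hE⟩ := exists_energy_bound ha hK κ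
  obtain ⟨k', C', hk', hC', hE'⟩ := exists_solution_bound ha hK κ
  obtain ⟨D, hD, hD'⟩ := exists_endpoint_bound ha hK one_pos
  obtain ⟨p, q, r, s, hR⟩ := κ.exists_robin
  refine ⟨((-(C + C' + 1) : ℝ) : ℂ), Set.mem_iInter.2 fun m => ?_⟩
  set z : ℂ := ((-(C + C' + 1) : ℝ) : ℂ) with hz
  have hzre : z.re = -(C + C' + 1) := Complex.ofReal_re _
  refine mem_rho_of_bound (C := 1) (fun G => ?_) fun ψ F h => ?_
  · have hG : MemLp G 2 (volume.restrict (J2 a)) := (memLp_nu_iff hK).1 (Lp.memLp G)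
    -- uniqueness is only needed for the Cauchy data at `-a`, which are controlled by the energy
    have huniq : ∀ u u1 u2 : ℝ → ℂ, IsPrimitive a u u1 → IsPrimitive a u1 u2 →
        κ.Holds (u (-a)) (u a) (u1 (-a)) (u1 a) →
        (∀ y, action1 K m u u1 u2 y - z * u y = 0) → u (-a) = 0 ∧ u1 (-a) = 0 := by
      intro u u1 u2 hu hu1 hB he
      have hu2 := memLp_secondDeriv hK hu.continuousOn hu1.continuousOn
        (MemLp.zero (ε := ℂ)) he
      have t1 := hu.hasEndValues ha.le (memLp_J2_of_continuousOn hu1.continuousOn)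
      have t2 := hu1.hasEndValues ha.le hu2
      have key := hE m _ _ _ _ _ _ _ t1 t2 hB
      have e : ∫ y, action1 K m u u1 u2 y * (starRingEnd ℂ) (u y) ∂(nu K a) =
          z * ((∫ y, ‖u y‖ ^ 2 ∂(nu K a) : ℝ) : ℂ) := by
        rw [← integral_complex_ofReal, ← integral_const_mul]
        refine integral_congr_ae (Filter.Eventually.of_forall fun y => ?_)
        simp only
        rw [ofReal_norm_sq, sub_eq_zero.1 (he y)]
        ring
      rw [e, Complex.re_mul_ofReal, hzre] at key
      have n0 : 0 ≤ ∫ y, ‖u y‖ ^ 2 ∂(nu K a) := integral_nonneg fun y => by positivity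
      have n1 : 0 ≤ ∫ y, ‖u1 y‖ ^ 2 ∂(nu K a) := integral_nonneg fun y => by positivity
      have n2 : 0 ≤ k * (m : ℝ) ^ 2 * ∫ y, ‖u y‖ ^ 2 ∂(nu K a) := by positivity
      have n3 : 0 ≤ C' * ∫ y, ‖u y‖ ^ 2 ∂(nu K a) := by positivity
      have m0 : ∫ y, ‖u y‖ ^ 2 ∂(nu K a) = 0 := by nlinarith
      have m1 : ∫ y, ‖u1 y‖ ^ 2 ∂(nu K a) = 0 := by nlinarith
      have hend := hD' _ _ _ _ t1
      rw [m0, m1, mul_zero, mul_zero, add_zero] at hend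
      have z1 : u (-a) = 0 := by
        rw [← norm_eq_zero]
        nlinarith [sq_nonneg ‖u a‖, sq_nonneg ‖u (-a)‖]
      have z2 : u a = 0 := by
        rw [← norm_eq_zero]
        nlinarith [sq_nonneg ‖u a‖, sq_nonneg ‖u (-a)‖]
      refine ⟨z1, ?_⟩
      rw [((hR _ _ _ _).1 hB).2, z1, z2, mul_zero, mul_zero, add_zero]
    obtain ⟨u, u1, u2, hu, hu1, hB, he⟩ := exists_boundary_value ha hK κ m z huniq
      (integrableOn_Icc_of_memLp hG)
    have hu2 := memLp_secondDeriv hK hu.continuousOn hu1.continuousOn hG he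
    have t1 := hu.hasEndValues ha.le (memLp_J2_of_continuousOn hu1.continuousOn)
    have t2 := hu1.hasEndValues ha.le hu2
    have hu' := (memLp_nu_iff hK).2 t1.memLp_fun
    refine ⟨hu'.toLp _, (mem_transGraph_iff hK κ m _ _).2 ⟨u, u1, u2, hu'.coeFn_toLp,
      t1.hasWeakDeriv, t2.hasWeakDeriv, ⟨_, _, _, _, t1, t2, hB⟩, ?_⟩⟩
    filter_upwards [Lp.coeFn_add G (z • hu'.toLp u), Lp.coeFn_smul z (hu'.toLp u),
      hu'.coeFn_toLp] with y e1 e2 e3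
    rw [e1, Pi.add_apply, e2, Pi.smul_apply, e3, ← he y, smul_eq_mul]
    ring
  · obtain ⟨U1, U2, gm, gp, hm, hp, hs⟩ := ((mem_transGraph_iff hK κ m _ _).1 h).exists_solution hK
    have key := hE' m z ψ U1 U2 F gm gp hm hp hs
    rw [hzre] at key
    have h2 : 0 ≤ (k' * (m : ℝ) ^ 2 + C) * ‖ψ‖ ^ 2 := by positivity
    have h3 : ‖ψ‖ ^ 2 ≤ ‖ψ‖ * ‖F - z • ψ‖ := by nlinarith [sq_nonneg ‖U1‖]
    rw [one_mul]
    by_contra! hlt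
    have h4 : 0 < ‖ψ‖ := (norm_nonneg _).trans_lt hlt
    nlinarith

/-- The bounds for the transverse resolvents that are uniform in `m`: the energy estimate handles
all but finitely many `m`. -/
lemma exists_resolv_bound (ha : 0 < a) (hK : K = 1 → a < Real.pi / 2) {z : ℂ}
    (hz : z ∈ commonRho K a κ) : ∃ B : ℝ, 0 ≤ B ∧ ∀ (m : ℤ) (G : L2J2 K a),
      (1 + (m : ℝ) ^ 2) * ‖resolv (transOp K a κ m) z G‖ ≤ B * ‖G‖ := by
  obtain ⟨k, C, hk, hC, hE⟩ := exists_solution_bound ha hK κ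
  -- outside of this finite set `k m² - C - Re z ≥ (k / 4) (1 + m²)`
  have hfin : {m : ℤ | (m : ℝ) ^ 2 < 4 / (3 * k) * (C + |z.re| + k / 4)}.Finite := by
    set X := 4 / (3 * k) * (C + |z.re| + k / 4)
    refine (Set.finite_Icc (-⌈|X| + 1⌉) ⌈|X| + 1⌉).subset fun m hm => ?_
    have h1 : |(m : ℝ)| ≤ |X| + 1 := by
      by_contra! hlt
      have h2 : (m : ℝ) ^ 2 < X := hm
      rw [← sq_abs] at h2
      nlinarith [le_abs_self X, abs_nonneg X]
    have h2 := abs_le.1 h1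
    have h3 := Int.le_ceil (|X| + 1)
    constructor
    · have : ((-⌈|X| + 1⌉ : ℤ) : ℝ) ≤ m := by push_cast; linarith
      exact_mod_cast this
    · have : (m : ℝ) ≤ ⌈|X| + 1⌉ := by linarith
      exact_mod_cast this
  have hnn : ∀ m : ℤ, 0 ≤ (1 + (m : ℝ) ^ 2) * ‖resolv (transOp K a κ m) z‖ := fun m => by positivity
  refine ⟨4 / k + ∑ m ∈ hfin.toFinset, (1 + (m : ℝ) ^ 2) * ‖resolv (transOp K a κ m) z‖,
    add_nonneg (by positivity) (Finset.sum_nonneg fun m _ => hnn m), fun m G => ?_⟩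
  set ψ := resolv (transOp K a κ m) z G with hψ
  by_cases hm : m ∈ hfin.toFinset
  · have h1 := Finset.single_le_sum (fun m _ => hnn m) hm
    calc (1 + (m : ℝ) ^ 2) * ‖ψ‖ ≤ (1 + (m : ℝ) ^ 2) * (‖resolv (transOp K a κ m) z‖ * ‖G‖) := by
          gcongr
          exact ContinuousLinearMap.le_opNorm _ _
      _ = (1 + (m : ℝ) ^ 2) * ‖resolv (transOp K a κ m) z‖ * ‖G‖ := by ring
      _ ≤ _ := by
          gcongr
          have : 0 ≤ 4 / k := by positivity
          linarith
  · have hm' : 4 / (3 * k) * (C + |z.re| + k / 4) ≤ (m : ℝ) ^ 2 := by simpa using hm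
    have hg := (isResolventAt_iff_graph.1 (resolv_spec (Set.mem_iInter.1 hz m))).1 G
    obtain ⟨U1, U2, gm, gp, hm, hp, hs⟩ :=
      ((mem_transGraph_iff hK κ m _ _).1 hg).exists_solution hK
    have key := hE m z _ _ _ _ _ _ _ _ hs
    rw [add_sub_cancel_right] at key
    have h1 : k / 4 * (1 + (m : ℝ) ^ 2) ≤ k * (m : ℝ) ^ 2 - C - z.re := by
      have h2 := mul_le_mul_of_nonneg_left hm' (show 0 ≤ 3 * k / 4 by positivity)
      have h3 : 3 * k / 4 * (4 / (3 * k) * (C + |z.re| + k / 4)) = C + |z.re| + k / 4 := by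
        field_simp
      rw [h3] at h2
      linarith [le_abs_self z.re]
    have h2 : k / 4 * (1 + (m : ℝ) ^ 2) * ‖ψ‖ ^ 2 ≤ ‖ψ‖ * ‖G‖ := by
      have := mul_le_mul_of_nonneg_right h1 (sq_nonneg ‖ψ‖)
      linarith [sq_nonneg ‖U1‖]
    have h3 : (1 + (m : ℝ) ^ 2) * ‖ψ‖ ≤ 4 / k * ‖G‖ := by
      rcases (norm_nonneg ψ).eq_or_lt with h0 | h0
      · rw [← h0, mul_zero]; positivity
      · have h4 : k / 4 * ((1 + (m : ℝ) ^ 2) * ‖ψ‖) ≤ ‖G‖ := by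
          refine le_of_mul_le_mul_left ?_ h0
          linarith
        calc _ = 4 / k * (k / 4 * ((1 + (m : ℝ) ^ 2) * ‖ψ‖)) := by field_simp
          _ ≤ _ := by gcongr
    refine h3.trans (mul_le_mul_of_nonneg_right ?_ (norm_nonneg _))
    linarith [Finset.sum_nonneg fun m (_ : m ∈ hfin.toFinset) => hnn m]

/-- The equation bounds the second derivative. -/
lemma IsTransSolution.norm_sq_secondDeriv_le (hK : K = 1 → a < Real.pi / 2)
    {ψ U1 U2 F : L2J2 K a} {gm gp hm hp : ℂ} (hs : IsTransSolution K a κ m ψ U1 U2 F gm gp hm hp)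
    {c M : ℝ} (hc : 0 < c)
    (hcM : ∀ y ∈ Set.Icc (-a) a, c ≤ warp K y ∧ warp K y ≤ M ∧ |drift K y| ≤ M) :
    ‖U2‖ ^ 2 ≤ 3 * (‖F‖ ^ 2 + M ^ 2 * ‖U1‖ ^ 2 + ((m : ℝ) ^ 2 * (c ^ 2)⁻¹) ^ 2 * ‖ψ‖ ^ 2) := by
  have i1 := integrable_norm_sq (Lp.memLp F)
  have i2 := (integrable_norm_sq (Lp.memLp U1)).const_mul (M ^ 2)
  have i3 := (integrable_norm_sq (Lp.memLp ψ)).const_mul (((m : ℝ) ^ 2 * (c ^ 2)⁻¹) ^ 2)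
  have i4 : Integrable (fun y => ‖F y‖ ^ 2 + M ^ 2 * ‖U1 y‖ ^ 2) (nu K a) := i1.add i2
  have i5 : Integrable (fun y => ‖F y‖ ^ 2 + M ^ 2 * ‖U1 y‖ ^ 2 +
      ((m : ℝ) ^ 2 * (c ^ 2)⁻¹) ^ 2 * ‖ψ y‖ ^ 2) (nu K a) := i4.add i3
  rw [norm_sq_L2, norm_sq_L2, norm_sq_L2, norm_sq_L2, ← integral_const_mul, ← integral_const_mul,
    ← integral_add i1 i2, ← integral_add i4 i3, ← integral_const_mul]
  refine integral_mono_ae (integrable_norm_sq (Lp.memLp U2)) (i5.const_mul 3) ?_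
  filter_upwards [hs.eq_action, (nu_ac K a).ae_le (ae_restrict_J2_of_forall hcM),
    (nu_ac K a).ae_le (ae_restrict_J2_of_forall fun y hy => warp_pos_Icc hK hy)]
    with y h1 ⟨h2, h3, h4⟩ h5
  have e : U2 y = -F y - (drift K y : ℂ) * U1 y +
      (((m : ℝ) ^ 2 * (warp K y ^ 2)⁻¹ : ℝ) : ℂ) * ψ y := by
    rw [h1, action1]; ring
  have h6 : ‖U2 y‖ ≤ ‖F y‖ + M * ‖U1 y‖ + (m : ℝ) ^ 2 * (c ^ 2)⁻¹ * ‖ψ y‖ := by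
    rw [e]
    refine (norm_add_le _ _).trans (add_le_add ((norm_sub_le _ _).trans (add_le_add ?_ ?_)) ?_)
    · rw [norm_neg]
    · rw [norm_mul, Complex.norm_real, Real.norm_eq_abs]
      gcongr
    · rw [norm_mul, Complex.norm_real, Real.norm_of_nonneg (by positivity)]
      gcongr
  have h7 := pow_le_pow_left₀ (norm_nonneg _) h6 2
  refine h7.trans ?_
  nlinarith [sq_nonneg (‖F y‖ - M * ‖U1 y‖),
    sq_nonneg (‖F y‖ - (m : ℝ) ^ 2 * (c ^ 2)⁻¹ * ‖ψ y‖),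
    sq_nonneg (M * ‖U1 y‖ - (m : ℝ) ^ 2 * (c ^ 2)⁻¹ * ‖ψ y‖)]

/-- Bounds for the derivatives and the boundary values of `(H^m - z)⁻¹ G` that are uniform in
`m`. -/
lemma exists_resolv_deriv_bound (ha : 0 < a) (hK : K = 1 → a < Real.pi / 2) {z : ℂ}
    (hz : z ∈ commonRho K a κ) : ∃ B : ℝ, ∀ (m : ℤ) (G U1 U2 : L2J2 K a)
      (gm gp hm hp : ℂ), IsTransSolution K a κ m (resolv (transOp K a κ m) z G) U1 U2
        (G + z • resolv (transOp K a κ m) z G) gm gp hm hp →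
      (1 + (m : ℝ) ^ 2) ^ 2 * ‖resolv (transOp K a κ m) z G‖ ^ 2 ≤ B * ‖G‖ ^ 2 ∧
      (1 + (m : ℝ) ^ 2) * ‖U1‖ ^ 2 ≤ B * ‖G‖ ^ 2 ∧ ‖U2‖ ^ 2 ≤ B * ‖G‖ ^ 2 ∧
      (1 + (m : ℝ) ^ 2) * (‖gp‖ ^ 2 + ‖gm‖ ^ 2) ≤ B * ‖G‖ ^ 2 := by
  obtain ⟨k, C, hk, hC, hE⟩ := exists_solution_bound ha hK κ
  obtain ⟨D, hD, hD'⟩ := exists_endpoint_bound ha hK one_pos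
  obtain ⟨B, hB, hBb⟩ := exists_resolv_bound ha hK hz
  obtain ⟨c, M, hc, hM, hcM⟩ := exists_coeff_bounds K hK
  set B1 := 2 * (B + (C + |z.re|) * B ^ 2) with hB1
  have hB1' : 0 ≤ B1 := by positivity
  set B2 := 3 * ((1 + ‖z‖ * B) ^ 2 + M ^ 2 * B1 + (c ^ 2)⁻¹ ^ 2 * B ^ 2) with hB2
  have hB2' : 0 ≤ B2 := by positivity
  refine ⟨B ^ 2 + B1 + B2 + (B1 + D * B ^ 2), fun m G U1 U2 gm gp hm hp hs => ?_⟩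
  set ψ := resolv (transOp K a κ m) z G with hψ
  have hm1 : 1 ≤ 1 + (m : ℝ) ^ 2 := by nlinarith [sq_nonneg (m : ℝ)]
  have b0 := hBb m G
  have b0' : (1 + (m : ℝ) ^ 2) ^ 2 * ‖ψ‖ ^ 2 ≤ B ^ 2 * ‖G‖ ^ 2 := by
    rw [← mul_pow, ← mul_pow]
    exact pow_le_pow_left₀ (by positivity) b0 2
  have hψB : ‖ψ‖ ≤ B * ‖G‖ := le_trans (by nlinarith [norm_nonneg ψ]) b0
  have b1 : (1 + (m : ℝ) ^ 2) * ‖U1‖ ^ 2 ≤ B1 * ‖G‖ ^ 2 := by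
    have key := hE m z _ _ _ _ _ _ _ _ hs
    rw [add_sub_cancel_right] at key
    have h1 : ‖U1‖ ^ 2 ≤ 2 * (‖ψ‖ * ‖G‖ + (C + |z.re|) * ‖ψ‖ ^ 2) := by
      have h2 : 0 ≤ k * (m : ℝ) ^ 2 * ‖ψ‖ ^ 2 := by positivity
      have h3 := mul_le_mul_of_nonneg_right (le_abs_self z.re) (sq_nonneg ‖ψ‖)
      linarith
    calc (1 + (m : ℝ) ^ 2) * ‖U1‖ ^ 2
        ≤ (1 + (m : ℝ) ^ 2) * (2 * (‖ψ‖ * ‖G‖ + (C + |z.re|) * ‖ψ‖ ^ 2)) := by gcongr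
      _ = 2 * ((1 + (m : ℝ) ^ 2) * ‖ψ‖ * ‖G‖ +
            (C + |z.re|) * ((1 + (m : ℝ) ^ 2) * ‖ψ‖ * ‖ψ‖)) := by ring
      _ ≤ 2 * (B * ‖G‖ * ‖G‖ + (C + |z.re|) * (B * ‖G‖ * (B * ‖G‖))) := by gcongr
      _ = _ := by rw [hB1]; ring
  have b1' : ‖U1‖ ^ 2 ≤ B1 * ‖G‖ ^ 2 := le_trans (by nlinarith [sq_nonneg ‖U1‖]) b1
  have b2 : ‖U2‖ ^ 2 ≤ B2 * ‖G‖ ^ 2 := by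
    set F := G + z • ψ with hF
    have hFn : ‖F‖ ^ 2 ≤ (1 + ‖z‖ * B) ^ 2 * ‖G‖ ^ 2 := by
      rw [← mul_pow]
      refine pow_le_pow_left₀ (norm_nonneg _) ((norm_add_le _ _).trans ?_) 2
      rw [norm_smul]
      nlinarith [mul_le_mul_of_nonneg_left hψB (norm_nonneg z)]
    have h1 := hs.norm_sq_secondDeriv_le hK hc hcM
    have h8 : ((m : ℝ) ^ 2 * (c ^ 2)⁻¹) ^ 2 * ‖ψ‖ ^ 2 ≤ (c ^ 2)⁻¹ ^ 2 * (B ^ 2 * ‖G‖ ^ 2) := by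
      calc _ = (c ^ 2)⁻¹ ^ 2 * (((m : ℝ) ^ 2) ^ 2 * ‖ψ‖ ^ 2) := by ring
        _ ≤ (c ^ 2)⁻¹ ^ 2 * ((1 + (m : ℝ) ^ 2) ^ 2 * ‖ψ‖ ^ 2) := by
            gcongr
            linarith
        _ ≤ _ := by gcongr
    calc _ ≤ _ := h1
      _ ≤ 3 * ((1 + ‖z‖ * B) ^ 2 * ‖G‖ ^ 2 + M ^ 2 * (B1 * ‖G‖ ^ 2) +
          (c ^ 2)⁻¹ ^ 2 * (B ^ 2 * ‖G‖ ^ 2)) := by gcongr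
      _ = _ := by rw [hB2]; ring
  have b3 : (1 + (m : ℝ) ^ 2) * (‖gp‖ ^ 2 + ‖gm‖ ^ 2) ≤ (B1 + D * B ^ 2) * ‖G‖ ^ 2 := by
    have h1 := hD' _ _ _ _ hs.ends
    rw [← norm_sq_L2, ← norm_sq_L2, one_mul] at h1
    have h2 : (1 + (m : ℝ) ^ 2) * ‖ψ‖ ^ 2 ≤ B ^ 2 * ‖G‖ ^ 2 := by
      refine le_trans ?_ b0'
      gcongr
      nlinarith
    calc _ ≤ (1 + (m : ℝ) ^ 2) * (‖U1‖ ^ 2 + D * ‖ψ‖ ^ 2) := by gcongr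
      _ = (1 + (m : ℝ) ^ 2) * ‖U1‖ ^ 2 + D * ((1 + (m : ℝ) ^ 2) * ‖ψ‖ ^ 2) := by ring
      _ ≤ B1 * ‖G‖ ^ 2 + D * (B ^ 2 * ‖G‖ ^ 2) := by gcongr
      _ = _ := by ring
  have hG : 0 ≤ ‖G‖ ^ 2 := by positivity
  have hDB : 0 ≤ D * B ^ 2 := by positivity
  refine ⟨b0'.trans ?_, b1.trans ?_, b2.trans ?_, b3.trans ?_⟩ <;>
    refine mul_le_mul_of_nonneg_right ?_ hG <;> linarith [sq_nonneg B]

end TransverseResolvent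

/-! ### The Fourier decomposition in the longitudinal variable -/

lemma conj_phi (m : ℤ) (t : ℝ) : (starRingEnd ℂ) (phi m t) = phi (-m) t := by
  simp only [phi, map_mul, Complex.conj_ofReal, ← Complex.exp_conj, Complex.conj_I, map_intCast]
  push_cast
  ring_nf

lemma phi_add_pi (m : ℤ) : phi m (-Real.pi) = phi m Real.pi := by
  simp only [phi]
  congr 1
  rw [Complex.exp_eq_exp_iff_exists_int]
  refine ⟨-m, ?_⟩
  push_cast
  ring

lemma hasDerivAt_phi (m : ℤ) (t : ℝ) : HasDerivAt (phi m) (Complex.I * m * phi m t) t := by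
  have h1 : HasDerivAt (fun t : ℝ => Complex.I * m * (t : ℂ)) (Complex.I * m) t := by
    simpa using (Complex.ofRealCLM.hasDerivAt (x := t)).const_mul (Complex.I * m)
  have h2 := h1.cexp.const_mul (((Real.sqrt (2 * Real.pi))⁻¹ : ℝ) : ℂ)
  refine h2.congr_deriv ?_
  rw [phi]
  ring

lemma contDiff_phi (m : ℤ) : ContDiff ℝ (⊤ : ℕ∞) (phi m) := by
  unfold phi
  exact contDiff_const.mul ((contDiff_const.mul Complex.ofRealCLM.contDiff).cexp)

lemma phi_mul_phi_neg (m : ℤ) (t : ℝ) : phi m t * phi (-m) t = ((2 * Real.pi)⁻¹ : ℝ) := by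
  rw [← conj_phi, Complex.mul_conj, Complex.normSq_eq_norm_sq, norm_phi, inv_pow,
    Real.sq_sqrt (by positivity)]

lemma integral_J1_eq {f : ℝ → ℂ} : ∫ t in J1, f t = ∫ t in (-Real.pi)..Real.pi, f t := by
  rw [intervalIntegral.integral_of_le (by linarith [Real.pi_pos]), integral_Ioc_eq_integral_Ioo, J1]

lemma integral_conj_phi_mul_phi (m n : ℤ) :
    ∫ t in J1, (starRingEnd ℂ) (phi m t) * phi n t = if m = n then 1 else 0 := by
  split_ifs with h
  · subst h
    simp only [conj_phi, mul_comm (phi (-m) _), phi_mul_phi_neg]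
    rw [integral_const, volume_real_J1]
    have := Real.pi_pos
    rw [Complex.real_smul, ← Complex.ofReal_mul, mul_inv_cancel₀ (by positivity),
      Complex.ofReal_one]
  · have hne : Complex.I * ((n : ℂ) - m) ≠ 0 := by
      refine mul_ne_zero Complex.I_ne_zero (sub_ne_zero.2 ?_)
      exact_mod_cast Ne.symm h
    have hd : ∀ t ∈ Set.uIcc (-Real.pi) Real.pi, HasDerivAt
        (fun t => (Complex.I * ((n : ℂ) - m))⁻¹ * (phi (-m) t * phi n t))
        (phi (-m) t * phi n t) t := by
      intro t _
      refine (((hasDerivAt_phi (-m) t).mul (hasDerivAt_phi n t)).const_mul _).congr_deriv ?_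
      rw [inv_mul_eq_iff_eq_mul₀ hne]
      push_cast
      ring
    rw [integral_J1_eq]
    simp only [conj_phi]
    rw [intervalIntegral.integral_eq_sub_of_hasDerivAt hd
      (((continuous_phi _).mul (continuous_phi _)).intervalIntegrable _ _), phi_add_pi, phi_add_pi,
      sub_self]

lemma inner_phiL2 (m : ℤ) (g : L2J1) :
    inner ℂ (phiL2 m) g = ∫ t in J1, (starRingEnd ℂ) (phi m t) * g t := by
  rw [L2.inner_def]
  refine integral_congr_ae ?_
  filter_upwards [(memLp_phi m).coeFn_toLp] with t ht
  rw [RCLike.inner_apply, phiL2, ht, mul_comm]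

lemma orthonormal_phiL2 : Orthonormal ℂ phiL2 := by
  classical
  rw [orthonormal_iff_ite]
  intro m n
  rw [inner_phiL2, ← integral_conj_phi_mul_phi]
  refine integral_congr_ae ?_
  filter_upwards [(memLp_phi n).coeFn_toLp] with t ht
  rw [phiL2, ht]

/-- Completeness of the trigonometric system on `J₁`. -/
lemma ae_eq_zero_of_phi_coeff {f : ℝ → ℂ} (hf : MemLp f 2 (volume.restrict J1))
    (h : ∀ m : ℤ, ∫ t in J1, (starRingEnd ℂ) (phi m t) * f t = 0) :
    ∫ t in J1, ‖f t‖ ^ 2 = 0 := by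
  have hlt : -Real.pi < Real.pi := by linarith [Real.pi_pos]
  have hf' : MemLp f 2 (volume.restrict (Set.Ioc (-Real.pi) Real.pi)) := by
    rwa [← restrict_Ioo_eq_restrict_Ioc]
  have hs := hasSum_sq_fourierCoeffOn hlt hf'
  have h0 : ∀ n, fourierCoeffOn hlt f n = 0 := by
    intro n
    have e : ∀ x : ℝ, fourier (-n) (x : AddCircle (Real.pi - -Real.pi)) • f x =
        ((Real.sqrt (2 * Real.pi) : ℝ) : ℂ) * ((starRingEnd ℂ) (phi n x) * f x) := by
      intro x
      have hp := Real.pi_pos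
      have hs : ((Real.sqrt (2 * Real.pi) : ℝ) : ℂ) ≠ 0 := by
        exact_mod_cast (Real.sqrt_pos.2 (by positivity)).ne'
      have hpc : (Real.pi : ℂ) ≠ 0 := by exact_mod_cast hp.ne'
      rw [fourier_coe_apply, conj_phi, phi, smul_eq_mul, ← mul_assoc, ← mul_assoc,
        Complex.ofReal_inv, mul_inv_cancel₀ hs, one_mul]
      congr 2
      push_cast
      field_simp
      ring
    rw [fourierCoeffOn_eq_integral]
    simp only [e]
    rw [intervalIntegral.integral_const_mul, ← integral_J1_eq, h n, mul_zero, smul_zero]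
  simp only [h0, norm_zero, ne_eq, OfNat.ofNat_ne_zero, not_false_eq_true, zero_pow] at hs
  have h1 := hs.unique hasSum_zero
  rw [intervalIntegral.integral_of_le hlt.le, integral_Ioc_eq_integral_Ioo, smul_eq_mul,
    mul_eq_zero] at h1
  rcases h1 with h1 | h1
  · exact absurd h1 (inv_ne_zero (by linarith))
  · exact h1

section Modes

variable {K : SignType} {a : ℝ}

lemma eq_zero_of_coeff_eq_zero {Ψ : L2Omega K a} (h : ∀ m, coeff m Ψ = 0) : Ψ = 0 := by
  have h2 : Integrable (fun x : ℝ × ℝ => ‖Ψ x‖ ^ 2) ((volume.restrict J1).prod (nu K a)) :=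
    integrable_norm_sq (Lp.memLp Ψ)
  have h1 : Integrable (fun x : ℝ × ℝ => Ψ x) ((volume.restrict J1).prod (nu K a)) :=
    (Lp.memLp Ψ).integrable (by norm_num)
  have h0 : ∀ᵐ y ∂(nu K a), ∀ m : ℤ, coeffFun m Ψ y = 0 := by
    rw [ae_all_iff]
    intro m
    have := (memLp_coeffFun m Ψ).coeFn_toLp
    filter_upwards [this, (Lp.coeFn_zero ℂ 2 (nu K a))] with y e1 e2
    rw [← e1, ← coeff, h m, e2]
    rfl
  have key : ‖Ψ‖ ^ 2 = 0 := by
    rw [norm_sq_L2]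
    change ∫ x, ‖Ψ x‖ ^ 2 ∂((volume.restrict J1).prod (nu K a)) = 0
    rw [integral_prod_symm _ h2, ← integral_zero ℝ ℝ (μ := nu K a)]
    refine integral_congr_ae ?_
    filter_upwards [h0, h1.prod_left_ae, h2.prod_left_ae] with y e1 e2 e3
    exact ae_eq_zero_of_phi_coeff ((memLp_two_iff_integrable_sq_norm e2.1).2 e3) e1
  exact norm_eq_zero.1 (pow_eq_zero_iff two_ne_zero |>.1 key)

/-- The embedding `h ↦ φ_m ⊗ h` of `L²(J₂, dν_K)` as the `m`-th mode. -/
def modeEmb (K : SignType) (a : ℝ) (m : ℤ) : L2J2 K a →ₗᵢ[ℂ] L2Omega K a where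
  toFun h := tensor (phiL2 m) h
  map_add' h h' := by simpa using tensor_lin (phiL2 m) 1 h h'
  map_smul' c h := by
    have z : tensor (phiL2 m) (0 : L2J2 K a) = 0 := by
      simpa using tensor_lin (phiL2 m) 1 (0 : L2J2 K a) 0
    simpa [z] using tensor_lin (phiL2 m) c h 0
  norm_map' h := (norm_tensor _ _).trans (by rw [orthonormal_phiL2.1 m, one_mul])

/-- The `m`-th Fourier coefficient as a bounded operator; it is the adjoint of `modeEmb`. -/
def modeCoeff (K : SignType) (a : ℝ) (m : ℤ) : L2Omega K a →L[ℂ] L2J2 K a :=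
  LinearMap.mkContinuous
    { toFun := coeff m
      map_add' := fun Ψ Φ => by simpa using coeff_lin m 1 Ψ Φ
      map_smul' := fun c Ψ => by
        have z : coeff m (0 : L2Omega K a) = 0 := by
          simpa using coeff_lin m 1 (0 : L2Omega K a) 0
        simpa [z] using coeff_lin m c Ψ 0 }
    1 fun Ψ => by simpa using norm_coeff_le m Ψ

lemma modeProj_apply (m : ℤ) (Ψ : L2Omega K a) :
    modeProj K a m Ψ = modeEmb K a m (modeCoeff K a m Ψ) := rfl

lemma modeCoeff_ae (m : ℤ) (Ψ : L2Omega K a) : modeCoeff K a m Ψ =ᵐ[nu K a] coeffFun m Ψ :=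
  (memLp_coeffFun m Ψ).coeFn_toLp

lemma tensor_ae (g : L2J1) (h : L2J2 K a) :
    tensor g h =ᵐ[muG K a] fun x => g x.1 * h x.2 :=
  (memLp_tensor g h).coeFn_toLp

lemma modeEmb_ae (m : ℤ) (h : L2J2 K a) :
    modeEmb K a m h =ᵐ[muG K a] fun x => phi m x.1 * h x.2 := by
  have h1 := (Measure.quasiMeasurePreserving_fst (μ := volume.restrict J1)
    (ν := nu K a)).ae (memLp_phi m).coeFn_toLp
  filter_upwards [tensor_ae (phiL2 m) h, h1] with x e1 e2
  change tensor (phiL2 m) h x = _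
  rw [e1, phiL2, e2]

lemma coeffFun_congr (m : ℤ) {Ψ Φ : ℝ × ℝ → ℂ} (h : Ψ =ᵐ[muG K a] Φ) :
    coeffFun m Ψ =ᵐ[nu K a] coeffFun m Φ := by
  have h' := (Measure.measurePreserving_swap (μ := nu K a)
    (ν := volume.restrict J1)).quasiMeasurePreserving.ae h
  filter_upwards [Measure.ae_ae_of_ae_prod h'] with y hy
  refine integral_congr_ae ?_
  filter_upwards [hy] with t ht
  simp only [Prod.swap_prod_mk] at ht
  rw [ht]

lemma modeCoeff_tensor (m : ℤ) (g : L2J1) (h : L2J2 K a) :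
    modeCoeff K a m (tensor g h) = (inner ℂ (phiL2 m) g : ℂ) • h := by
  apply Lp.ext
  filter_upwards [modeCoeff_ae m (tensor g h), coeffFun_congr m (tensor_ae g h),
    Lp.coeFn_smul (inner ℂ (phiL2 m) g : ℂ) h] with y e1 e2 e3
  rw [e1, e2, e3, Pi.smul_apply, smul_eq_mul, inner_phiL2, ← integral_mul_const]
  simp only [coeffFun, mul_assoc]

lemma modeCoeff_modeEmb (m n : ℤ) (h : L2J2 K a) :
    modeCoeff K a m (modeEmb K a n h) = if m = n then h else 0 := by
  have := modeCoeff_tensor m (phiL2 n) h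
  rw [orthonormal_iff_ite.1 orthonormal_phiL2 m n] at this
  refine Eq.trans this ?_
  split_ifs <;> simp

lemma inner_modeEmb (m : ℤ) (h : L2J2 K a) (Ψ : L2Omega K a) :
    inner ℂ (modeEmb K a m h) Ψ = (inner ℂ h (modeCoeff K a m Ψ) : ℂ) := by
  have hi := L2.integrable_inner (𝕜 := ℂ) (modeEmb K a m h) Ψ
  have hi' : Integrable (fun x : ℝ × ℝ => (starRingEnd ℂ) (h x.2) *
      ((starRingEnd ℂ) (phi m x.1) * Ψ x)) ((volume.restrict J1).prod (nu K a)) := by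
    refine hi.congr ?_
    filter_upwards [modeEmb_ae m h] with x hx
    rw [RCLike.inner_apply, hx, map_mul]
    ring
  rw [L2.inner_def, L2.inner_def]
  calc _ = ∫ x, (starRingEnd ℂ) (h x.2) * ((starRingEnd ℂ) (phi m x.1) * Ψ x)
        ∂((volume.restrict J1).prod (nu K a)) := by
        refine integral_congr_ae ?_
        filter_upwards [modeEmb_ae m h] with x hx
        rw [RCLike.inner_apply, hx, map_mul]
        ring
    _ = _ := by
        rw [integral_prod_symm _ hi']
        refine integral_congr_ae ?_
        filter_upwards [modeCoeff_ae m Ψ] with y hy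
        rw [RCLike.inner_apply, hy, coeffFun, mul_comm, ← integral_const_mul]

lemma orthogonalFamily_modeEmb : OrthogonalFamily ℂ (fun _ : ℤ => L2J2 K a) (modeEmb K a) := by
  intro m n hmn h h'
  rw [inner_modeEmb, modeCoeff_modeEmb, if_neg hmn, inner_zero_right]

lemma isHilbertSum_modeEmb : IsHilbertSum ℂ (fun _ : ℤ => L2J2 K a) (modeEmb K a) := by
  refine IsHilbertSum.mk orthogonalFamily_modeEmb ?_
  rw [top_le_iff, Submodule.topologicalClosure_eq_top_iff, Submodule.eq_bot_iff]
  intro Ψ hΨ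
  refine eq_zero_of_coeff_eq_zero fun m => ?_
  have : ∀ h : L2J2 K a, inner ℂ h (modeCoeff K a m Ψ) = 0 := fun h => by
    rw [← inner_modeEmb]
    exact (Submodule.mem_orthogonal _ _).1 hΨ _
      (Submodule.mem_iSup_of_mem m (LinearMap.mem_range_self _ h))
  exact inner_self_eq_zero.1 (this _)

lemma modeCoeff_of_hasSum {u : ℤ → L2J2 K a} {Ψ : L2Omega K a}
    (h : HasSum (fun m => modeEmb K a m (u m)) Ψ) (n : ℤ) : modeCoeff K a n Ψ = u n := by
  have h1 := h.mapL (modeCoeff K a n)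
  simp only [modeCoeff_modeEmb] at h1
  have h2 := hasSum_ite_eq n (u n)
  refine h1.unique ?_
  convert h2 using 1
  funext m
  by_cases hm : m = n
  · simp [hm]
  · simp [hm, Ne.symm hm]

/-- The Fourier expansion of an element of `L²(Ω₀, G)`. -/
lemma hasSum_modes (Ψ : L2Omega K a) :
    HasSum (fun m => modeEmb K a m (modeCoeff K a m Ψ)) Ψ := by
  have h := isHilbertSum_modeEmb.hasSum_linearIsometryEquiv_symm
    ((isHilbertSum_modeEmb (K := K) (a := a)).linearIsometryEquiv Ψ)
  rw [LinearIsometryEquiv.symm_apply_apply] at h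
  have h2 := modeCoeff_of_hasSum h
  simpa only [h2] using h

lemma hasSum_norm_sq_modeCoeff (Ψ : L2Omega K a) :
    HasSum (fun m => ‖modeCoeff K a m Ψ‖ ^ 2) (‖Ψ‖ ^ 2) := by
  have h := (hasSum_modes Ψ).mapL (innerSL ℂ Ψ)
  have e : ∀ m, innerSL ℂ Ψ (modeEmb K a m (modeCoeff K a m Ψ)) =
      ((‖modeCoeff K a m Ψ‖ ^ 2 : ℝ) : ℂ) := fun m => by
    rw [innerSL_apply_apply, ← inner_conj_symm, inner_modeEmb, inner_self_eq_norm_sq_to_K]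
    simp
  simp only [e] at h
  rw [innerSL_apply_apply, inner_self_eq_norm_sq_to_K] at h
  refine Complex.hasSum_ofReal.1 ?_
  simpa using h

lemma summable_modeEmb {u : ℤ → L2J2 K a} (h : Summable fun m => ‖u m‖ ^ 2) :
    Summable fun m => modeEmb K a m (u m) :=
  (orthogonalFamily_modeEmb.summable_iff_norm_sq_summable u).2 h

/-- A bounded sequence of operators on `L²(J₂, dν_K)` defines a diagonal operator on
`L²(Ω₀, G)`. -/
lemma exists_diagonal {A : ℤ → L2J2 K a →L[ℂ] L2J2 K a} {B : ℝ}
    (hA : ∀ m h, ‖A m h‖ ≤ B * ‖h‖) : ∃ R : L2Omega K a →L[ℂ] L2Omega K a,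
      ∀ Ψ, HasSum (fun m => modeEmb K a m (A m (modeCoeff K a m Ψ))) (R Ψ) := by
  have hsq : ∀ m (Ψ : L2Omega K a),
      ‖A m (modeCoeff K a m Ψ)‖ ^ 2 ≤ B ^ 2 * ‖modeCoeff K a m Ψ‖ ^ 2 := fun m Ψ => by
    rw [← mul_pow]
    exact pow_le_pow_left₀ (norm_nonneg _) (hA m _) 2
  have hs : ∀ Ψ : L2Omega K a, Summable fun m => modeEmb K a m (A m (modeCoeff K a m Ψ)) :=
    fun Ψ => summable_modeEmb (Summable.of_nonneg_of_le (fun m => by positivity)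
      (fun m => hsq m Ψ) ((hasSum_norm_sq_modeCoeff Ψ).summable.mul_left _))
  let L : L2Omega K a →ₗ[ℂ] L2Omega K a :=
    { toFun := fun Ψ => ∑' m, modeEmb K a m (A m (modeCoeff K a m Ψ))
      map_add' := fun Ψ Φ => by
        simp only [map_add]
        exact (hs Ψ).tsum_add (hs Φ)
      map_smul' := fun c Ψ => by
        simp only [map_smul, RingHom.id_apply]
        exact (hs Ψ).tsum_const_smul c }
  refine ⟨L.mkContinuous |B| fun Ψ => ?_, fun Ψ => (hs Ψ).hasSum⟩
  refine le_of_tendsto ((hs Ψ).hasSum.norm) (Filter.Eventually.of_forall fun s => ?_)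
  refine le_of_sq_le_sq ?_ (by positivity)
  rw [orthogonalFamily_modeEmb.norm_sum, mul_pow, sq_abs]
  refine (Finset.sum_le_sum fun m _ => hsq m Ψ).trans ?_
  rw [← Finset.mul_sum]
  exact mul_le_mul_of_nonneg_left (sum_le_hasSum s (fun m _ => by positivity)
    (hasSum_norm_sq_modeCoeff Ψ)) (by positivity)

/-- The operator `1 ⊗ A` exists. -/
lemma exists_oneTensor (A : L2J2 K a →L[ℂ] L2J2 K a) : ∃ T : L2Omega K a →L[ℂ] L2Omega K a,
    IsOneTensor A T ∧ ∀ m Ψ, modeCoeff K a m (T Ψ) = A (modeCoeff K a m Ψ) := by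
  obtain ⟨T, hT⟩ := exists_diagonal (A := fun _ : ℤ => A) fun _ h => A.le_opNorm h
  refine ⟨T, fun g h => ?_, fun m Ψ => modeCoeff_of_hasSum (hT Ψ) m⟩
  refine (hT _).unique ?_
  convert hasSum_modes (tensor g (A h)) using 3 with m
  rw [modeCoeff_tensor, modeCoeff_tensor, map_smul]

lemma modeEmb_ext {Ψ Φ : L2Omega K a} (h : ∀ m, modeCoeff K a m Ψ = modeCoeff K a m Φ) : Ψ = Φ :=
  (hasSum_modes Ψ).unique (by simpa only [h] using hasSum_modes Φ)

/-- The mode projections reduce a diagonal operator to its entries. -/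
lemma isDirectSum_of_diagonal {A : ℤ → L2J2 K a →L[ℂ] L2J2 K a}
    {T : ℤ → L2Omega K a →L[ℂ] L2Omega K a} {R : L2Omega K a →L[ℂ] L2Omega K a}
    (hT : ∀ m n Ψ, modeCoeff K a n (T m Ψ) = A m (modeCoeff K a n Ψ))
    (hR : ∀ Ψ, HasSum (fun m => modeEmb K a m (A m (modeCoeff K a m Ψ))) (R Ψ)) :
    IsDirectSum (modeProj K a) T R where
  proj m := by
    constructor
    · ext1 Ψ
      change modeProj K a m (modeProj K a m Ψ) = _
      simp only [modeProj_apply, modeCoeff_modeEmb, if_true]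
    · rw [ContinuousLinearMap.isSelfAdjoint_iff_isSymmetric]
      intro Ψ Φ
      change inner ℂ (modeProj K a m Ψ) Φ = inner ℂ Ψ (modeProj K a m Φ)
      rw [modeProj_apply, modeProj_apply, inner_modeEmb, ← inner_conj_symm Ψ, inner_modeEmb,
        inner_conj_symm]
  orthogonal m n hmn := by
    ext1 Ψ
    change modeProj K a m (modeProj K a n Ψ) = 0
    rw [modeProj_apply, modeProj_apply, modeCoeff_modeEmb, if_neg hmn, map_zero]
  complete := hasSum_modes
  invariant m := by
    ext1 Ψ
    refine modeEmb_ext fun n => ?_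
    change modeCoeff K a n (T m (modeProj K a m Ψ)) = modeCoeff K a n (modeProj K a m (T m Ψ))
    rw [hT, modeProj_apply, modeProj_apply, modeCoeff_modeEmb, modeCoeff_modeEmb, hT]
    split_ifs
    · rfl
    · simp
  hasSum Ψ := by
    convert hR Ψ using 2 with m
    refine modeEmb_ext fun n => ?_
    rw [hT, modeProj_apply, modeCoeff_modeEmb, modeCoeff_modeEmb]
    split_ifs
    · rfl
    · simp

end Modes

/-! ### Fourier coefficients of functions in the domain of the Hamiltonian -/

lemma IsTest.mul_prod {f g : ℝ → ℂ} (hf : IsTest f) (hg : IsTest g) :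
    IsTest fun x : ℝ × ℝ => f x.1 * g x.2 := by
  refine ⟨(hf.1.comp contDiff_fst).mul (hg.1.comp contDiff_snd), ?_⟩
  refine HasCompactSupport.intro (IsCompact.prod hf.2 hg.2) fun x hx => ?_
  rw [Set.mem_prod, not_and_or] at hx
  rcases hx with hx | hx
  · rw [image_eq_zero_of_notMem_tsupport hx, zero_mul]
  · rw [image_eq_zero_of_notMem_tsupport hx, mul_zero]

lemma fderiv_mul_prod {f g : ℝ → ℂ} (hf : Differentiable ℝ f) (hg : Differentiable ℝ g)
    (x e : ℝ × ℝ) : fderiv ℝ (fun x : ℝ × ℝ => f x.1 * g x.2) x e =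
      f x.1 * (fderiv ℝ g x.2 e.2) + fderiv ℝ f x.1 e.1 * g x.2 := by
  have h1 : HasFDerivAt (fun x : ℝ × ℝ => f x.1) ((fderiv ℝ f x.1).comp
      (ContinuousLinearMap.fst ℝ ℝ ℝ)) x := (hf x.1).hasFDerivAt.comp x hasFDerivAt_fst
  have h2 : HasFDerivAt (fun x : ℝ × ℝ => g x.2) ((fderiv ℝ g x.2).comp
      (ContinuousLinearMap.snd ℝ ℝ ℝ)) x := (hg x.2).hasFDerivAt.comp x hasFDerivAt_snd
  rw [(h1.fun_mul h2).fderiv]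
  simp [mul_comm]

lemma restrict_Omega0 (a : ℝ) :
    volume.restrict (Omega0 a) = (volume.restrict J1).prod (volume.restrict (J2 a)) := by
  rw [Measure.prod_restrict]
  rfl

instance isFiniteMeasure_Omega0 (a : ℝ) : IsFiniteMeasure (volume.restrict (Omega0 a)) := by
  rw [restrict_Omega0]
  infer_instance

lemma ae_restrict_J1_of_forall {P : ℝ → Prop} (h : ∀ t ∈ Set.Icc (-Real.pi) Real.pi, P t) :
    ∀ᵐ t ∂(volume.restrict J1), P t :=
  (ae_restrict_iff' measurableSet_Ioo).2
    (Filter.Eventually.of_forall fun y hy => h y ⟨hy.1.le, hy.2.le⟩)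

lemma ae_Omega0_of_forall {a : ℝ} {P : ℝ × ℝ → Prop}
    (h : ∀ x, x.1 ∈ Set.Icc (-Real.pi) Real.pi → x.2 ∈ Set.Icc (-a) a → P x) :
    ∀ᵐ x ∂(volume.restrict (Omega0 a)), P x :=
  (ae_restrict_iff' (isOpen_Omega0 a).measurableSet).2
    (Filter.Eventually.of_forall fun x hx => h x ⟨hx.1.1.le, hx.1.2.le⟩ ⟨hx.2.1.le, hx.2.2.le⟩)

lemma integrable_mul_continuous {a : ℝ} {u h : ℝ × ℝ → ℂ}
    (hu : MemLp u 2 (volume.restrict (Omega0 a))) (hh : Continuous h) :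
    Integrable (fun x => u x * h x) (volume.restrict (Omega0 a)) := by
  obtain ⟨C, hC⟩ := ((isCompact_Icc (a := -Real.pi) (b := Real.pi)).prod
    (isCompact_Icc (a := -a) (b := a))).exists_bound_of_continuousOn hh.continuousOn
  have : Integrable (fun x => h x * u x) (volume.restrict (Omega0 a)) :=
    (hu.integrable (by norm_num)).bdd_mul hh.aestronglyMeasurable
      (ae_Omega0_of_forall fun x h1 h2 => hC x ⟨h1, h2⟩)
  simpa only [mul_comm] using this

/-- For zero curvature `muG` is Lebesgue measure and the condition on `a` is void; facts about
unweighted spaces are obtained from this case. -/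
lemma zero_curvature {a : ℝ} : (0 : SignType) = 1 → a < Real.pi / 2 := fun h => absurd h (by decide)

lemma memLp_coeffFun_J2 {a : ℝ} {u : ℝ × ℝ → ℂ} (hu : MemLp u 2 (volume.restrict (Omega0 a)))
    (m : ℤ) : MemLp (coeffFun m u) 2 (volume.restrict (J2 a)) := by
  have hu' := (memLp_muG_iff (zero_curvature (a := a))).2 hu
  refine (memLp_nu_iff (zero_curvature (a := a))).1 ?_
  exact (memLp_congr_ae (coeffFun_congr m hu'.coeFn_toLp)).1 (memLp_coeffFun m (hu'.toLp u))

/-- Fubini's theorem for the Fourier coefficients. -/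
lemma integral_mul_conj_phi {a : ℝ} {u : ℝ × ℝ → ℂ} (hu : MemLp u 2 (volume.restrict (Omega0 a)))
    (m : ℤ) {g : ℝ → ℂ} (hg : Continuous g) :
    ∫ x in Omega0 a, u x * ((starRingEnd ℂ) (phi m x.1) * g x.2) =
      ∫ y in J2 a, coeffFun m u y * g y := by
  have hi := integrable_mul_continuous hu (h := fun x => (starRingEnd ℂ) (phi m x.1) * g x.2)
    ((Complex.continuous_conj.comp ((continuous_phi m).comp continuous_fst)).mul
      (hg.comp continuous_snd))
  rw [restrict_Omega0] at hi ⊢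
  rw [integral_prod_symm _ hi]
  refine integral_congr_ae (Filter.Eventually.of_forall fun y => ?_)
  simp only [coeffFun]
  rw [← integral_mul_const]
  refine integral_congr_ae (Filter.Eventually.of_forall fun t => ?_)
  simp only
  ring

/-- Test functions of the form `\bar φ_m ⊗ g` near the closed rectangle. -/
lemma exists_test_phi (m : ℤ) {g : ℝ → ℂ} (hg : IsTest g) : ∃ Φ : ℝ × ℝ → ℂ, IsTest Φ ∧
    ∀ x : ℝ × ℝ, x.1 ∈ Set.Icc (-Real.pi) Real.pi →
      Φ x = (starRingEnd ℂ) (phi m x.1) * g x.2 ∧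
      fderiv ℝ Φ x (0, 1) = (starRingEnd ℂ) (phi m x.1) * fderiv ℝ g x.2 1 ∧
      fderiv ℝ Φ x (1, 0) = -(Complex.I * m) * ((starRingEnd ℂ) (phi m x.1) * g x.2) := by
  obtain ⟨χ, hχ, hχ1⟩ := exists_cutoff Real.pi
  have hf := hχ.mul_contDiff (contDiff_phi (-m))
  refine ⟨_, hf.mul_prod hg, fun x hx => ?_⟩
  obtain ⟨c1, c2⟩ := hχ1 _ hx
  have hd := fderiv_mul_prod (hf.1.differentiable (by simp)) (hg.1.differentiable (by simp)) x
  have e : fderiv ℝ (fun t => χ t * phi (-m) t) x.1 1 = -(Complex.I * m) * phi (-m) x.1 := by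
    have h1 := (hχ.hasDerivAt x.1).mul (hasDerivAt_phi (-m) x.1)
    have h2 := h1.unique (hf.hasDerivAt x.1)
    rw [← h2, c1, c2]
    push_cast
    simp
  refine ⟨by rw [c1, one_mul, conj_phi], ?_, ?_⟩
  · rw [hd]
    simp [c1, conj_phi]
  · rw [hd, e]
    simp [conj_phi]
    ring

lemma HasTraces2.hasEndValues_coeffFun {a : ℝ} {u v : ℝ × ℝ → ℂ} {gm gp : ℝ → ℂ}
    (h : HasTraces2 a u v gm gp) (m : ℤ) :
    HasEndValues a (coeffFun m u) (coeffFun m v) (∫ t in J1, (starRingEnd ℂ) (phi m t) * gm t)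
      (∫ t in J1, (starRingEnd ℂ) (phi m t) * gp t) where
  memLp_fun := memLp_coeffFun_J2 h.memLp_fun m
  memLp_deriv := memLp_coeffFun_J2 h.memLp_deriv m
  green φ hφ := by
    obtain ⟨Φ, hΦ, e⟩ := exists_test_phi m hφ
    have hφ' : Continuous fun y => fderiv ℝ φ y 1 :=
      (hφ.1.continuous_fderiv (by simp)).clm_apply continuous_const
    have key := h.green Φ hΦ
    have e1 : ∫ x in Omega0 a, (u x * fderiv ℝ Φ x (0, 1) + v x * Φ x) =
        ∫ y in J2 a, (coeffFun m u y * fderiv ℝ φ y 1 + coeffFun m v y * φ y) := by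
      rw [integral_add (integrable_mul_of_memLp (memLp_coeffFun_J2 h.memLp_fun m)
          (hφ.memLp_fderiv _ _))
        (integrable_mul_of_memLp (memLp_coeffFun_J2 h.memLp_deriv m) (hφ.memLp _)),
        integral_add (integrable_mul_of_memLp h.memLp_fun (hΦ.memLp_fderiv _ _))
          (integrable_mul_of_memLp h.memLp_deriv (hΦ.memLp _)),
        ← integral_mul_conj_phi h.memLp_fun m hφ',
        ← integral_mul_conj_phi h.memLp_deriv m hφ.1.continuous]
      congr 1
      · refine integral_congr_ae (ae_Omega0_of_forall fun x h1 _ => ?_)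
        simp only [(e x h1).2.1]
      · refine integral_congr_ae (ae_Omega0_of_forall fun x h1 _ => ?_)
        simp only [(e x h1).1]
    have i : ∀ {g : ℝ → ℂ}, MemLp g 2 (volume.restrict J1) →
        Integrable (fun t => (starRingEnd ℂ) (phi m t) * g t) (volume.restrict J1) := by
      intro g hg
      simp only [conj_phi]
      exact integrable_mul_of_memLp (memLp_phi (-m)) hg
    have e2 : ∫ t in J1, (gp t * Φ (t, a) - gm t * Φ (t, -a)) =
        (∫ t in J1, (starRingEnd ℂ) (phi m t) * gp t) * φ a -
          (∫ t in J1, (starRingEnd ℂ) (phi m t) * gm t) * φ (-a) := by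
      rw [← integral_mul_const, ← integral_mul_const, ← integral_sub
        ((i h.memLp_plus).mul_const _) ((i h.memLp_minus).mul_const _)]
      refine integral_congr_ae (ae_restrict_J1_of_forall fun t ht => ?_)
      simp only [(e (t, a) ht).1, (e (t, -a) ht).1]
      ring
    rw [← e1, key, e2]

/-- On periodic functions `∂₁` acts on the `m`-th Fourier coefficient as multiplication by
`i m`. -/
lemma HasTraces1.coeffFun_deriv {a : ℝ} {u v : ℝ × ℝ → ℂ} {gm gp : ℝ → ℂ}
    (h : HasTraces1 a u v gm gp) (hg : gm =ᵐ[volume.restrict (J2 a)] gp) (m : ℤ) :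
    coeffFun m v =ᵐ[volume.restrict (J2 a)] fun y => Complex.I * m * coeffFun m u y := by
  have mu := memLp_coeffFun_J2 h.memLp_fun m
  have mv := memLp_coeffFun_J2 h.memLp_deriv m
  have hz : (fun y => coeffFun m v y - Complex.I * m * coeffFun m u y)
      =ᵐ[volume.restrict (J2 a)] fun _ => 0 := by
    refine ae_eq_zero_of_integral_test (mv.sub (mu.const_mul _)) fun φ hφ _ => ?_
    obtain ⟨Φ, hΦ, e⟩ := exists_test_phi m hφ
    have key := h.green Φ hΦ
    have e2 : ∫ y in J2 a, (gp y * Φ (Real.pi, y) - gm y * Φ (-Real.pi, y)) = 0 := by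
      rw [← integral_zero ℝ ℂ (μ := volume.restrict (J2 a))]
      refine integral_congr_ae ?_
      filter_upwards [hg] with y hy
      have hp := Real.pi_pos
      rw [(e (Real.pi, y) ⟨by simp only; linarith, le_rfl⟩).1,
        (e (-Real.pi, y) ⟨le_rfl, by simp only; linarith⟩).1, hy]
      simp only [phi_add_pi, sub_self]
    have e1 : ∫ x in Omega0 a, (u x * fderiv ℝ Φ x (1, 0) + v x * Φ x) =
        ∫ y in J2 a, (coeffFun m v y - Complex.I * m * coeffFun m u y) * φ y := by
      have s : ∀ y, (coeffFun m v y - Complex.I * m * coeffFun m u y) * φ y =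
          (-(Complex.I * m)) * (coeffFun m u y * φ y) + coeffFun m v y * φ y := fun y => by ring
      simp only [s]
      rw [integral_lin _ (integrable_mul_of_memLp mu (hφ.memLp _))
          (integrable_mul_of_memLp mv (hφ.memLp _)),
        integral_add (integrable_mul_of_memLp h.memLp_fun (hΦ.memLp_fderiv _ _))
          (integrable_mul_of_memLp h.memLp_deriv (hΦ.memLp _)),
        ← integral_mul_conj_phi h.memLp_fun m hφ.1.continuous,
        ← integral_mul_conj_phi h.memLp_deriv m hφ.1.continuous, ← integral_const_mul]
      congr 1
      · refine integral_congr_ae (ae_Omega0_of_forall fun x h1 _ => ?_)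
        simp only [(e x h1).2.2]
        ring
      · refine integral_congr_ae (ae_Omega0_of_forall fun x h1 _ => ?_)
        simp only [(e x h1).1]
    rw [← e1, key, e2]
  filter_upwards [hz] with y hy
  exact sub_eq_zero.1 hy

lemma coeffFun_action2 {K : SignType} {a : ℝ} {u2 u11 u22 : ℝ × ℝ → ℂ}
    (h2 : MemLp u2 2 (muG K a)) (h11 : MemLp u11 2 (muG K a)) (h22 : MemLp u22 2 (muG K a))
    (m : ℤ) : coeffFun m (action2 K u2 u11 u22) =ᵐ[nu K a] fun y =>
      -(((warp K y ^ 2)⁻¹ : ℝ) : ℂ) * coeffFun m u11 y - coeffFun m u22 y -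
        (drift K y : ℂ) * coeffFun m u2 y := by
  have hi : ∀ {u : ℝ × ℝ → ℂ}, MemLp u 2 (muG K a) → ∀ᵐ y ∂(nu K a),
      Integrable (fun t => (starRingEnd ℂ) (phi m t) * u (t, y)) (volume.restrict J1) := by
    intro u hu
    have h1 : Integrable (fun x : ℝ × ℝ => (starRingEnd ℂ) (phi m x.1) * u x)
        ((volume.restrict J1).prod (nu K a)) :=
      (integrable_coeff m (hu.toLp u)).congr (by
        filter_upwards [hu.coeFn_toLp] with x hx
        rw [hx])
    exact h1.prod_left_ae
  filter_upwards [hi h2, hi h11, hi h22] with y i2 i11 i22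
  have i3 : Integrable (fun t => -(((warp K y ^ 2)⁻¹ : ℝ) : ℂ) * ((starRingEnd ℂ) (phi m t) *
      u11 (t, y)) - (starRingEnd ℂ) (phi m t) * u22 (t, y)) (volume.restrict J1) :=
    (i11.const_mul _).sub i22
  simp only [coeffFun]
  rw [← integral_const_mul, ← integral_const_mul, ← integral_sub (i11.const_mul _) i22,
    ← integral_sub i3 (i2.const_mul _)]
  refine integral_congr_ae (Filter.Eventually.of_forall fun t => ?_)
  simp only [action2]
  ring

/-- The Fourier coefficients of a function in the domain of `H` belong to the domains of the
transverse operators, and `H` acts on them diagonally. -/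
lemma StripRel.transRel_modeCoeff {K : SignType} {a : ℝ}
    (hK : K = 1 → a < Real.pi / 2) {κ : Coupling} {ψ F : L2Omega K a} (h : StripRel K a κ ψ F)
    (m : ℤ) : TransRel K a κ m (modeCoeff K a m ψ) (modeCoeff K a m F) := by
  obtain ⟨u, u1, u2, u11, u12, u22, hu, W, ⟨⟨gm, gp, p1, q1⟩, ⟨hm, hp, p2, q2⟩⟩,
    ⟨km, kp, lm, lp, t1, t2, hB⟩, hF⟩ := h
  obtain ⟨p, q, r, s, hR⟩ := κ.exists_robin
  have s1 := t1.hasEndValues_coeffFun m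
  have s2 := t2.hasEndValues_coeffFun m
  refine ⟨_, _, _, (modeCoeff_ae m ψ).trans (coeffFun_congr m hu), s1.hasWeakDeriv,
    s2.hasWeakDeriv, ⟨_, _, _, _, s1, s2, (hR _ _ _ _).2 ⟨?_, ?_⟩⟩, ?_⟩
  · simp only [conj_phi]
    rw [← integral_const_mul, ← integral_const_mul, ← integral_add
      ((integrable_mul_of_memLp (memLp_phi _) t1.memLp_plus).const_mul _)
      ((integrable_mul_of_memLp (memLp_phi _) t1.memLp_minus).const_mul _)]
    refine integral_congr_ae ?_
    filter_upwards [hB] with t ht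
    rw [((hR _ _ _ _).1 ht).1]
    ring
  · simp only [conj_phi]
    rw [← integral_const_mul, ← integral_const_mul, ← integral_add
      ((integrable_mul_of_memLp (memLp_phi _) t1.memLp_plus).const_mul _)
      ((integrable_mul_of_memLp (memLp_phi _) t1.memLp_minus).const_mul _)]
    refine integral_congr_ae ?_
    filter_upwards [hB] with t ht
    rw [((hR _ _ _ _).1 ht).2]
    ring
  · have m2 := (memLp_muG_iff hK).2 t1.memLp_deriv
    have m22 := (memLp_muG_iff hK).2 t2.memLp_deriv
    have m11 := (memLp_muG_iff hK).2 p2.memLp_deriv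
    filter_upwards [modeCoeff_ae m F, coeffFun_congr m hF, coeffFun_action2 m2 m11 m22 m,
      (nu_ac K a).ae_eq (p1.coeffFun_deriv q1 m), (nu_ac K a).ae_eq (p2.coeffFun_deriv q2 m)]
      with y e1 e2 e3 e4 e5
    rw [e1, e2, e3, action1, e5, e4]
    push_cast
    linear_combination (-(warp K y : ℂ) ^ 2)⁻¹ * (m : ℂ) ^ 2 * coeffFun m u y * Complex.I_sq

/-! ### Green's formulas for Fourier series -/

lemma hasSum_integral_mul {ι α : Type*} [MeasurableSpace α] {μ : Measure α} {G : ι → Lp ℂ 2 μ}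
    {g : Lp ℂ 2 μ} (hG : HasSum G g) {h : α → ℂ} (hh : MemLp h 2 μ) :
    HasSum (fun i => ∫ x, G i x * h x ∂μ) (∫ x, g x * h x ∂μ) := by
  have hc : MemLp (fun x => (starRingEnd ℂ) (h x)) 2 μ := hh.star
  have e : ∀ f : Lp ℂ 2 μ, innerSL ℂ (hc.toLp _) f = ∫ x, f x * h x ∂μ := fun f => by
    rw [innerSL_apply_apply, L2.inner_def]
    refine integral_congr_ae ?_
    filter_upwards [hc.coeFn_toLp] with x hx
    rw [RCLike.inner_apply, hx, Complex.conj_conj]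
  simpa only [e] using hG.mapL (innerSL ℂ (hc.toLp _))

section FourierSeries

variable {K : SignType} {a : ℝ}

lemma integral_muG (hK : K = 1 → a < Real.pi / 2) (g : ℝ × ℝ → ℂ) :
    ∫ x, g x ∂(muG K a) = ∫ x in Omega0 a, warp K x.2 • g x := by
  have hm : Measurable fun x : ℝ × ℝ => ENNReal.ofReal (warp K x.2) :=
    ENNReal.measurable_ofReal.comp ((continuous_warp K).comp continuous_snd).measurable
  rw [muG_eq, integral_withDensity_eq_integral_toReal_smul hm
    (Filter.Eventually.of_forall fun y => ENNReal.ofReal_lt_top)]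
  refine integral_congr_ae (ae_restrict_Omega0_of_forall fun y hy => ?_)
  simp only [ENNReal.toReal_ofReal (warp_pos_Icc hK hy).le]

lemma measurable_warp_inv (K : SignType) :
    Measurable fun x : ℝ × ℝ => (((warp K x.2)⁻¹ : ℝ) : ℂ) :=
  Complex.measurable_ofReal.comp ((continuous_warp K).measurable.comp measurable_snd).inv

lemma hasSum_integral_Omega0 (hK : K = 1 → a < Real.pi / 2) {ι : Type*} {G : ι → L2Omega K a}
    {g : L2Omega K a} (hG : HasSum G g) {h : ℝ × ℝ → ℂ}
    (hh : MemLp h 2 (volume.restrict (Omega0 a))) :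
    HasSum (fun i => ∫ x in Omega0 a, G i x * h x) (∫ x in Omega0 a, g x * h x) := by
  obtain ⟨c, C, hc, -, hcC⟩ := exists_coeff_bounds K hK
  have hk : MemLp (fun x => (((warp K x.2)⁻¹ : ℝ) : ℂ) * h x) 2 (muG K a) := by
    rw [memLp_muG_iff hK]
    refine hh.of_le_mul (c := c⁻¹)
      ((measurable_warp_inv K).aestronglyMeasurable.mul hh.1)
      (ae_restrict_Omega0_of_forall fun x hx => ?_)
    rw [norm_mul, Complex.norm_real, Real.norm_of_nonneg (inv_nonneg.2 (warp_pos_Icc hK hx).le)]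
    exact mul_le_mul_of_nonneg_right (inv_anti₀ hc (hcC _ hx).1) (norm_nonneg _)
  have e : ∀ f : ℝ × ℝ → ℂ, ∫ x, f x * ((((warp K x.2)⁻¹ : ℝ) : ℂ) * h x) ∂(muG K a) =
      ∫ x in Omega0 a, f x * h x := by
    intro f
    rw [integral_muG hK]
    refine integral_congr_ae (ae_restrict_Omega0_of_forall fun x hx => ?_)
    have hne : (warp K x.2 : ℂ) ≠ 0 := by exact_mod_cast (warp_pos_Icc hK hx).ne'
    simp only [Complex.real_smul, Complex.ofReal_inv]
    field_simp
  simpa only [e] using hasSum_integral_mul hG hk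

lemma modeEmb_ae_Omega0 (hK : K = 1 → a < Real.pi / 2) (m : ℤ) (h : L2J2 K a) :
    modeEmb K a m h =ᵐ[volume.restrict (Omega0 a)] fun x => phi m x.1 * h x.2 :=
  (restrict_ac_muG hK).ae_eq (modeEmb_ae m h)

lemma memLp_Omega0 (hK : K = 1 → a < Real.pi / 2) (Ψ : L2Omega K a) :
    MemLp Ψ 2 (volume.restrict (Omega0 a)) :=
  (memLp_muG_iff hK).1 (Lp.memLp Ψ)

lemma memLp_L2J2 (hK : K = 1 → a < Real.pi / 2) (h : L2J2 K a) :
    MemLp h 2 (volume.restrict (J2 a)) :=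
  (memLp_nu_iff hK).1 (Lp.memLp h)

lemma hasFDerivAt_slice {Φ : ℝ × ℝ → ℂ} (hΦ : Differentiable ℝ Φ) (t y : ℝ) :
    HasDerivAt (fun y => Φ (t, y)) (fderiv ℝ Φ (t, y) (0, 1)) y ∧
      HasDerivAt (fun t => Φ (t, y)) (fderiv ℝ Φ (t, y) (1, 0)) t := by
  constructor
  · exact (hΦ (t, y)).hasFDerivAt.comp_hasDerivAt y
      ((hasDerivAt_const y t).prodMk (hasDerivAt_id y))
  · exact (hΦ (t, y)).hasFDerivAt.comp_hasDerivAt t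
      ((hasDerivAt_id t).prodMk (hasDerivAt_const t y))

lemma IsTest.slice {Φ : ℝ × ℝ → ℂ} (hΦ : IsTest Φ) (t : ℝ) : IsTest fun y => Φ (t, y) := by
  refine ⟨hΦ.1.comp (contDiff_const.prodMk contDiff_id), ?_⟩
  refine HasCompactSupport.intro (hΦ.2.isCompact.image continuous_snd) fun y hy => ?_
  by_contra h
  exact hy ⟨(t, y), subset_tsupport _ h, rfl⟩

/-- Green's formula in `x₂` for a single mode. -/
lemma green2_mode (hK : K = 1 → a < Real.pi / 2) (m : ℤ) {U V : L2J2 K a} {p q : ℂ}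
    (h : HasEndValues a U V p q) {Φ : ℝ × ℝ → ℂ} (hΦ : IsTest Φ) :
    ∫ x in Omega0 a, (modeEmb K a m U x * fderiv ℝ Φ x (0, 1) + modeEmb K a m V x * Φ x) =
      ∫ t in J1, (q * phi m t * Φ (t, a) - p * phi m t * Φ (t, -a)) := by
  have e : ∫ x in Omega0 a, (modeEmb K a m U x * fderiv ℝ Φ x (0, 1) + modeEmb K a m V x * Φ x) =
      ∫ x in Omega0 a, phi m x.1 * (U x.2 * fderiv ℝ Φ x (0, 1) + V x.2 * Φ x) := by
    refine integral_congr_ae ?_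
    filter_upwards [modeEmb_ae_Omega0 hK m U, modeEmb_ae_Omega0 hK m V] with x h1 h2
    rw [h1, h2]
    ring
  have hi : Integrable (fun x : ℝ × ℝ => phi m x.1 * (U x.2 * fderiv ℝ Φ x (0, 1) + V x.2 * Φ x))
      (volume.restrict (Omega0 a)) := by
    refine (integrable_mul_add (memLp_Omega0 hK (modeEmb K a m U)) (hΦ.memLp_fderiv (0, 1) _)
      (memLp_Omega0 hK (modeEmb K a m V)) (hΦ.memLp _)).congr ?_
    filter_upwards [modeEmb_ae_Omega0 hK m U, modeEmb_ae_Omega0 hK m V] with x h1 h2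
    rw [h1, h2]
    ring
  rw [e]
  rw [restrict_Omega0] at hi ⊢
  rw [integral_prod _ hi]
  refine integral_congr_ae (Filter.Eventually.of_forall fun t => ?_)
  have hs := hΦ.slice t
  have h1 := h.green _ hs
  have h2 : ∀ y, fderiv ℝ (fun y => Φ (t, y)) y 1 = fderiv ℝ Φ (t, y) (0, 1) := fun y =>
    (hs.hasDerivAt y).unique (hasFDerivAt_slice (hΦ.1.differentiable (by simp)) t y).1
  simp only [h2] at h1
  simp only
  rw [integral_const_mul, h1]
  ring

/-- Green's formula in `x₁` for a single mode. -/
lemma green1_mode (hK : K = 1 → a < Real.pi / 2) (m : ℤ) (U : L2J2 K a) {Φ : ℝ × ℝ → ℂ}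
    (hΦ : IsTest Φ) :
    ∫ x in Omega0 a, (modeEmb K a m U x * fderiv ℝ Φ x (1, 0) +
        modeEmb K a m ((Complex.I * m : ℂ) • U) x * Φ x) =
      ∫ y in J2 a, (phi m Real.pi * U y) * (Φ (Real.pi, y) - Φ (-Real.pi, y)) := by
  have e : (fun x => modeEmb K a m U x * fderiv ℝ Φ x (1, 0) +
        modeEmb K a m ((Complex.I * m : ℂ) • U) x * Φ x) =ᵐ[volume.restrict (Omega0 a)]
      fun x => U x.2 * (Complex.I * m * phi m x.1 * Φ x + phi m x.1 * fderiv ℝ Φ x (1, 0)) := by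
    rw [map_smul]
    filter_upwards [modeEmb_ae_Omega0 hK m U,
      (restrict_ac_muG hK).ae_eq (Lp.coeFn_smul (Complex.I * m : ℂ) (modeEmb K a m U))] with x h1 h2
    rw [h2, Pi.smul_apply, h1, smul_eq_mul]
    ring
  have hi := (integrable_mul_add (memLp_Omega0 hK (modeEmb K a m U)) (hΦ.memLp_fderiv (1, 0) _)
      (memLp_Omega0 hK (modeEmb K a m ((Complex.I * m : ℂ) • U))) (hΦ.memLp _)).congr e
  rw [integral_congr_ae e]
  rw [restrict_Omega0] at hi ⊢
  rw [integral_prod_symm _ hi]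
  refine integral_congr_ae (Filter.Eventually.of_forall fun y => ?_)
  simp only
  have hc : Continuous fun t => Complex.I * m * phi m t * Φ (t, y) +
      phi m t * fderiv ℝ Φ (t, y) (1, 0) := by
    have h1 : Continuous fun t : ℝ => Φ (t, y) := hΦ.1.continuous.comp (by fun_prop)
    have h2 : Continuous fun t : ℝ => fderiv ℝ Φ (t, y) (1, 0) :=
      ((hΦ.1.continuous_fderiv (by simp)).comp (by fun_prop : Continuous fun t : ℝ => (t, y))).clm_apply
        continuous_const
    exact ((continuous_const.mul (continuous_phi m)).mul h1).add ((continuous_phi m).mul h2)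
  rw [integral_const_mul, integral_J1_eq, intervalIntegral.integral_eq_sub_of_hasDerivAt
    (fun t _ => (hasDerivAt_phi m t).mul
      (hasFDerivAt_slice (hΦ.1.differentiable (by simp)) t y).2) (hc.intervalIntegrable _ _)]
  simp only [Pi.mul_apply, phi_add_pi]
  ring

/-- Traces of a Fourier series on the sides `x₂ = ± a`. -/
lemma hasTraces2_of_hasSum (hK : K = 1 → a < Real.pi / 2) {U V : ℤ → L2J2 K a} {p q : ℤ → ℂ}
    (h : ∀ m, HasEndValues a (U m) (V m) (p m) (q m)) {u v : L2Omega K a} {gm gp : L2J1}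
    (hu : HasSum (fun m => modeEmb K a m (U m)) u) (hv : HasSum (fun m => modeEmb K a m (V m)) v)
    (hm : HasSum (fun m => p m • phiL2 m) gm) (hp : HasSum (fun m => q m • phiL2 m) gp) :
    HasTraces2 a u v gm gp where
  memLp_fun := memLp_Omega0 hK u
  memLp_deriv := memLp_Omega0 hK v
  memLp_minus := Lp.memLp gm
  memLp_plus := Lp.memLp gp
  green Φ hΦ := by
    have s1 := hasSum_integral_Omega0 hK hu (hΦ.memLp_fderiv (0, 1) _)
    have s2 := hasSum_integral_Omega0 hK hv (hΦ.memLp _)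
    have s3 := hasSum_integral_mul hp (hΦ.memLp_slice2 a)
    have s4 := hasSum_integral_mul hm (hΦ.memLp_slice2 (-a))
    rw [integral_add (integrable_mul_of_memLp (memLp_Omega0 hK u) (hΦ.memLp_fderiv _ _))
      (integrable_mul_of_memLp (memLp_Omega0 hK v) (hΦ.memLp _)),
      integral_sub (integrable_mul_of_memLp (Lp.memLp gp) (hΦ.memLp_slice2 a))
        (integrable_mul_of_memLp (Lp.memLp gm) (hΦ.memLp_slice2 (-a)))]
    refine (s1.add s2).unique ((s3.sub s4).congr_fun fun m => ?_)
    rw [← integral_add (integrable_mul_of_memLp (memLp_Omega0 hK _) (hΦ.memLp_fderiv _ _))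
      (integrable_mul_of_memLp (memLp_Omega0 hK _) (hΦ.memLp _)), green2_mode hK m (h m) hΦ,
      ← integral_sub (integrable_mul_of_memLp (Lp.memLp _) (hΦ.memLp_slice2 a))
        (integrable_mul_of_memLp (Lp.memLp _) (hΦ.memLp_slice2 (-a)))]
    refine integral_congr_ae ?_
    filter_upwards [Lp.coeFn_smul (q m) (phiL2 m), Lp.coeFn_smul (p m) (phiL2 m),
      (memLp_phi m).coeFn_toLp] with t e1 e2 e3
    rw [e1, e2, Pi.smul_apply, Pi.smul_apply, smul_eq_mul, smul_eq_mul, phiL2, e3]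

/-- A Fourier series that may be differentiated termwise in `x₁` is periodic. -/
lemma exists_hasTraces1_of_hasSum (hK : K = 1 → a < Real.pi / 2) {U : ℤ → L2J2 K a}
    (hU : Summable fun m => ‖U m‖) {u v : L2Omega K a}
    (hu : HasSum (fun m => modeEmb K a m (U m)) u)
    (hv : HasSum (fun m => modeEmb K a m ((Complex.I * m : ℂ) • U m)) v) :
    ∃ g : ℝ → ℂ, HasTraces1 a u v g g := by
  have hs : Summable fun m => phi m Real.pi • U m := by
    refine Summable.of_norm ?_
    simp only [norm_smul, norm_phi]
    exact hU.mul_left _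
  obtain ⟨g, hg⟩ := hs
  refine ⟨g, memLp_Omega0 hK u, memLp_Omega0 hK v, memLp_L2J2 hK g, memLp_L2J2 hK g,
    fun Φ hΦ => ?_⟩
  obtain ⟨c, C, hc, -, hcC⟩ := exists_coeff_bounds K hK
  set D : ℝ → ℂ := fun y => Φ (Real.pi, y) - Φ (-Real.pi, y) with hD
  have hDc : Continuous D := (hΦ.1.continuous.comp (by fun_prop)).sub
    (hΦ.1.continuous.comp (by fun_prop))
  have hDw : MemLp (fun y => (((warp K y)⁻¹ : ℝ) : ℂ) * D y) 2 (nu K a) := by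
    rw [memLp_nu_iff hK]
    exact memLp_J2_of_continuousOn ((Complex.continuous_ofReal.comp_continuousOn
      ((continuous_warp K).continuousOn.inv₀ fun y hy => (warp_pos_Icc hK hy).ne')).mul
        hDc.continuousOn)
  have e : ∀ f : ℝ → ℂ, ∫ y, f y * ((((warp K y)⁻¹ : ℝ) : ℂ) * D y) ∂(nu K a) =
      ∫ y in J2 a, f y * D y := by
    intro f
    rw [integral_nu hK]
    refine integral_congr_ae (ae_restrict_J2_of_forall fun y hy => ?_)
    have hne : (warp K y : ℂ) ≠ 0 := by exact_mod_cast (warp_pos_Icc hK hy).ne'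
    simp only [Complex.real_smul, Complex.ofReal_inv]
    field_simp
  have s1 := hasSum_integral_Omega0 hK hu (hΦ.memLp_fderiv (1, 0) _)
  have s2 := hasSum_integral_Omega0 hK hv (hΦ.memLp _)
  have s3 := hasSum_integral_mul hg hDw
  simp only [e] at s3
  have e2 : ∫ y in J2 a, (g y * Φ (Real.pi, y) - g y * Φ (-Real.pi, y)) =
      ∫ y in J2 a, g y * D y := by
    simp only [hD, mul_sub]
  rw [integral_add (integrable_mul_of_memLp (memLp_Omega0 hK u) (hΦ.memLp_fderiv _ _))
      (integrable_mul_of_memLp (memLp_Omega0 hK v) (hΦ.memLp _)), e2]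
  refine (s1.add s2).unique (s3.congr_fun fun m => ?_)
  rw [← integral_add (integrable_mul_of_memLp (memLp_Omega0 hK _) (hΦ.memLp_fderiv _ _))
    (integrable_mul_of_memLp (memLp_Omega0 hK _) (hΦ.memLp _)), green1_mode hK m (U m) hΦ]
  refine integral_congr_ae ?_
  filter_upwards [(restrict_ac_nu hK).ae_eq (Lp.coeFn_smul (phi m Real.pi) (U m))] with y hy
  rw [hy, Pi.smul_apply, smul_eq_mul]

lemma HasTraces1.hasWeakDeriv {u v : ℝ × ℝ → ℂ} {gm gp : ℝ → ℂ} (h : HasTraces1 a u v gm gp) :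
    HasWeakDeriv (Omega0 a) (1, 0) u v where
  memLp_fun := h.memLp_fun
  memLp_deriv := h.memLp_deriv
  integral_eq φ hφ hU := by
    have h1 := h.green φ hφ
    have z1 : ∀ y, φ (Real.pi, y) = 0 := fun y =>
      image_eq_zero_of_notMem_tsupport fun hx => lt_irrefl _ (hU hx).1.2
    have z2 : ∀ y, φ (-Real.pi, y) = 0 := fun y =>
      image_eq_zero_of_notMem_tsupport fun hx => lt_irrefl _ (hU hx).1.1
    simp only [z1, z2, mul_zero, sub_zero, integral_zero] at h1
    rw [integral_add (integrable_mul_of_memLp h.memLp_fun (hφ.memLp_fderiv _ _))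
      (integrable_mul_of_memLp h.memLp_deriv (hφ.memLp _))] at h1
    exact eq_neg_of_add_eq_zero_left h1

lemma HasTraces2.hasWeakDeriv {u v : ℝ × ℝ → ℂ} {gm gp : ℝ → ℂ} (h : HasTraces2 a u v gm gp) :
    HasWeakDeriv (Omega0 a) (0, 1) u v where
  memLp_fun := h.memLp_fun
  memLp_deriv := h.memLp_deriv
  integral_eq φ hφ hU := by
    have h1 := h.green φ hφ
    have z1 : ∀ t, φ (t, a) = 0 := fun t =>
      image_eq_zero_of_notMem_tsupport fun hx => lt_irrefl _ (hU hx).2.2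
    have z2 : ∀ t, φ (t, -a) = 0 := fun t =>
      image_eq_zero_of_notMem_tsupport fun hx => lt_irrefl _ (hU hx).2.1
    simp only [z1, z2, mul_zero, sub_zero, integral_zero] at h1
    rw [integral_add (integrable_mul_of_memLp h.memLp_fun (hφ.memLp_fderiv _ _))
      (integrable_mul_of_memLp h.memLp_deriv (hφ.memLp _))] at h1
    exact eq_neg_of_add_eq_zero_left h1

end FourierSeries

/-! ### The resolvent of the two-dimensional Hamiltonian -/

section StripResolvent

variable {K : SignType} {a : ℝ} {κ : Coupling}

lemma memLp_muG_mul_of_continuousOn (hK : K = 1 → a < Real.pi / 2) {k : ℝ → ℝ}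
    (hk : ContinuousOn k (Set.Icc (-a) a)) {u : ℝ × ℝ → ℂ} (hu : MemLp u 2 (muG K a)) :
    MemLp (fun x => (k x.2 : ℂ) * u x) 2 (muG K a) := by
  rw [memLp_muG_iff hK] at hu ⊢
  obtain ⟨C, hC⟩ := isCompact_Icc.exists_bound_of_continuousOn hk
  have hm : ContinuousOn (fun x : ℝ × ℝ => (k x.2 : ℂ)) (Omega0 a) :=
    Complex.continuous_ofReal.comp_continuousOn
      (hk.comp continuousOn_snd fun x hx => ⟨hx.2.1.le, hx.2.2.le⟩)
  refine hu.of_le_mul (c := C)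
    ((hm.aestronglyMeasurable (isOpen_Omega0 a).measurableSet).mul hu.1)
    (ae_restrict_Omega0_of_forall fun x hx => ?_)
  rw [norm_mul, Complex.norm_real]
  exact mul_le_mul_of_nonneg_right (hC _ hx) (norm_nonneg _)

lemma memLp_action2 (hK : K = 1 → a < Real.pi / 2) {u2 u11 u22 : ℝ × ℝ → ℂ}
    (h2 : MemLp u2 2 (muG K a)) (h11 : MemLp u11 2 (muG K a)) (h22 : MemLp u22 2 (muG K a)) :
    MemLp (action2 K u2 u11 u22) 2 (muG K a) := by
  have hk : ContinuousOn (fun y => -(warp K y ^ 2)⁻¹) (Set.Icc (-a) a) :=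
    (((continuous_warp K).pow 2).continuousOn.inv₀
      fun y hy => (pow_pos (warp_pos_Icc hK hy) 2).ne').neg
  convert ((memLp_muG_mul_of_continuousOn hK hk h11).sub h22).sub
    (memLp_muG_mul_of_continuousOn hK (continuousOn_drift hK) h2) using 1
  funext x
  simp only [action2, Pi.sub_apply, Complex.ofReal_neg]

lemma summable_one_add_sq_inv : Summable fun m : ℤ => (1 + (m : ℝ) ^ 2)⁻¹ := by
  have h := Real.summable_one_div_int_pow (p := 2) |>.2 one_lt_two
  refine Summable.of_norm_bounded_eventually (g := fun m : ℤ => 1 / (m : ℝ) ^ 2) h ?_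
  rw [Filter.eventually_cofinite]
  refine (Set.finite_singleton (0 : ℤ)).subset fun m hm => ?_
  by_contra hne
  have hpos : 0 < (m : ℝ) ^ 2 := by
    have : (m : ℝ) ≠ 0 := by exact_mod_cast hne
    positivity
  refine hm ?_
  rw [Real.norm_of_nonneg (by positivity), one_div]
  exact inv_anti₀ hpos (by linarith)

/-- A weight `w = 1 + m²` improves square summability to summability, as `2 x ≤ w x² + w⁻¹`. -/
lemma summable_of_weighted_sq {x g : ℤ → ℝ} (hg : Summable g) (hx0 : ∀ m, 0 ≤ x m)
    (hx : ∀ m : ℤ, (1 + (m : ℝ) ^ 2) * x m ^ 2 ≤ g m) : Summable x := by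
  refine Summable.of_nonneg_of_le hx0 (fun m => ?_) (hg.add summable_one_add_sq_inv)
  have hw : 0 < 1 + (m : ℝ) ^ 2 := by positivity
  have h1 : 0 ≤ (1 + (m : ℝ) ^ 2)⁻¹ := by positivity
  have h2 : (1 + (m : ℝ) ^ 2) * (x m - (1 + (m : ℝ) ^ 2)⁻¹) ^ 2 =
      (1 + (m : ℝ) ^ 2) * x m ^ 2 - 2 * x m + (1 + (m : ℝ) ^ 2)⁻¹ := by
    field_simp
    ring
  have h3 : 0 ≤ (1 + (m : ℝ) ^ 2) * (x m - (1 + (m : ℝ) ^ 2)⁻¹) ^ 2 := by positivity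
  linarith [hx m, hx0 m]

lemma summable_sq_of_weighted_sq {x g : ℤ → ℝ} (hg : Summable g)
    (hx : ∀ m : ℤ, (1 + (m : ℝ) ^ 2) * x m ^ 2 ≤ g m) : Summable fun m => x m ^ 2 := by
  refine Summable.of_nonneg_of_le (fun m => sq_nonneg _) (fun m => ?_) hg
  have h : 1 * x m ^ 2 ≤ (1 + (m : ℝ) ^ 2) * x m ^ 2 :=
    mul_le_mul_of_nonneg_right (by linarith [sq_nonneg (m : ℝ)]) (sq_nonneg _)
  linarith [hx m]

lemma exists_hasSum_smul_phiL2 {p : ℤ → ℂ} (h : Summable fun m => ‖p m‖ ^ 2) :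
    ∃ g : L2J1, HasSum (fun m => p m • phiL2 m) g := by
  have h1 := (orthonormal_phiL2.orthogonalFamily.summable_iff_norm_sq_summable p).2 h
  simp only [LinearIsometry.toSpanSingleton_apply] at h1
  exact h1

lemma norm_I_mul_int (m : ℤ) : ‖(Complex.I * m : ℂ)‖ = |(m : ℝ)| := by
  rw [norm_mul, Complex.norm_I, one_mul, Complex.norm_intCast]

lemma norm_I_mul_int_smul_sq (m : ℤ) (h : L2J2 K a) :
    ‖(Complex.I * m : ℂ) • h‖ ^ 2 = (m : ℝ) ^ 2 * ‖h‖ ^ 2 := by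
  rw [norm_smul, mul_pow, norm_I_mul_int, sq_abs]

lemma HasEndValues.smul (hK : K = 1 → a < Real.pi / 2) {U V : L2J2 K a} {p q : ℂ}
    (h : HasEndValues a U V p q) (c : ℂ) :
    HasEndValues a (c • U : L2J2 K a) (c • V : L2J2 K a) (c * p) (c * q) := by
  have h1 := h.lin c (HasEndValues.zero a)
  rw [add_zero, add_zero] at h1
  refine h1.congr ?_ ?_
  · filter_upwards [(restrict_ac_nu hK).ae_eq (Lp.coeFn_smul c U)] with y hy
    rw [hy, Pi.smul_apply, smul_eq_mul, add_zero]
  · filter_upwards [(restrict_ac_nu hK).ae_eq (Lp.coeFn_smul c V)] with y hy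
    rw [hy, Pi.smul_apply, smul_eq_mul, add_zero]

/-- The boundary conditions pass from the Fourier modes to the sum of the series. -/
lemma couplingBC_of_hasSum (hK : K = 1 → a < Real.pi / 2) {ψ U1 U2 F : ℤ → L2J2 K a}
    {gm gp hm hp : ℤ → ℂ}
    (hs : ∀ m, IsTransSolution K a κ m (ψ m) (U1 m) (U2 m) (F m) (gm m) (gp m) (hm m) (hp m))
    (sm : Summable fun m => ‖gm m‖ ^ 2) (sp : Summable fun m => ‖gp m‖ ^ 2)
    {u u2 u22 : L2Omega K a} (hu : HasSum (fun m => modeEmb K a m (ψ m)) u)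
    (hu2 : HasSum (fun m => modeEmb K a m (U1 m)) u2)
    (hu22 : HasSum (fun m => modeEmb K a m (U2 m)) u22) : CouplingBC κ a u u2 u22 := by
  obtain ⟨p, q, r, s, hR⟩ := κ.exists_robin
  obtain ⟨Gm, hGm⟩ := exists_hasSum_smul_phiL2 sm
  obtain ⟨Gp, hGp⟩ := exists_hasSum_smul_phiL2 sp
  have hHp : HasSum (fun m => hp m • phiL2 m) (p • Gp + q • Gm) := by
    refine ((hGp.const_smul p).add (hGm.const_smul q)).congr_fun fun m => ?_
    rw [((hR _ _ _ _).1 (hs m).holds).1, add_smul, mul_smul, mul_smul]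
  have hHm : HasSum (fun m => hm m • phiL2 m) (r • Gp + s • Gm) := by
    refine ((hGp.const_smul r).add (hGm.const_smul s)).congr_fun fun m => ?_
    rw [((hR _ _ _ _).1 (hs m).holds).2, add_smul, mul_smul, mul_smul]
  refine ⟨Gm, Gp, _, _, hasTraces2_of_hasSum hK (fun m => (hs m).ends) hu hu2 hGm hGp,
    hasTraces2_of_hasSum hK (fun m => (hs m).ends_deriv) hu2 hu22 hHm hHp, ?_⟩
  filter_upwards [Lp.coeFn_add (p • Gp) (q • Gm), Lp.coeFn_add (r • Gp) (s • Gm),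
    Lp.coeFn_smul p Gp, Lp.coeFn_smul q Gm, Lp.coeFn_smul r Gp, Lp.coeFn_smul s Gm]
    with t e1 e2 e3 e4 e5 e6
  refine (hR _ _ _ _).2 ⟨?_, ?_⟩
  · rw [e1, Pi.add_apply, e3, e4, Pi.smul_apply, Pi.smul_apply, smul_eq_mul, smul_eq_mul]
  · rw [e2, Pi.add_apply, e5, e6, Pi.smul_apply, Pi.smul_apply, smul_eq_mul, smul_eq_mul]

/-- The differential expression may be applied to a Fourier series termwise. -/
lemma eq_action2_of_hasSum (hK : K = 1 → a < Real.pi / 2) {ψ U1 U2 : ℤ → L2J2 K a}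
    {u2 u11 u22 Φ : L2Omega K a} (hu2 : HasSum (fun m => modeEmb K a m (U1 m)) u2)
    (hu11 : HasSum (fun m : ℤ =>
      modeEmb K a m ((Complex.I * m : ℂ) • (Complex.I * m : ℂ) • ψ m)) u11)
    (hu22 : HasSum (fun m => modeEmb K a m (U2 m)) u22)
    (hΦ : ∀ m, modeCoeff K a m Φ =ᵐ[nu K a] action1 K m (ψ m) (U1 m) (U2 m)) :
    Φ =ᵐ[muG K a] action2 K u2 u11 u22 := by
  have hL := memLp_action2 hK (Lp.memLp u2) (Lp.memLp u11) (Lp.memLp u22)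
  suffices h : Φ = hL.toLp _ by
    conv_lhs => rw [h]
    exact hL.coeFn_toLp
  refine modeEmb_ext fun m => Lp.ext ?_
  have c2 := modeCoeff_ae m u2
  have c11 := modeCoeff_ae m u11
  have c22 := modeCoeff_ae m u22
  rw [modeCoeff_of_hasSum hu2] at c2
  rw [modeCoeff_of_hasSum hu11] at c11
  rw [modeCoeff_of_hasSum hu22] at c22
  filter_upwards [hΦ m, modeCoeff_ae m (hL.toLp _), coeffFun_congr m hL.coeFn_toLp,
    coeffFun_action2 (Lp.memLp u2) (Lp.memLp u11) (Lp.memLp u22) m, c2, c11, c22,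
    Lp.coeFn_smul (Complex.I * m : ℂ) ((Complex.I * m : ℂ) • ψ m),
    Lp.coeFn_smul (Complex.I * m : ℂ) (ψ m)] with y e1 e2 e3 e4 e5 e6 e7 e8 e9
  rw [e1, e2, e3, e4, ← e5, ← e6, ← e7, e8, Pi.smul_apply, e9, Pi.smul_apply, smul_eq_mul,
    smul_eq_mul, action1]
  push_cast
  linear_combination (((warp K y : ℂ) ^ 2)⁻¹ * m ^ 2 * ψ m y) * (Complex.I_sq)

/-- The diagonal operator with entries `(H^m - z)⁻¹` maps into the domain of `H`: the Fourier
series of its values may be differentiated twice termwise. -/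
lemma stripRel_of_hasSum (ha : 0 < a) (hK : K = 1 → a < Real.pi / 2) {z : ℂ}
    (hz : z ∈ commonRho K a κ) {Ψ u : L2Omega K a}
    (hu : HasSum (fun m => modeEmb K a m (resolv (transOp K a κ m) z (modeCoeff K a m Ψ))) u) :
    StripRel K a κ u (Ψ + z • u : L2Omega K a) := by
  obtain ⟨B, hB⟩ := exists_resolv_deriv_bound ha hK hz
  have hex : ∀ m, ∃ (U1 U2 : L2J2 K a) (gm gp hm hp : ℂ), IsTransSolution K a κ m
      (resolv (transOp K a κ m) z (modeCoeff K a m Ψ)) U1 U2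
      (modeCoeff K a m Ψ + z • resolv (transOp K a κ m) z (modeCoeff K a m Ψ)) gm gp hm hp :=
    fun m => ((mem_transGraph_iff hK κ m _ _).1 ((isResolventAt_iff_graph.1
      (resolv_spec (Set.mem_iInter.1 hz m))).1 (modeCoeff K a m Ψ))).exists_solution hK
  choose U1 U2 gm gp hm hp hs using hex
  set ψ : ℤ → L2J2 K a := fun m => resolv (transOp K a κ m) z (modeCoeff K a m Ψ) with hψ
  have hb := fun m => hB m _ _ _ _ _ _ _ (hs m)
  have hg : Summable fun m => B * ‖modeCoeff K a m Ψ‖ ^ 2 :=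
    (hasSum_norm_sq_modeCoeff Ψ).summable.mul_left B
  have hw : ∀ (m : ℤ) (x : ℝ), 0 ≤ x → x ≤ (1 + (m : ℝ) ^ 2) * x ∧
      (m : ℝ) ^ 2 * x ≤ (1 + (m : ℝ) ^ 2) * x := fun m x hx =>
    ⟨by nlinarith [sq_nonneg (m : ℝ)], by nlinarith⟩
  -- each derivative in `x₁` costs a factor `|m|`, i.e. half a power of the weight `1 + m²`
  have b0 : ∀ m : ℤ, (1 + (m : ℝ) ^ 2) * ‖ψ m‖ ^ 2 ≤ B * ‖modeCoeff K a m Ψ‖ ^ 2 := fun m =>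
    ((hw m ((1 + (m : ℝ) ^ 2) * ‖ψ m‖ ^ 2) (by positivity)).1.trans_eq (by ring)).trans (hb m).1
  have b1 : ∀ m : ℤ, (1 + (m : ℝ) ^ 2) * ‖(Complex.I * m : ℂ) • ψ m‖ ^ 2 ≤
      B * ‖modeCoeff K a m Ψ‖ ^ 2 := fun m => by
    rw [norm_I_mul_int_smul_sq]
    exact ((hw m ((1 + (m : ℝ) ^ 2) * ‖ψ m‖ ^ 2) (by positivity)).2.trans_eq' (by ring)).trans
      ((hb m).1.trans_eq' (by ring))
  have b11 : ∀ m : ℤ, ‖(Complex.I * m : ℂ) • (Complex.I * m : ℂ) • ψ m‖ ^ 2 ≤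
      B * ‖modeCoeff K a m Ψ‖ ^ 2 := fun m => by
    rw [norm_I_mul_int_smul_sq]
    exact (hw m _ (by positivity)).2.trans (b1 m)
  have b12 : ∀ m : ℤ, ‖(Complex.I * m : ℂ) • U1 m‖ ^ 2 ≤ B * ‖modeCoeff K a m Ψ‖ ^ 2 :=
    fun m => by
    rw [norm_I_mul_int_smul_sq]
    exact (hw m _ (by positivity)).2.trans (hb m).2.1
  have bm : ∀ m : ℤ, (1 + (m : ℝ) ^ 2) * ‖gm m‖ ^ 2 ≤ B * ‖modeCoeff K a m Ψ‖ ^ 2 := fun m =>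
    (mul_le_mul_of_nonneg_left (le_add_of_nonneg_left (sq_nonneg _)) (by positivity)).trans
      (hb m).2.2.2
  have bp : ∀ m : ℤ, (1 + (m : ℝ) ^ 2) * ‖gp m‖ ^ 2 ≤ B * ‖modeCoeff K a m Ψ‖ ^ 2 := fun m =>
    (mul_le_mul_of_nonneg_left (le_add_of_nonneg_right (sq_nonneg _)) (by positivity)).trans
      (hb m).2.2.2
  have bim : ∀ (p : ℤ → ℂ), (∀ m : ℤ, (1 + (m : ℝ) ^ 2) * ‖p m‖ ^ 2 ≤
      B * ‖modeCoeff K a m Ψ‖ ^ 2) → Summable fun m : ℤ => ‖(Complex.I * m : ℂ) * p m‖ ^ 2 := by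
    intro p h
    refine Summable.of_nonneg_of_le (fun m => sq_nonneg _) (fun m => ?_) hg
    rw [norm_mul, mul_pow, norm_I_mul_int, sq_abs]
    exact (hw m _ (by positivity)).2.trans (h m)
  obtain ⟨u1, hu1⟩ := summable_modeEmb (summable_sq_of_weighted_sq hg b1)
  obtain ⟨u2, hu2⟩ := summable_modeEmb (summable_sq_of_weighted_sq hg fun m => (hb m).2.1)
  obtain ⟨u11, hu11⟩ := summable_modeEmb (hg.of_nonneg_of_le (fun m => sq_nonneg _) b11)
  obtain ⟨u12, hu12⟩ := summable_modeEmb (hg.of_nonneg_of_le (fun m => sq_nonneg _) b12)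
  obtain ⟨u22, hu22⟩ := summable_modeEmb
    (hg.of_nonneg_of_le (fun m => sq_nonneg _) fun m => (hb m).2.2.1)
  obtain ⟨g, t1⟩ := exists_hasTraces1_of_hasSum hK
    (summable_of_weighted_sq hg (fun m => norm_nonneg _) b0) hu hu1
  obtain ⟨h, t2⟩ := exists_hasTraces1_of_hasSum hK
    (summable_of_weighted_sq hg (fun m => norm_nonneg _) b1) hu1 hu11
  obtain ⟨_, t3⟩ := exists_hasTraces1_of_hasSum hK
    (summable_of_weighted_sq hg (fun m => norm_nonneg _) fun m => (hb m).2.1) hu2 hu12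
  have hC : CouplingBC κ a u u2 u22 := couplingBC_of_hasSum hK hs
    (summable_sq_of_weighted_sq hg bm) (summable_sq_of_weighted_sq hg bp) hu hu2 hu22
  obtain ⟨Gm, hGm⟩ := exists_hasSum_smul_phiL2 (bim gm bm)
  obtain ⟨Gp, hGp⟩ := exists_hasSum_smul_phiL2 (bim gp bp)
  have t4 := hasTraces2_of_hasSum hK (fun m : ℤ => (hs m).ends.smul hK (Complex.I * m))
    hu1 hu12 hGm hGp
  have ⟨_, _, _, _, t5, t6, _⟩ := hC
  refine ⟨u, u1, u2, u11, u12, u22, Filter.EventuallyEq.rfl,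
    ⟨t1.hasWeakDeriv, t5.hasWeakDeriv, t2.hasWeakDeriv, t4.hasWeakDeriv, t3.hasWeakDeriv,
      t6.hasWeakDeriv⟩,
    ⟨⟨_, _, t1, Filter.EventuallyEq.rfl⟩, ⟨_, _, t2, Filter.EventuallyEq.rfl⟩⟩,
    hC, eq_action2_of_hasSum hK hu2 hu11 hu22 fun m => ?_⟩
  rw [map_add, map_smul, modeCoeff_of_hasSum hu]
  exact (hs m).eq_action

/-- The diagonal operator with entries `(H^m - z)⁻¹` is the resolvent of `H`. -/
lemma isResolventAt_of_hasSum (ha : 0 < a) (hK : K = 1 → a < Real.pi / 2) {z : ℂ}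
    (hz : z ∈ commonRho K a κ) {R : L2Omega K a →L[ℂ] L2Omega K a}
    (hR : ∀ Ψ, HasSum (fun m => modeEmb K a m (resolv (transOp K a κ m) z (modeCoeff K a m Ψ)))
      (R Ψ)) : IsResolventAt (stripOp K a κ) z R := by
  refine isResolventAt_iff_graph.2 ⟨fun Ψ => (mem_stripGraph_iff hK κ _ _).2
    (stripRel_of_hasSum ha hK hz (hR Ψ)), fun u F h => modeEmb_ext fun m => ?_⟩
  rw [modeCoeff_of_hasSum (hR _), map_sub, map_smul]
  exact (isResolventAt_iff_graph.1 (resolv_spec (Set.mem_iInter.1 hz m))).2 _ _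
    ((mem_transGraph_iff hK κ m _ _).2
      (((mem_stripGraph_iff hK κ _ _).1 h).transRel_modeCoeff hK m))

lemma exists_diagonal_resolv (ha : 0 < a) (hK : K = 1 → a < Real.pi / 2) {z : ℂ}
    (hz : z ∈ commonRho K a κ) : ∃ R : L2Omega K a →L[ℂ] L2Omega K a, ∀ Ψ,
      HasSum (fun m => modeEmb K a m (resolv (transOp K a κ m) z (modeCoeff K a m Ψ))) (R Ψ) := by
  obtain ⟨B, -, hB⟩ := exists_resolv_bound ha hK hz
  refine exists_diagonal (B := B) fun m h => le_trans ?_ (hB m h)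
  nlinarith [norm_nonneg (resolv (transOp K a κ m) z h), sq_nonneg (m : ℝ),
    mul_nonneg (sq_nonneg (m : ℝ)) (norm_nonneg (resolv (transOp K a κ m) z h))]

end StripResolvent

end PTStrip

end

theorem proposition4p1 (K : SignType) (a : ℝ) (ha : 0 < a) (haK : K = 1 → a < Real.pi / 2)
    (κ : PTStrip.Coupling) :
    (PTStrip.commonRho K a κ).Nonempty ∧
    PTStrip.commonRho K a κ ⊆ PTStrip.rho (PTStrip.stripOp K a κ) ∧
    ∀ z ∈ PTStrip.commonRho K a κ,
      ∃ T : ℤ → (PTStrip.L2Omega K a →L[ℂ] PTStrip.L2Omega K a),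
        (∀ m, PTStrip.IsOneTensor (PTStrip.resolv (PTStrip.transOp K a κ m) z) (T m)) ∧
        PTStrip.IsDirectSum (PTStrip.modeProj K a) T (PTStrip.resolv (PTStrip.stripOp K a κ) z) := by
  refine ⟨PTStrip.commonRho_nonempty ha haK κ, fun z hz => ?_, fun z hz => ?_⟩
  · obtain ⟨R, hR⟩ := PTStrip.exists_diagonal_resolv ha haK hz
    exact ⟨R, PTStrip.isResolventAt_of_hasSum ha haK hz hR⟩
  · obtain ⟨R, hR⟩ := PTStrip.exists_diagonal_resolv ha haK hz
    have h := PTStrip.isResolventAt_of_hasSum ha haK hz hR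
    choose T hT hTm using fun m =>
      PTStrip.exists_oneTensor (PTStrip.resolv (PTStrip.transOp K a κ m) z)
    refine ⟨T, hT, ?_⟩
    rw [(PTStrip.resolv_spec ⟨R, h⟩).unique h]
    exact PTStrip.isDirectSum_of_diagonal hTm hR
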